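/- Let $d\ge 1$, $m\ge 2$, and write points of $\mathbb R^{md}$ as $\vec u=(u^1,\dots,u^m)$ with $u^j\in\mathbb R^d$. Let $M\subset\mathbb R^{md}$ be a compact embedded $C^\infty$ submanifold (without boundary) of codimension $l$, let $\sigma_M$ be its surface measure, let $\psi:\mathbb R^{md}\to\mathbb C$ be smooth, and let $\nu=\psi\,\sigma_M$. Let $H_0=\{(x,\dots,x):x\in\mathbb R^d\}\subset\mathbb R^{md}$ be the diagonal, and for a function $F$ on $\mathbb R^{md}$ put $$\|F\|_{\Lambda^{H_0}_{2,\infty}}=\operatorname*{ess\,sup}_{\xi\in H_0}\Big(\int_{\xi+H_0^\perp}|\widehat F(\zeta)|^2\,d\zeta\Big)^{1/2},\qquad \widehat F(\zeta)=\int e^{-2\pi i\vec u\cdot\zeta}F(\vec u)\,d\vec u ,$$ the inner integral being with respect to $(m-1)d$-dimensional Lebesgue measure. Fix a smooth dyadic partition of unity on frequency space: real-valued functions $\phi_0,\phi\in C_c^\infty(\mathbb R^{md})$ with $0\notin\operatorname{supp}\phi$ and $\phi_0(\zeta)+\sum_{j\ge1}\phi(2^{-j}\zeta)=1$ for all $\zeta$;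 put $\phi_j=\phi(2^{-j}\cdot)$ for $j\ge 1$, and let $\nu_j$ be the Littlewood–Paley component of $\nu$ given by $\widehat{\nu_j}=\phi_j\widehat\nu$, $j\ge0$. Suppose that for some $\gamma>0$ and some constant $C$ $$\|\nu_j\|_{\Lambda^{H_0}_{2,\infty}}\le C\,2^{-j\gamma}\qquad\text{for all } j\ge 0 .$$ For Schwartz functions $f_1,\dots,f_m$ on $\mathbb R^d$ define $$B_\nu(f_1,\dots,f_m)(x)=\int_{\mathbb R^{md}} f_1(x-u^1)\cdots f_m(x-u^m)\,d\nu(\vec u).$$ Then: 1. $B_\nu$ extends to a bounded $m$-linear operator $L^2(\mathbb R^d)\times\cdots\times L^2(\mathbb R^d)\to L^2_\gamma(\mathbb R^d)$, where $L^2_\gamma$ is the Sobolev space with norm $\|g\|_{L^2_\gamma}=\|(1+|\xi|^2)^{\gamma/2}\,\widehat g\,\|_{L^2}$; that is, $$\|B_\nu(f_1,\dots,f_m)\|_{L^2_\gamma(\mathbb R^d)}\lesssim\prod_{j=1}^m\|f_j\|_{L^2(\mathbb R^d)} .$$ 2. For every $p$ with $\dfrac{2(l+\gamma)}{l+2\gamma}<p\le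 m+1$ and $\frac1p+\frac1{p'}=1$, $B_\nu$ extends to a bounded $m$-linear operator $L^p(\mathbb R^d)\times\cdots\times L^p(\mathbb R^d)\to L^{p'}(\mathbb R^d)$; that is, $$\|B_\nu(f_1,\dots,f_m)\|_{L^{p'}(\mathbb R^d)}\lesssim\prod_{j=1}^m\|f_j\|_{L^p(\mathbb R^d)} .$$ The implied constants do not depend on $f_1,\dots,f_m$. -/

import Mathlib

open MeasureTheory Set Filter Topology FourierTransform
open scoped ENNReal NNReal ContDiff SchwartzMap

noncomputable section

/-- `ℝ^{md}`, written as the space of `m`-tuples `u = (u¹, …, uᵐ)` of vectors of `ℝ^d`, with its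
Euclidean (i.e. `ℓ²`) inner product. -/
abbrev TupleSpace (m d : ℕ) : Type :=
  PiLp 2 (fun _ : Fin m => EuclideanSpace ℝ (Fin d))

/-- The diagonal `H₀ = {(x, …, x) : x ∈ ℝ^d}` of `ℝ^{md}`. -/
def diagonalSubspace (m d : ℕ) : Submodule ℝ (TupleSpace m d) where
  carrier := {u | ∀ i j : Fin m, u i = u j}
  add_mem' := by
    intro a b ha hb i j
    simp only [PiLp.add_apply]
    rw [ha i j, hb i j]
  zero_mem' := by
    intro i j
    simp
  smul_mem' := by
    intro c a ha i j
    simp only [PiLp.smul_apply]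
    rw [ha i j]

section General

variable {E : Type*} [NormedAddCommGroup E] [InnerProductSpace ℝ E]

/-- `M` is an embedded smooth submanifold (without boundary) of `E` of dimension `k` : near each of
its points some smooth diffeomorphism between open subsets of `E` straightens `M` to a
`k`-dimensional linear subspace. -/
def IsSmoothSubmanifold (k : ℕ) (M : Set E) : Prop :=
  ∀ x ∈ M, ∃ (e : OpenPartialHomeomorph E E) (V : Submodule ℝ E),
    x ∈ e.source ∧ ContDiffOn ℝ ∞ e e.source ∧ ContDiffOn ℝ ∞ e.symm e.target ∧
      Module.finrank ℝ V = k ∧ e '' (e.source ∩ M) = e.target ∩ (V : Set E)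

/-- An (inhomogeneous) Littlewood–Paley partition of unity on the frequency space `E`: smooth
compactly supported cut-offs `low`, and `high` supported away from the origin, such that
`low ζ + ∑_{j ≥ 1} high (2^{-j} ζ) = 1` for every `ζ`. -/
structure LittlewoodPaley (E : Type*) [NormedAddCommGroup E] [InnerProductSpace ℝ E] where
  low : E → ℝ
  high : E → ℝ
  low_smooth : ContDiff ℝ ∞ low
  high_smooth : ContDiff ℝ ∞ high
  low_compact : HasCompactSupport low
  high_compact : HasCompactSupport high
  high_zero : (0 : E) ∉ tsupport high
  hasSum : ∀ ζ : E, HasSum (fun j : ℕ => high ((2 : ℝ)⁻¹ ^ (j + 1) • ζ)) (1 - low ζ)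

/-- The frequency cut-off at scale `2^j`, `j ≥ 0`. -/
def LittlewoodPaley.cutoff (φ : LittlewoodPaley E) : ℕ → E → ℝ
  | 0 => φ.low
  | j + 1 => fun ζ => φ.high ((2 : ℝ)⁻¹ ^ (j + 1) • ζ)

variable [MeasurableSpace E] [BorelSpace E]

/-- Fourier transform of the complex measure `ψ dσ`:  `ζ ↦ ∫ e^{-2πi⟨u,ζ⟩} ψ(u) dσ(u)`. -/
def fourierMeasure (σ : Measure E) (ψ : E → ℂ) (ζ : E) : ℂ :=
  ∫ u, Complex.exp (-(2 * Real.pi * inner ℝ u ζ : ℝ) * Complex.I) * ψ u ∂σ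

variable [FiniteDimensional ℝ E]

/-- The Littlewood–Paley component at frequency scale `2^j` of the complex measure `ψ dσ`, that is,
the function whose Fourier transform is the `j`-th cut-off times the Fourier transform of `ψ dσ`. -/
def littlewoodPaleyPiece (φ : LittlewoodPaley E) (σ : Measure E) (ψ : E → ℂ) (j : ℕ) : E → ℂ :=
  𝓕⁻ (fun ζ : E => (φ.cutoff j ζ : ℂ) * fourierMeasure σ ψ ζ)

/-- Lebesgue measure on a linear subspace of a Euclidean space, normalised by the induced inner
product. -/
def subspaceVolume (H : Submodule ℝ E) : Measure H :=
  (stdOrthonormalBasis ℝ H).toBasis.addHaar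

/-- The mixed norm
`‖F‖_{Λ^H_{r,p}} = (∫_{H} (∫_{ξ + H^⊥} |F̂(ζ)|^r dζ)^{p/r} dξ)^{1/p}`, where the dual of `H` is
identified with `H` through the inner product (with the usual modification for infinite
exponents). -/
def lambdaNorm (H : Submodule ℝ E) (r p : ℝ≥0∞) (F : E → ℂ) : ℝ≥0∞ :=
  eLpNorm
    (fun ξ : H =>
      eLpNorm (fun η : Hᗮ => 𝓕 F ((ξ : E) + (η : E))) r (subspaceVolume Hᗮ))
    p (subspaceVolume H)

end General

/-- The multilinear average with respect to the complex measure `ψ dσ` on `ℝ^{md}`: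
`x ↦ ∫ f₁(x - u¹) ⋯ f_m(x - uᵐ) ψ(u) dσ(u)`. -/
def multilinearAverage {m d : ℕ} (σ : Measure (TupleSpace m d)) (ψ : TupleSpace m d → ℂ)
    (f : Fin m → EuclideanSpace ℝ (Fin d) → ℂ) (x : EuclideanSpace ℝ (Fin d)) : ℂ :=
  ∫ u, (∏ j : Fin m, f j (x - u j)) * ψ u ∂σ

/-- Surface measure on a `k`-dimensional submanifold: the `k`-dimensional Hausdorff measure,
normalised to agree with Lebesgue measure on `k`-planes, restricted to the submanifold. -/
def surfaceMeasure {E : Type*} [NormedAddCommGroup E] [InnerProductSpace ℝ E] [MeasurableSpace E]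
    [BorelSpace E] (k : ℕ) (M : Set E) : Measure E :=
  (Measure.euclideanHausdorffMeasure k : Measure E).restrict M

/-- `T` is the bounded extension of the multilinear operator `B` from Schwartz functions to
`L^p × ⋯ × L^p → L^q`. -/
def IsBoundedExtension {m d : ℕ} (p q : ℝ≥0∞) [Fact (1 ≤ p)] [Fact (1 ≤ q)]
    (B : (Fin m → EuclideanSpace ℝ (Fin d) → ℂ) → EuclideanSpace ℝ (Fin d) → ℂ)
    (T : ContinuousMultilinearMap ℂ
      (fun _ : Fin m => Lp ℂ p (volume : Measure (EuclideanSpace ℝ (Fin d))))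
      (Lp ℂ q (volume : Measure (EuclideanSpace ℝ (Fin d))))) : Prop :=
  ∀ f : Fin m → 𝓢(EuclideanSpace ℝ (Fin d), ℂ),
    T (fun j => (f j).toLp p) =ᵐ[volume] B (fun j => ⇑(f j))

end

/-!
# Multilinear averages over submanifolds with Fourier decay along slices

Pairing `B_ν(f₁, …, f_m)` with a further function `f₀` gives an `(m + 1)`-linear form
`Λ_ν(f₀, …, f_m) = ∫∫ f₀(x) f₁(x - u¹) ⋯ f_m(x - uᵐ) dν(u) dx`, and `L^p × ⋯ × L^p → L^{p'}` bounds
for `B_ν` are the same as bounds for `Λ_ν` in `L^p` norm of all its arguments (`FormBound`). Three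
bounds are available.

* For every finite complex measure, Hölder's inequality bounds the form at `p = m + 1`
  (`formBound_multilinearForm`).
* For a bounded density `S` on `ℝ^{md}`, the form is bounded by `c S` at `p = 1`
  (`exists_formBound_one`). The surface measure of a compact `k`-dimensional submanifold gives balls
  of radius `r` mass `O(r^k)` (`IsSmoothSubmanifold.exists_surfaceMeasure_closedBall_le`), so the
  piece `ν_j` is bounded by a multiple of `2^{jl}`
  (`LittlewoodPaley.exists_norm_littlewoodPaleyPiece_le`).
* On the Fourier side the form is `∫ ν̂(ζ) f̌₀(ζ₁ + ⋯ + ζ_m) ∏ f̂ᵢ(ζᵢ) dζ`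
  (`integral_formIntegrand_eq`). The sum `ζ₁ + ⋯ + ζ_m` is constant on the slices orthogonal to the
  diagonal, so Cauchy–Schwarz on each slice and then over the slices, together with Plancherel's
  theorem, bounds the form at `p = 2` by the `Λ_{2,∞}` norm of `ν` (`exists_slice_bound`).

For `L²_γ` regularity the weight `(1 + |s|²)^{γ/2}` is put on `s = ζ₁ + ⋯ + ζ_m`. The piece `ν_j`
only sees slices with `|s| ≲ 2^j`, and `∑_{2^j ≳ |s|} 2^{-jγ} ≲ |s|^{-γ}` absorbs the weight
(`SliceDecay.exists_lintegral_weighted_le`); the Riesz representation theorem then supplies the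
function in `L²` (`SliceDecay.exists_besselPotential`).

The remaining exponents come from interpolation (`FormBound.interpolate`, proved by applying the
three lines theorem to simple functions). For `2 ≤ p ≤ m + 1` the whole form is interpolated between
`2` and `m + 1`. For `p < 2` each piece is interpolated between `1` and `2`: with
`1/p = (1 - θ) + θ/2` the bound for `ν_j` is a multiple of `2^{j(l(1 - θ) - γθ)}`, and the condition
`2(l + γ)/(l + 2γ) < p` says exactly that the exponent is negative, so that the pieces can be
summed (`SliceDecay.exists_formBound_of_lt_two`). Bounds for the form on Schwartz functions turn
into bounded extensions of `B_ν` by duality and density (`FormBound.exists_isBoundedExtension`).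
-/

noncomputable section


/-! ### Interpolation of multilinear forms -/

/-- The weighted `ℓ^{1/s}` norm of a finite family of scalars; the exponent enters through its
reciprocal `s`. -/
def weightedNorm {K : Type*} [Fintype K] (w : K → ℝ) (s : ℝ) (a : K → ℂ) : ℝ :=
  (∑ k, w k * ‖a k‖ ^ (1 / s)) ^ s

lemma weightedNorm_nonneg {K : Type*} [Fintype K] {w : K → ℝ} (hw : ∀ k, 0 ≤ w k) (s : ℝ)
    (a : K → ℂ) : 0 ≤ weightedNorm w s a :=
  Real.rpow_nonneg (Finset.sum_nonneg fun k _ =>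
    mul_nonneg (hw k) (Real.rpow_nonneg (norm_nonneg _) _)) _

lemma weightedNorm_smul {K : Type*} [Fintype K] {w : K → ℝ} (hw : ∀ k, 0 ≤ w k) {s : ℝ}
    (hs : 0 < s) (c : ℂ) (a : K → ℂ) :
    weightedNorm w s (c • a) = ‖c‖ * weightedNorm w s a := by
  have h : ∀ k, w k * ‖(c • a) k‖ ^ (1 / s) = ‖c‖ ^ (1 / s) * (w k * ‖a k‖ ^ (1 / s)) := by
    intro k
    rw [Pi.smul_apply, smul_eq_mul, norm_mul, Real.mul_rpow (norm_nonneg _) (norm_nonneg _)]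
    ring
  unfold weightedNorm
  simp_rw [h]
  rw [← Finset.mul_sum, Real.mul_rpow (Real.rpow_nonneg (norm_nonneg _) _)
    (Finset.sum_nonneg fun k _ => mul_nonneg (hw k) (Real.rpow_nonneg (norm_nonneg _) _)),
    ← Real.rpow_mul (norm_nonneg _), one_div_mul_cancel hs.ne', Real.rpow_one]

lemma weightedNorm_eq_zero_of {K : Type*} [Fintype K] {w : K → ℝ} (hw : ∀ k, 0 ≤ w k) {s t : ℝ}
    (hs : 0 < s) (ht : 0 < t) {a : K → ℂ} (h : weightedNorm w s a = 0) :
    weightedNorm w t a = 0 := by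
  have hnn : ∀ k, 0 ≤ w k * ‖a k‖ ^ (1 / s) := fun k =>
    mul_nonneg (hw k) (Real.rpow_nonneg (norm_nonneg _) _)
  have h1 : ∑ k, w k * ‖a k‖ ^ (1 / s) = 0 :=
    ((Real.rpow_eq_zero (Finset.sum_nonneg fun k _ => hnn k) hs.ne').1 h)
  rw [Finset.sum_eq_zero_iff_of_nonneg fun k _ => hnn k] at h1
  have h2 : ∑ k, w k * ‖a k‖ ^ (1 / t) = 0 := by
    refine Finset.sum_eq_zero fun k hk => ?_
    rcases mul_eq_zero.1 (h1 k hk) with h3 | h3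
    · simp [h3]
    · rw [Real.rpow_eq_zero (norm_nonneg _) (by positivity)] at h3
      rw [h3, Real.zero_rpow (by positivity), mul_zero]
  unfold weightedNorm
  rw [h2, Real.zero_rpow ht.ne']

/-- The holomorphic family of scalars `|b|^{((1-z)s₀ + z s₁)/s} · sgn b` through `b`, which drives
the complex interpolation argument. -/
def powerFamily (s₀ s₁ s : ℝ) (b : ℂ) (z : ℂ) : ℂ :=
  if b = 0 then 0 else ((‖b‖ : ℝ) : ℂ) ^ (((1 - z) * s₀ + z * s₁) / s) * (b / ‖b‖)

lemma differentiable_powerFamily (s₀ s₁ s : ℝ) (b : ℂ) :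
    Differentiable ℂ (powerFamily s₀ s₁ s b) := by
  unfold powerFamily
  by_cases hb : b = 0
  · simp [hb]
  · simp only [hb, if_false]
    have : ((‖b‖ : ℝ) : ℂ) ≠ 0 := by simpa using hb
    refine Differentiable.mul_const ?_ _
    refine Differentiable.const_cpow ?_ (Or.inl this)
    fun_prop

lemma norm_powerFamily {s₀ s₁ s : ℝ} {b z : ℂ} (hb : b ≠ 0) :
    ‖powerFamily s₀ s₁ s b z‖ = ‖b‖ ^ (((1 - z.re) * s₀ + z.re * s₁) / s) := by
  have hb' : 0 < ‖b‖ := norm_pos_iff.2 hb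
  simp only [powerFamily, hb, if_false]
  rw [norm_mul, Complex.norm_cpow_eq_rpow_re_of_pos hb', norm_div, Complex.norm_real, norm_norm,
    div_self hb'.ne', mul_one]
  congr 1
  simp [Complex.div_ofReal_re]

lemma powerFamily_self {s₀ s₁ s θ : ℝ} (hs : 0 < s) (h : s = (1 - θ) * s₀ + θ * s₁) (b : ℂ) :
    powerFamily s₀ s₁ s b θ = b := by
  by_cases hb : b = 0
  · simp [powerFamily, hb]
  · simp only [powerFamily, hb, if_false]
    have : (((1 - (θ : ℂ)) * s₀ + θ * s₁) / s) = 1 := by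
      rw [div_eq_one_iff_eq (by exact_mod_cast hs.ne')]
      rw [h]; push_cast; ring
    rw [this, Complex.cpow_one, mul_div_cancel₀]
    simpa using hb

/-- Multilinear Riesz–Thorin interpolation for weighted finite-dimensional `ℓ^p` norms, all
factors having the same exponent. -/
theorem interpolation_weightedNorm {ι : Type*} [Fintype ι] {K : ι → Type*} [∀ i, Fintype (K i)]
    (L : ContinuousMultilinearMap ℂ (fun i => K i → ℂ) ℂ) {w : ∀ i, K i → ℝ}
    (hw : ∀ i k, 0 ≤ w i k) {s₀ s₁ θ A₀ A₁ : ℝ} (hs₀ : 0 < s₀) (hs₁ : 0 < s₁)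
    (hθ : θ ∈ Icc (0 : ℝ) 1) (hA₀ : 0 ≤ A₀) (hA₁ : 0 ≤ A₁)
    (h₀ : ∀ a, ‖L a‖ ≤ A₀ * ∏ i, weightedNorm (w i) s₀ (a i))
    (h₁ : ∀ a, ‖L a‖ ≤ A₁ * ∏ i, weightedNorm (w i) s₁ (a i)) (a : ∀ i, K i → ℂ) :
    ‖L a‖ ≤ A₀ ^ (1 - θ) * A₁ ^ θ *
      ∏ i, weightedNorm (w i) ((1 - θ) * s₀ + θ * s₁) (a i) := by
  set s := (1 - θ) * s₀ + θ * s₁ with hsdef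
  have hs : 0 < s := by
    rcases hθ.1.eq_or_lt with h | h
    · rw [hsdef, ← h]; simpa using hs₀
    · have : 0 ≤ (1 - θ) * s₀ := mul_nonneg (by linarith [hθ.2]) hs₀.le
      have : 0 < θ * s₁ := by positivity
      linarith
  have hRHS : 0 ≤ A₀ ^ (1 - θ) * A₁ ^ θ := by positivity
  -- a factor of norm zero makes both sides vanish
  by_cases hz : ∃ i, weightedNorm (w i) s (a i) = 0
  · obtain ⟨i, hi⟩ := hz
    have h2 := h₀ a
    rw [Finset.prod_eq_zero (Finset.mem_univ i)
      (weightedNorm_eq_zero_of (hw i) hs hs₀ hi), mul_zero] at h2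
    exact h2.trans (mul_nonneg hRHS (Finset.prod_nonneg fun i _ => weightedNorm_nonneg (hw i) _ _))
  push Not at hz
  -- the normalised case
  have key : ∀ b : ∀ i, K i → ℂ, (∀ i, ∑ k, w i k * ‖b i k‖ ^ (1 / s) = 1) →
      ‖L b‖ ≤ A₀ ^ (1 - θ) * A₁ ^ θ := by
    intro b hb
    set c : ℂ → ∀ i, K i → ℂ := fun z i k => powerFamily s₀ s₁ s (b i k) z with hc
    have hcd : Differentiable ℂ c := by
      refine differentiable_pi.2 fun i => differentiable_pi.2 fun k =>
        differentiable_powerFamily _ _ _ _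
    have hfd : Differentiable ℂ (fun z => L (c z)) :=
      (ContinuousMultilinearMap.contDiff (n := 1) L).differentiable (by norm_num) |>.comp hcd
    have hside : ∀ (t : ℝ), 0 < t → ∀ z : ℂ, (1 - z.re) * s₀ + z.re * s₁ = t →
        ∀ i, weightedNorm (w i) t (c z i) = 1 := by
      intro t ht z hz i
      have : ∀ k, w i k * ‖c z i k‖ ^ (1 / t) = w i k * ‖b i k‖ ^ (1 / s) := by
        intro k
        by_cases hbk : b i k = 0
        · simp only [hc, hbk, powerFamily, if_true, norm_zero]
          rw [Real.zero_rpow (by positivity), Real.zero_rpow (by positivity)]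
        · simp only [hc]
          rw [norm_powerFamily hbk, ← Real.rpow_mul (norm_nonneg _), hz]
          congr 2
          field_simp
      unfold weightedNorm
      simp_rw [this]
      rw [hb i, Real.one_rpow]
    have hb0 : ∀ z ∈ Complex.re ⁻¹' {(0 : ℝ)}, ‖L (c z)‖ ≤ A₀ := by
      intro z hz
      have hz' : z.re = 0 := hz
      refine (h₀ (c z)).trans_eq ?_
      rw [Finset.prod_eq_one fun i _ => hside s₀ hs₀ z (by rw [hz']; ring) i, mul_one]
    have hb1 : ∀ z ∈ Complex.re ⁻¹' {(1 : ℝ)}, ‖L (c z)‖ ≤ A₁ := by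
      intro z hz
      have hz' : z.re = 1 := hz
      refine (h₁ (c z)).trans_eq ?_
      rw [Finset.prod_eq_one fun i _ => hside s₁ hs₁ z (by rw [hz']; ring) i, mul_one]
    -- on the strip `L (c z)` is dominated by a continuous function of `Re z ∈ [0, 1]`
    have hbdd : BddAbove ((norm ∘ fun z => L (c z)) ''
        Complex.HadamardThreeLines.verticalClosedStrip 0 1) := by
      have hcont : Continuous (fun x : ℝ => A₀ * ∏ i, weightedNorm (w i) s₀ (c (x : ℂ) i)) := by
        refine continuous_const.mul (continuous_finsetProd _ fun i _ => ?_)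
        unfold weightedNorm
        refine Continuous.rpow_const ?_ (fun _ => Or.inr hs₀.le)
        refine continuous_finsetSum _ fun k _ => continuous_const.mul ?_
        refine Continuous.rpow_const ?_ (fun _ => Or.inr (by positivity))
        exact ((differentiable_powerFamily _ _ _ _).continuous.comp
          Complex.continuous_ofReal).norm
      obtain ⟨B, hB⟩ := (isCompact_Icc (a := (0 : ℝ)) (b := 1)).bddAbove_image hcont.continuousOn
      refine ⟨B, ?_⟩
      rintro _ ⟨z, hz, rfl⟩
      refine (h₀ (c z)).trans (le_trans (le_of_eq ?_) (hB ⟨z.re, hz, rfl⟩))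
      have : ∀ i, weightedNorm (w i) s₀ (c z i) = weightedNorm (w i) s₀ (c (z.re : ℂ) i) := by
        intro i
        unfold weightedNorm
        congr 1
        refine Finset.sum_congr rfl fun k _ => ?_
        congr 2
        by_cases hbk : b i k = 0
        · simp [hc, hbk, powerFamily]
        · simp only [hc]
          rw [norm_powerFamily hbk, norm_powerFamily hbk, Complex.ofReal_re]
      simp_rw [this]
    have := Complex.HadamardThreeLines.norm_le_interp_of_mem_verticalClosedStrip₀₁'
      (fun z => L (c z)) (z := (θ : ℂ)) (by simpa [Complex.HadamardThreeLines.verticalClosedStrip]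
        using hθ) hfd.diffContOnCl hbdd hb0 hb1
    have hcb : c (θ : ℂ) = b := by
      funext i k
      exact powerFamily_self hs hsdef _
    simpa [hcb] using this
  -- reduction to the normalised case by homogeneity
  set n : ι → ℝ := fun i => weightedNorm (w i) s (a i) with hn
  have hnpos : ∀ i, 0 < n i := fun i =>
    lt_of_le_of_ne (weightedNorm_nonneg (hw i) _ _) (Ne.symm (hz i))
  set b : ∀ i, K i → ℂ := fun i => ((n i : ℂ)⁻¹) • a i with hb
  have hab : a = fun i => (n i : ℂ) • b i := by
    funext i
    rw [hb]
    simp only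
    rw [smul_inv_smul₀]
    exact_mod_cast (hnpos i).ne'
  have hb1 : ∀ i, ∑ k, w i k * ‖b i k‖ ^ (1 / s) = 1 := by
    intro i
    have h3 : weightedNorm (w i) s (b i) = 1 := by
      rw [hb]
      simp only
      rw [weightedNorm_smul (hw i) hs, norm_inv, Complex.norm_real, Real.norm_of_nonneg
        (hnpos i).le]
      exact inv_mul_cancel₀ (hnpos i).ne'
    unfold weightedNorm at h3
    have h4 := congrArg (fun x : ℝ => x ^ (1 / s)) h3
    rwa [← Real.rpow_mul (Finset.sum_nonneg fun k _ =>
      mul_nonneg (hw i k) (Real.rpow_nonneg (norm_nonneg _) _)), mul_one_div_cancel hs.ne',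
      Real.rpow_one, Real.one_rpow] at h4
  have h4 : L a = (∏ i, (n i : ℂ)) • L b := by
    conv_lhs => rw [hab]
    exact L.toMultilinearMap.map_smul_univ _ _
  rw [h4, norm_smul, norm_prod, mul_comm]
  have h5 : ∏ i, ‖(n i : ℂ)‖ = ∏ i, n i := by
    refine Finset.prod_congr rfl fun i _ => ?_
    rw [Complex.norm_real, Real.norm_of_nonneg (hnpos i).le]
  rw [h5]
  exact mul_le_mul_of_nonneg_right (key b hb1) (Finset.prod_nonneg fun i _ => (hnpos i).le)

section StepFunctions

variable {X : Type*} [MeasurableSpace X] {μ : Measure X} {K : Type*} [Fintype K]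

/-- The step function with value `a k` on `A k` (the sets `A k` being disjoint in applications). -/
def stepFun (A : K → Set X) (a : K → ℂ) (x : X) : ℂ :=
  ∑ k, (A k).indicator (fun _ => a k) x

lemma memLp_stepFun {A : K → Set X} (hA : ∀ k, MeasurableSet (A k)) (hfin : ∀ k, μ (A k) ≠ ⊤)
    (p : ℝ≥0∞) (a : K → ℂ) : MemLp (stepFun A a) p μ :=
  memLp_finsetSum _ fun k _ => memLp_indicator_const p (hA k) _ (Or.inr (hfin k))

/-- Step functions over fixed sets, as a linear map into `L^p`. -/
def stepLp {A : K → Set X} (hA : ∀ k, MeasurableSet (A k)) (hfin : ∀ k, μ (A k) ≠ ⊤)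
    (p : ℝ≥0∞) : (K → ℂ) →ₗ[ℂ] Lp ℂ p μ where
  toFun a := (memLp_stepFun hA hfin p a).toLp
  map_add' a b := by
    rw [← MemLp.toLp_add]
    congr 1
    funext x
    simp only [stepFun, Pi.add_apply, ← Finset.sum_add_distrib]
    refine Finset.sum_congr rfl fun k _ => ?_
    by_cases hx : x ∈ A k <;> simp [hx]
  map_smul' c a := by
    rw [RingHom.id_apply, ← MemLp.toLp_const_smul]
    congr 1
    funext x
    simp only [stepFun, Pi.smul_apply, Finset.smul_sum]
    refine Finset.sum_congr rfl fun k _ => ?_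
    by_cases hx : x ∈ A k <;> simp [hx]

lemma coeFn_stepLp {A : K → Set X} (hA : ∀ k, MeasurableSet (A k)) (hfin : ∀ k, μ (A k) ≠ ⊤)
    (p : ℝ≥0∞) (a : K → ℂ) : stepLp hA hfin p a =ᵐ[μ] stepFun A a :=
  MemLp.coeFn_toLp (memLp_stepFun hA hfin p a)

lemma eLpNorm_stepFun {A : K → Set X} (hA : ∀ k, MeasurableSet (A k))
    (hfin : ∀ k, μ (A k) ≠ ⊤) (hdisj : Pairwise fun i j => Disjoint (A i) (A j)) {p : ℝ≥0∞}
    (hp₀ : p ≠ 0) (hp : p ≠ ⊤) (a : K → ℂ) :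
    (eLpNorm (stepFun A a) p μ).toReal = weightedNorm (fun k => μ.real (A k)) p.toReal⁻¹ a := by
  have hp' : 0 < p.toReal := ENNReal.toReal_pos hp₀ hp
  have h1 : ∀ x, ‖stepFun A a x‖ₑ ^ p.toReal =
      ∑ k, (A k).indicator (fun _ => ‖a k‖ₑ ^ p.toReal) x := by
    intro x
    by_cases hx : ∃ k, x ∈ A k
    · obtain ⟨k, hk⟩ := hx
      have hne : ∀ j, j ≠ k → x ∉ A j := fun j hj hxj =>
        (hdisj hj).le_bot ⟨hxj, hk⟩
      unfold stepFun
      rw [Finset.sum_eq_single k (fun j _ hj => by simp [hne j hj]) (by simp),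
        Finset.sum_eq_single k (fun j _ hj => by simp [hne j hj]) (by simp)]
      simp [hk]
    · push Not at hx
      simp [stepFun, hx, hp']
  rw [eLpNorm_eq_lintegral_rpow_enorm_toReal hp₀ hp]
  simp_rw [h1]
  rw [lintegral_finsetSum _ fun k _ => measurable_const.indicator (hA k)]
  simp_rw [lintegral_indicator_const (hA _)]
  unfold weightedNorm
  rw [← ENNReal.toReal_rpow, ENNReal.toReal_sum]
  · simp only [one_div, inv_inv]
    congr 1
    refine Finset.sum_congr rfl fun k _ => ?_
    rw [ENNReal.toReal_mul, ← ENNReal.toReal_rpow, toReal_enorm, mul_comm]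
    rfl
  · intro k _
    exact ENNReal.mul_ne_top (ENNReal.rpow_ne_top_of_nonneg hp'.le enorm_ne_top) (hfin k)

/-- A simple function is a step function over its nonzero level sets. -/
lemma SimpleFunc.eq_stepFun (g : SimpleFunc X ℂ) :
    (g : X → ℂ) = stepFun
      (fun k : ↥(g.range.erase 0) => g ⁻¹' {(k : ℂ)}) (fun k => (k : ℂ)) := by
  funext x
  unfold stepFun
  by_cases hx : g x = 0
  · rw [hx, Finset.sum_eq_zero]
    intro k _
    have : g x ≠ (k : ℂ) := by
      rw [hx]
      exact fun h => (Finset.mem_erase.1 k.2).1 h.symm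
    simp [this]
  · have hmem : g x ∈ g.range.erase 0 :=
      Finset.mem_erase.2 ⟨hx, SimpleFunc.mem_range_self _ _⟩
    rw [Finset.sum_eq_single ⟨g x, hmem⟩]
    · simp
    · intro k _ hk
      have : g x ≠ (k : ℂ) := fun h => hk (Subtype.ext h.symm)
      simp [this]
    · simp

end StepFunctions

/-- Simple functions are dense in `L^r ∩ L^p`. -/
lemma exists_simpleFunc_approx {X : Type*} [MeasurableSpace X] {μ : Measure X} {r p : ℝ≥0∞}
    (hr : r ≠ ⊤) (hp : p ≠ ⊤) (F : Lp ℂ r μ)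
    (hF : MemLp F p μ) (ε : ℝ≥0∞) (hε : ε ≠ 0) :
    ∃ g : SimpleFunc X ℂ, MemLp g r μ ∧ MemLp g p μ ∧ eLpNorm (g - F : X → ℂ) r μ ≤ ε ∧
        eLpNorm (g - F : X → ℂ) p μ ≤ ε := by
  obtain ⟨f, hfm, hfF⟩ : ∃ f : X → ℂ, Measurable f ∧ F =ᵐ[μ] f :=
    ⟨_, (Lp.aestronglyMeasurable F).stronglyMeasurable_mk.measurable,
      (Lp.aestronglyMeasurable F).ae_eq_mk⟩
  have hfr : MemLp f r μ := (memLp_congr_ae hfF).1 (Lp.memLp F)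
  have hfp : MemLp f p μ := (memLp_congr_ae hfF).1 hF
  have h1 := SimpleFunc.tendsto_approxOn_range_Lp_eLpNorm hr hfm hfr.2
  have h2 := SimpleFunc.tendsto_approxOn_range_Lp_eLpNorm hp hfm hfp.2
  have hpos : 0 < ε := pos_iff_ne_zero.2 hε
  obtain ⟨n, hn1, hn2⟩ := ((h1.eventually (gt_mem_nhds hpos)).and
    (h2.eventually (gt_mem_nhds hpos))).exists
  refine ⟨_, SimpleFunc.memLp_approxOn_range hfm hfr n, SimpleFunc.memLp_approxOn_range hfm hfp n,
    ?_, ?_⟩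
  · exact (eLpNorm_congr_ae (EventuallyEq.rfl.sub hfF)).trans_le hn1.le
  · exact (eLpNorm_congr_ae (EventuallyEq.rfl.sub hfF)).trans_le hn2.le

section FormBound

variable {X : Type*} [MeasurableSpace X] {μ : Measure X} {ι : Type*} [Fintype ι]
  {r : ℝ≥0∞} [Fact (1 ≤ r)]

/-- The multilinear form `Λ` on `L^r × ⋯ × L^r` is bounded by `A` with respect to the `L^p` norm
of all its arguments, for arguments in `L^r ∩ L^p`. -/
def FormBound (Λ : ContinuousMultilinearMap ℂ (fun _ : ι => Lp ℂ r μ) ℂ) (p : ℝ≥0∞) (A : ℝ) :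
    Prop :=
  ∀ F : ι → Lp ℂ r μ, (∀ i, MemLp (F i) p μ) →
    ‖Λ F‖ ≤ A * ∏ i, (eLpNorm (F i) p μ).toReal

/-- A bound in `L^p` norm for a form needs only be checked on a set of functions that is dense in
`L^r` and `L^p` simultaneously. -/
lemma FormBound.of_dense {Λ : ContinuousMultilinearMap ℂ (fun _ : ι => Lp ℂ r μ) ℂ} {p : ℝ≥0∞}
    (hp : 1 ≤ p) {A : ℝ} (P : Lp ℂ r μ → Prop)
    (hdense : ∀ F : Lp ℂ r μ, MemLp F p μ → ∀ ε : ℝ≥0∞, ε ≠ 0 →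
      ∃ G : Lp ℂ r μ, P G ∧ MemLp G p μ ∧ eLpNorm (G - F : X → ℂ) r μ ≤ ε ∧
        eLpNorm (G - F : X → ℂ) p μ ≤ ε)
    (h : ∀ F : ι → Lp ℂ r μ, (∀ i, P (F i)) → (∀ i, MemLp (F i) p μ) →
      ‖Λ F‖ ≤ A * ∏ i, (eLpNorm (F i) p μ).toReal) : FormBound Λ p A := by
  intro F hF
  have : Fact (1 ≤ p) := ⟨hp⟩
  have hε : ∀ n : ℕ, ((n : ℝ≥0∞) + 1)⁻¹ ≠ 0 := fun n =>
    ENNReal.inv_ne_zero.2 (by simp)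
  choose G hGP hGp hGr hGp' using fun i (n : ℕ) => hdense (F i) (hF i) _ (hε n)
  have hlim0 : Tendsto (fun n : ℕ => ((n : ℝ≥0∞) + 1)⁻¹) atTop (𝓝 0) := by
    have := (tendsto_add_atTop_iff_nat 1).2 ENNReal.tendsto_inv_nat_nhds_zero
    simpa using this
  have h1 : ∀ i, Tendsto (fun n => G i n) atTop (𝓝 (F i)) := fun i =>
    (Lp.tendsto_Lp_iff_tendsto_eLpNorm' _ _).2
      (tendsto_of_tendsto_of_tendsto_of_le_of_le tendsto_const_nhds hlim0
        (fun _ => zero_le) (hGr i))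
  have h2 : ∀ i, Tendsto (fun n => (eLpNorm (G i n) p μ).toReal) atTop
      (𝓝 (eLpNorm (F i) p μ).toReal) := by
    intro i
    have := (Lp.tendsto_Lp_iff_tendsto_eLpNorm'' (fun n => (G i n : X → ℂ)) (hGp i) (F i)
      (hF i)).2 (tendsto_of_tendsto_of_tendsto_of_le_of_le tendsto_const_nhds hlim0
        (fun _ => zero_le) (hGp' i))
    simpa only [Lp.norm_toLp] using this.norm
  have h3 : Tendsto (fun n => ‖Λ fun i => G i n‖) atTop (𝓝 ‖Λ F‖) :=
    ((Λ.coe_continuous.tendsto F).comp (tendsto_pi_nhds.2 h1)).norm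
  refine le_of_tendsto_of_tendsto' h3
    (tendsto_const_nhds.mul (tendsto_finsetProd _ fun i _ => h2 i)) fun n => ?_
  exact h (fun i => G i n) (fun i => hGP i n) (fun i => hGp i n)

/-- Multilinear Riesz–Thorin interpolation, all arguments of the form having the same exponent. -/
theorem FormBound.interpolate {Λ : ContinuousMultilinearMap ℂ (fun _ : ι => Lp ℂ r μ) ℂ}
    {p₀ p₁ p : ℝ≥0∞} (hr : r ≠ ⊤) (hp₀ : 1 ≤ p₀) (hp₀' : p₀ ≠ ⊤) (hp₁ : 1 ≤ p₁) (hp₁' : p₁ ≠ ⊤)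
    (hp : 1 ≤ p) (hp' : p ≠ ⊤) {θ A₀ A₁ : ℝ} (hθ : θ ∈ Icc (0 : ℝ) 1)
    (hpθ : p.toReal⁻¹ = (1 - θ) * p₀.toReal⁻¹ + θ * p₁.toReal⁻¹) (hA₀ : 0 ≤ A₀) (hA₁ : 0 ≤ A₁)
    (h₀ : FormBound Λ p₀ A₀) (h₁ : FormBound Λ p₁ A₁) :
    FormBound Λ p (A₀ ^ (1 - θ) * A₁ ^ θ) := by
  have hr0 : r ≠ 0 := (zero_lt_one.trans_le (Fact.out : 1 ≤ r)).ne'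
  have hp0 : p ≠ 0 := (zero_lt_one.trans_le hp).ne'
  have hp00 : p₀ ≠ 0 := (zero_lt_one.trans_le hp₀).ne'
  have hp10 : p₁ ≠ 0 := (zero_lt_one.trans_le hp₁).ne'
  refine FormBound.of_dense hp (fun G => ∃ g : SimpleFunc X ℂ, MemLp g r μ ∧ G =ᵐ[μ] g) ?_ ?_
  · intro F hF ε hε
    obtain ⟨g, hgr, hgp, h1, h2⟩ := exists_simpleFunc_approx hr hp' F hF ε hε
    refine ⟨hgr.toLp, ⟨g, hgr, hgr.coeFn_toLp⟩, (memLp_congr_ae hgr.coeFn_toLp).2 hgp, ?_, ?_⟩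
    · exact (eLpNorm_congr_ae (hgr.coeFn_toLp.sub EventuallyEq.rfl)).trans_le h1
    · exact (eLpNorm_congr_ae (hgr.coeFn_toLp.sub EventuallyEq.rfl)).trans_le h2
  · intro F hF _
    choose g hgr hgF using hF
    set K : ι → Type := fun i => ↥((g i).range.erase 0) with hK
    set A : ∀ i, K i → Set X := fun i k => g i ⁻¹' {(k : ℂ)} with hA
    have hAm : ∀ i k, MeasurableSet (A i k) := fun i k => (g i).measurableSet_preimage _
    have hAf : ∀ i k, μ (A i k) ≠ ⊤ := fun i k =>
      (SimpleFunc.measure_preimage_lt_top_of_memLp hr0 hr (g i) (hgr i) _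
        (Finset.mem_erase.1 k.2).1).ne
    have hAd : ∀ i, Pairwise fun k l => Disjoint (A i k) (A i l) := by
      intro i k l hkl
      rw [Set.disjoint_left]
      intro x hx hx'
      exact hkl (Subtype.ext ((hx : g i x = k).symm.trans (hx' : g i x = l)))
    set L : ContinuousMultilinearMap ℂ (fun i => K i → ℂ) ℂ :=
      Λ.compContinuousLinearMap fun i => (stepLp (hAm i) (hAf i) r).toContinuousLinearMap with hL
    have hnorm : ∀ q : ℝ≥0∞, q ≠ 0 → q ≠ ⊤ → ∀ i (a : K i → ℂ),
        (eLpNorm (stepLp (hAm i) (hAf i) r a) q μ).toReal =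
          weightedNorm (fun k => μ.real (A i k)) q.toReal⁻¹ a := by
      intro q hq hq' i a
      rw [eLpNorm_congr_ae (coeFn_stepLp _ _ _ _), eLpNorm_stepFun (hAm i) (hAf i) (hAd i) hq hq']
    have hbound : ∀ (q : ℝ≥0∞) (B : ℝ), q ≠ 0 → q ≠ ⊤ → FormBound Λ q B → ∀ a,
        ‖L a‖ ≤ B * ∏ i, weightedNorm (fun k => μ.real (A i k)) q.toReal⁻¹ (a i) := by
      intro q B hq hq' h a
      have := h (fun i => stepLp (hAm i) (hAf i) r (a i)) fun i =>
        (memLp_congr_ae (coeFn_stepLp _ _ _ _)).2 (memLp_stepFun (hAm i) (hAf i) _ _)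
      simp only [hnorm q hq hq'] at this
      exact this
    have hF : F = fun i => stepLp (hAm i) (hAf i) r (fun k => (k : ℂ)) := by
      funext i
      refine Lp.ext ((hgF i).trans ?_)
      rw [SimpleFunc.eq_stepFun (g i)]
      exact (coeFn_stepLp (hAm i) (hAf i) r _).symm
    have := interpolation_weightedNorm L (w := fun i k => μ.real (A i k))
      (fun _ _ => measureReal_nonneg) (s₀ := p₀.toReal⁻¹) (s₁ := p₁.toReal⁻¹)
      (inv_pos.2 (ENNReal.toReal_pos hp00 hp₀')) (inv_pos.2 (ENNReal.toReal_pos hp10 hp₁')) hθ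
      hA₀ hA₁ (hbound p₀ A₀ hp00 hp₀' h₀) (hbound p₁ A₁ hp10 hp₁' h₁) (fun i k => (k : ℂ))
    rw [← hpθ] at this
    rw [hF]
    simp only [hnorm p hp0 hp']
    exact this

end FormBound

/-! ### Density of Schwartz functions in two `L^p` spaces at once -/

section Density

variable {V : Type*} [NormedAddCommGroup V] [InnerProductSpace ℝ V] [FiniteDimensional ℝ V]
  [MeasurableSpace V] [BorelSpace V]

/-- The indicator function of a set of finite measure is approximated by smooth cut-off functions
that differ from it only on a set of small measure. -/
lemma exists_schwartz_approx_indicator {A : Set V} (hA : MeasurableSet A)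
    (hfin : volume A ≠ ⊤) (c : ℂ) {δ : ℝ≥0∞} (hδ : δ ≠ 0) :
    ∃ φ : 𝓢(V, ℂ), ∃ S : Set V, MeasurableSet S ∧ volume S ≤ δ ∧
      ∀ x, ‖φ x - A.indicator (fun _ => c) x‖ ≤ ‖S.indicator (fun _ => c) x‖ := by
  have hδ2 : δ / 2 ≠ 0 := (ENNReal.half_pos hδ).ne'
  obtain ⟨U, hAU, hU, -, hUA⟩ := hA.exists_isOpen_sdiff_lt hfin hδ2
  obtain ⟨K, hKA, hK, hAK⟩ := hA.exists_isCompact_sdiff_lt hfin hδ2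
  obtain ⟨L, hL, hKL, hLU⟩ := exists_compact_between hK hU (hKA.trans hAU)
  obtain ⟨h, hsm, hrange, h0, h1⟩ := exists_contMDiff_zero_iff_one_iff_of_isClosed
    (n := ⊤) (modelWithCornersSelf ℝ V) (s := (interior L)ᶜ) (t := K)
    isOpen_interior.isClosed_compl hK.isClosed
    (disjoint_compl_left_iff_subset.2 hKL)
  have hsm' : ContDiff ℝ ∞ h := contMDiff_iff_contDiff.1 hsm
  have hcs : HasCompactSupport h := by
    refine HasCompactSupport.intro hL fun x hx => ?_
    exact (h0 x).1 (fun hx' => hx (interior_subset hx'))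
  have hcs' : HasCompactSupport fun x => c * ((h x : ℝ) : ℂ) :=
    hcs.comp_left (g := fun t : ℝ => c * (t : ℂ)) (by simp)
  have hsm'' : ContDiff ℝ ∞ fun x => c * ((h x : ℝ) : ℂ) :=
    contDiff_const.mul (Complex.ofRealCLM.contDiff.comp hsm')
  refine ⟨hcs'.toSchwartzMap hsm'', U \ K, hU.measurableSet.diff hK.measurableSet, ?_, ?_⟩
  · calc volume (U \ K) ≤ volume ((U \ A) ∪ (A \ K)) :=
          measure_mono fun x hx => by by_cases hxA : x ∈ A <;> simp_all
      _ ≤ δ / 2 + δ / 2 := (measure_union_le _ _).trans (add_le_add hUA.le hAK.le)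
      _ = δ := ENNReal.add_halves δ
  · intro x
    change ‖c * ((h x : ℝ) : ℂ) - A.indicator (fun _ => c) x‖ ≤ _
    by_cases hxK : x ∈ K
    · have := (h1 x).1 hxK
      simp [this, hKA hxK]
    by_cases hxU : x ∈ U
    · have hx01 := hrange ⟨x, rfl⟩
      have hxS : x ∈ U \ K := ⟨hxU, hxK⟩
      rw [indicator_of_mem hxS]
      by_cases hxA : x ∈ A
      · rw [indicator_of_mem hxA]
        have : c * ((h x : ℝ) : ℂ) - c = c * ((h x - 1 : ℝ) : ℂ) := by push_cast; ring
        rw [this, norm_mul, Complex.norm_real]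
        refine mul_le_of_le_one_right (norm_nonneg _) ?_
        rw [Real.norm_eq_abs, abs_le]
        constructor <;> linarith [hx01.1, hx01.2]
      · rw [indicator_of_notMem hxA, sub_zero, norm_mul, Complex.norm_real]
        refine mul_le_of_le_one_right (norm_nonneg _) ?_
        rw [Real.norm_eq_abs, abs_le]
        constructor <;> linarith [hx01.1, hx01.2]
    · have hxA : x ∉ A := fun h' => hxU (hAU h')
      have hxL : x ∈ (interior L)ᶜ := fun h' => hxU (hLU (interior_subset h'))
      rw [(h0 x).1 hxL]
      simp [hxA]

/-- Schwartz functions are dense in `L^r ∩ L^p`. -/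
lemma exists_schwartz_approx {r p : ℝ≥0∞} (hr1 : 1 ≤ r) (hp1 : 1 ≤ p) (hr : r ≠ ⊤) (hp : p ≠ ⊤)
    (F : Lp ℂ r (volume : Measure V)) (hF : MemLp F p volume) (ε : ℝ≥0∞) (hε : ε ≠ 0) :
    ∃ φ : 𝓢(V, ℂ), eLpNorm (φ - F : V → ℂ) r volume ≤ ε ∧
      eLpNorm (φ - F : V → ℂ) p volume ≤ ε := by
  have hε2 : ε / 2 ≠ 0 := (ENNReal.half_pos hε).ne'
  obtain ⟨g, hgr, hgp, h1, h2⟩ := exists_simpleFunc_approx hr hp F hF (ε / 2) hε2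
  set K := ↥(g.range.erase 0)
  set N : ℝ≥0∞ := (Fintype.card K : ℝ≥0∞) + 1 with hN
  have hN0 : N ≠ 0 := by simp [hN]
  have hNt : N ≠ ⊤ := by simp [hN]
  have hη : ε / 2 / N ≠ 0 := (ENNReal.div_pos hε2 hNt).ne'
  have key : ∀ k : K, ∃ φ : 𝓢(V, ℂ), ∀ q ∈ ({r, p} : Set ℝ≥0∞),
      eLpNorm (fun x => φ x - (g ⁻¹' {(k : ℂ)}).indicator (fun _ => (k : ℂ)) x) q volume
        ≤ ε / 2 / N := by
    intro k
    have hkfin : volume (g ⁻¹' {(k : ℂ)}) ≠ ⊤ :=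
      (SimpleFunc.measure_preimage_lt_top_of_memLp (zero_lt_one.trans_le hr1).ne' hr g hgr _
        (Finset.mem_erase.1 k.2).1).ne
    have hsmall : ∀ q : ℝ≥0∞, 1 ≤ q → q ≠ ⊤ → ∀ᶠ δ in 𝓝[>] (0 : ℝ≥0∞),
        ‖(k : ℂ)‖ₑ * δ ^ (1 / q.toReal) ≤ ε / 2 / N := by
      intro q hq hq'
      have hq0 : 0 < 1 / q.toReal :=
        one_div_pos.2 (ENNReal.toReal_pos (zero_lt_one.trans_le hq).ne' hq')
      have hcont : Tendsto (fun δ : ℝ≥0∞ => ‖(k : ℂ)‖ₑ * δ ^ (1 / q.toReal)) (𝓝 0) (𝓝 0) := by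
        have h3 : Tendsto (fun δ : ℝ≥0∞ => δ ^ (1 / q.toReal)) (𝓝 0) (𝓝 0) := by
          have := (ENNReal.continuous_rpow_const (y := 1 / q.toReal)).tendsto (0 : ℝ≥0∞)
          rwa [ENNReal.zero_rpow_of_pos hq0] at this
        have := ENNReal.Tendsto.const_mul (a := ‖(k : ℂ)‖ₑ) h3 (Or.inr enorm_ne_top)
        rwa [mul_zero] at this
      exact ((hcont.eventually (gt_mem_nhds (pos_iff_ne_zero.2 hη))).filter_mono
        nhdsWithin_le_nhds).mono fun _ h => h.le
    have : (𝓝[>] (0 : ℝ≥0∞)).NeBot := nhdsGT_neBot_of_exists_gt ⟨1, zero_lt_one⟩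
    obtain ⟨δ, ⟨hδr, hδp⟩, hδ0⟩ :=
      (((hsmall r hr1 hr).and (hsmall p hp1 hp)).and self_mem_nhdsWithin).exists
    obtain ⟨φ, S, hS, hSδ, hφ⟩ := exists_schwartz_approx_indicator
      (g.measurableSet_preimage {(k : ℂ)}) hkfin (k : ℂ) (ne_of_gt hδ0)
    refine ⟨φ, fun q hq => ?_⟩
    have hbound : ‖(k : ℂ)‖ₑ * δ ^ (1 / q.toReal) ≤ ε / 2 / N := by
      rcases hq with rfl | rfl
      exacts [hδr, hδp]
    calc _ ≤ eLpNorm (S.indicator fun _ => (k : ℂ)) q volume :=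
          eLpNorm_mono hφ
      _ ≤ ‖(k : ℂ)‖ₑ * volume S ^ (1 / q.toReal) := eLpNorm_indicator_const_le _ _
      _ ≤ ‖(k : ℂ)‖ₑ * δ ^ (1 / q.toReal) := by gcongr
      _ ≤ _ := hbound
  choose φ hφ using key
  have hfinal : ∀ q ∈ ({r, p} : Set ℝ≥0∞), 1 ≤ q → eLpNorm (g - F : V → ℂ) q volume ≤ ε / 2 →
      AEStronglyMeasurable F volume →
      eLpNorm ((∑ k, φ k : 𝓢(V, ℂ)) - F : V → ℂ) q volume ≤ ε := by
    intro q hq hq1 hgF hFm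
    have hsplit : ((∑ k, φ k : 𝓢(V, ℂ)) - F : V → ℂ) =
        (∑ k : K, fun x => φ k x - (g ⁻¹' {(k : ℂ)}).indicator (fun _ => (k : ℂ)) x)
          + (g - F : V → ℂ) := by
      funext x
      have h4 := congrFun (SimpleFunc.eq_stepFun g) x
      simp only [Pi.sub_apply, Pi.add_apply, Finset.sum_apply, Finset.sum_sub_distrib]
      rw [h4]
      simp only [stepFun, sum_apply]
      ring
    have hm1 : ∀ k : K, AEStronglyMeasurable
        (fun x => φ k x - (g ⁻¹' {(k : ℂ)}).indicator (fun _ => (k : ℂ)) x) volume := fun k =>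
      (φ k).continuous.aestronglyMeasurable.sub
        (stronglyMeasurable_const.indicator (g.measurableSet_preimage _)).aestronglyMeasurable
    rw [hsplit]
    calc _ ≤ eLpNorm (∑ k : K, fun x => φ k x -
            (g ⁻¹' {(k : ℂ)}).indicator (fun _ => (k : ℂ)) x) q volume
            + eLpNorm (g - F : V → ℂ) q volume :=
          eLpNorm_add_le (Finset.aestronglyMeasurable_sum _ fun k _ => hm1 k)
            (g.stronglyMeasurable.aestronglyMeasurable.sub hFm) hq1
      _ ≤ ε / 2 + ε / 2 := by
          refine add_le_add ?_ hgF
          refine (eLpNorm_sum_le (fun k _ => hm1 k) hq1).trans ?_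
          refine (Finset.sum_le_sum fun k _ => hφ k q hq).trans ?_
          rw [Finset.sum_const, nsmul_eq_mul, Finset.card_univ, mul_comm]
          calc ε / 2 / N * (Fintype.card K : ℝ≥0∞) ≤ ε / 2 / N * N := by
                gcongr; exact le_self_add
            _ = ε / 2 := ENNReal.div_mul_cancel hN0 hNt
      _ = ε := ENNReal.add_halves ε
  have hFm := Lp.aestronglyMeasurable F
  exact ⟨∑ k, φ k, hfinal r (by simp) hr1 h1 hFm, hfinal p (by simp) hp1 h2 hFm⟩

/-- A bound in `L^p` norm for a form needs only be checked on Schwartz functions. -/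
lemma FormBound.of_schwartz {ι : Type*} [Fintype ι] {r : ℝ≥0∞} [Fact (1 ≤ r)]
    {Λ : ContinuousMultilinearMap ℂ (fun _ : ι => Lp ℂ r (volume : Measure V)) ℂ} {p : ℝ≥0∞}
    (hr : r ≠ ⊤) (hp1 : 1 ≤ p) (hp : p ≠ ⊤) {A : ℝ}
    (h : ∀ f : ι → 𝓢(V, ℂ), ‖Λ (fun i => (f i).toLp r)‖ ≤
      A * ∏ i, (eLpNorm (f i) p volume).toReal) : FormBound Λ p A := by
  refine FormBound.of_dense hp1 (fun G => ∃ φ : 𝓢(V, ℂ), G = φ.toLp r) ?_ ?_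
  · intro F hF ε hε
    obtain ⟨φ, h1, h2⟩ := exists_schwartz_approx (Fact.out : 1 ≤ r) hp1 hr hp F hF ε hε
    have hφ := φ.coeFn_toLp r volume
    refine ⟨φ.toLp r, ⟨φ, rfl⟩, (memLp_congr_ae hφ).2 (φ.memLp p volume), ?_, ?_⟩
    · exact (eLpNorm_congr_ae (hφ.sub EventuallyEq.rfl)).trans_le h1
    · exact (eLpNorm_congr_ae (hφ.sub EventuallyEq.rfl)).trans_le h2
  · intro F hF _
    choose f hf using hF
    obtain rfl : F = fun i => (f i).toLp r := funext hf
    refine (h f).trans_eq ?_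
    congr 1
    exact Finset.prod_congr rfl fun i _ => by
      rw [eLpNorm_congr_ae ((f i).coeFn_toLp r volume)]

end Density

/-! ### Extension of multilinear operators by density -/

section Extension

universe u

variable {D E F : Type u} [NormedAddCommGroup D] [NormedSpace ℂ D] [NormedAddCommGroup E]
  [NormedSpace ℂ E]

/-- Extension of bounded operators along a dense isometric embedding, as a bounded operator on the
space of operators. -/
def extendCLM (F : Type u) [NormedAddCommGroup F] [NormedSpace ℂ F] [CompleteSpace F]
    {e : D →L[ℂ] E} (he : DenseRange e) (hiso : ∀ x, ‖e x‖ = ‖x‖) :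
    (D →L[ℂ] F) →L[ℂ] (E →L[ℂ] F) :=
  have hui : IsUniformInducing e :=
    (AddMonoidHomClass.isometry_of_norm e hiso).isUniformInducing
  LinearMap.mkContinuous
    { toFun := fun f => f.extend e
      map_add' := fun f g => ContinuousLinearMap.extend_unique _ he hui _ (by
        ext x
        simp [ContinuousLinearMap.extend_eq _ he hui])
      map_smul' := fun c f => ContinuousLinearMap.extend_unique _ he hui _ (by
        ext x
        simp [ContinuousLinearMap.extend_eq _ he hui]) }
    1 (fun f => by
      have := ContinuousLinearMap.opNorm_extend_le f (N := 1) he (fun x => by simp [hiso x])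
      simpa using this)

lemma extendCLM_apply [NormedAddCommGroup F] [NormedSpace ℂ F] [CompleteSpace F]
    {e : D →L[ℂ] E} (he : DenseRange e) (hiso : ∀ x, ‖e x‖ = ‖x‖) (f : D →L[ℂ] F) (x : D) :
    extendCLM F he hiso f (e x) = f x :=
  ContinuousLinearMap.extend_eq f he
    (AddMonoidHomClass.isometry_of_norm e hiso).isUniformInducing x

/-- Bounded multilinear operators extend along a dense isometric embedding. -/
theorem exists_multilinear_extension {e : D →L[ℂ] E} (he : DenseRange e)
    (hiso : ∀ x, ‖e x‖ = ‖x‖) (n : ℕ) (F : Type u) [NormedAddCommGroup F] [NormedSpace ℂ F]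
    [CompleteSpace F] (T : ContinuousMultilinearMap ℂ (fun _ : Fin n => D) F) :
    ∃ T' : ContinuousMultilinearMap ℂ (fun _ : Fin n => E) F,
      ∀ x : Fin n → D, T' (fun i => e (x i)) = T x := by
  induction n generalizing F with
  | zero =>
    refine ⟨ContinuousMultilinearMap.constOfIsEmpty ℂ _ (T 0), fun x => ?_⟩
    rw [Subsingleton.elim x 0]
    rfl
  | succ n ih =>
    obtain ⟨S, hS⟩ := ih (E →L[ℂ] F)
      ((extendCLM F he hiso).compContinuousMultilinearMap T.curryRight)
    refine ⟨ContinuousMultilinearMap.uncurryRight (Ei := fun _ => E) S, fun x => ?_⟩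
    rw [ContinuousMultilinearMap.uncurryRight_apply]
    have h1 := hS (Fin.init x)
    have h2 : (Fin.init fun i => e (x i) : Fin n → E) =
        fun i => e (Fin.init (α := fun _ => D) x i) := rfl
    rw [h2, h1, ContinuousLinearMap.compContinuousMultilinearMap_coe, Function.comp_apply,
      extendCLM_apply, ContinuousMultilinearMap.curryRight_apply, Fin.snoc_init_self]

end Extension

/-! ### Duality in `L^p` -/

section Duality

variable {V : Type*} [NormedAddCommGroup V] [InnerProductSpace ℝ V] [FiniteDimensional ℝ V]
  [MeasurableSpace V] [BorelSpace V]

/-- The converse of Hölder's inequality: the `L^q` norm of a function in `L^q` is controlled by its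
pairings with Schwartz functions. -/
lemma eLpNorm_le_of_schwartz_pairing {p q : ℝ≥0∞} (hpq : p.HolderConjugate q) (hp1 : 1 < p)
    (hp : p ≠ ⊤) {h : V → ℂ} (hh : MemLp h q volume) {C : ℝ} (hC0 : 0 ≤ C)
    (hC : ∀ φ : 𝓢(V, ℂ), ‖∫ x, h x * φ x‖ ≤ C * (eLpNorm φ p volume).toReal) :
    (eLpNorm h q volume).toReal ≤ C := by
  have hinv := ENNReal.HolderConjugate.inv_add_inv_eq_one p q
  have hq : q ≠ ⊤ := by
    rintro rfl
    simp only [ENNReal.inv_top, add_zero, ENNReal.inv_eq_one] at hinv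
    exact hp1.ne' hinv
  have hpq' : p.toReal.HolderConjugate q.toReal := ENNReal.HolderConjugate.toReal_of_ne_top hp hq
  have hq1' : 1 < q.toReal := hpq'.symm.lt
  have hq0 : q ≠ 0 := fun h0 => by rw [h0] at hq1'; norm_num at hq1'
  have : Fact (1 ≤ p) := ⟨hp1.le⟩
  have : Fact (1 ≤ q) := ⟨ENNReal.HolderConjugate.one_le q p⟩
  set N := (eLpNorm h q volume).toReal with hN
  have hN0 : 0 ≤ N := ENNReal.toReal_nonneg
  rcases hN0.eq_or_lt with hN' | hNpos
  · rw [← hN']; exact hC0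
  set ℓ : Lp ℂ p (volume : Measure V) →L[ℂ] ℂ :=
    (ContinuousLinearMap.mul ℂ ℂ).lpPairing volume q p hh.toLp with hℓ
  have hℓ' : ∀ g : Lp ℂ p (volume : Measure V), ℓ g = ∫ x, h x * g x := by
    intro g
    rw [hℓ, ContinuousLinearMap.lpPairing_eq_integral]
    refine integral_congr_ae ?_
    filter_upwards [hh.coeFn_toLp] with x hx
    simp [hx]
  have hbound : ∀ g : Lp ℂ p (volume : Measure V), ‖ℓ g‖ ≤ C * ‖g‖ := by
    intro g
    refine (SchwartzMap.denseRange_toLpCLM (F := ℂ) (μ := (volume : Measure V)) hp).induction_on g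
      (isClosed_le ℓ.continuous.norm (continuous_const.mul continuous_norm)) fun φ => ?_
    rw [hℓ', SchwartzMap.toLpCLM_apply, SchwartzMap.norm_toLp]
    convert hC φ using 2
    refine integral_congr_ae ?_
    filter_upwards [φ.coeFn_toLp p volume] with x hx
    rw [hx]
  -- the extremal function `|h|^{q-2} conj h`
  set g₀ : V → ℂ := fun x => starRingEnd ℂ (h x) * ((‖h x‖ ^ (q.toReal - 2) : ℝ) : ℂ) with hg₀
  have hnorm : ∀ x, ‖g₀ x‖ = ‖h x‖ ^ (q.toReal - 1) := by
    intro x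
    rcases eq_or_ne (h x) 0 with hx | hx
    · simp only [hg₀, hx, map_zero, zero_mul, norm_zero]
      rw [Real.zero_rpow (by linarith)]
    · have hx' : 0 < ‖h x‖ := norm_pos_iff.2 hx
      simp only [hg₀, norm_mul, RCLike.norm_conj, Complex.norm_real]
      rw [Real.norm_of_nonneg (by positivity)]
      nth_rewrite 1 [← Real.rpow_one ‖h x‖]
      rw [← Real.rpow_add hx']
      congr 1
      ring
  have hmeas : AEStronglyMeasurable g₀ volume := by
    have h1 := hh.1
    have h2 : AEMeasurable (fun x => ‖h x‖ ^ (q.toReal - 2)) volume :=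
      (h1.norm.aemeasurable).pow_const _
    exact (Complex.continuous_conj.comp_aestronglyMeasurable h1).mul
      (Complex.continuous_ofReal.comp_aestronglyMeasurable h2.aestronglyMeasurable)
  have hpe : p * ENNReal.ofReal (q.toReal - 1) = q := by
    rw [← ENNReal.ofReal_toReal hp, ← ENNReal.ofReal_mul ENNReal.toReal_nonneg]
    rw [← ENNReal.ofReal_toReal hq]
    congr 1
    rw [ENNReal.toReal_ofReal ENNReal.toReal_nonneg]
    have := hpq'.mul_eq_add
    linarith
  have hg₀norm : eLpNorm g₀ p volume = eLpNorm h q volume ^ (q.toReal - 1) := by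
    have h1 := eLpNorm_norm_rpow (p := p) (μ := volume) h (q := q.toReal - 1) (by linarith)
    rw [hpe] at h1
    rw [← h1]
    refine eLpNorm_congr_norm_ae (Eventually.of_forall fun x => ?_)
    rw [hnorm, Real.norm_of_nonneg (by positivity)]
  have hg₀mem : MemLp g₀ p volume :=
    ⟨hmeas, by rw [hg₀norm]; exact ENNReal.rpow_lt_top_of_nonneg (by linarith) hh.2.ne⟩
  have hint : ∫ x, h x * g₀ x = ((N ^ q.toReal : ℝ) : ℂ) := by
    have h1 : ∀ x, h x * g₀ x = ((‖h x‖ ^ q.toReal : ℝ) : ℂ) := by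
      intro x
      rcases eq_or_ne (h x) 0 with hx | hx
      · simp only [hx, zero_mul, norm_zero]
        rw [Real.zero_rpow (by linarith)]
        simp
      · have hx' : 0 < ‖h x‖ := norm_pos_iff.2 hx
        simp only [hg₀]
        rw [← mul_assoc, Complex.mul_conj, Complex.normSq_eq_norm_sq, ← Complex.ofReal_mul,
          ← Real.rpow_natCast, ← Real.rpow_add hx']
        congr 2
        push_cast
        ring
    simp_rw [h1]
    rw [integral_complex_ofReal]
    congr 1
    rw [hN, hh.eLpNorm_eq_integral_rpow_norm hq0 hq, ENNReal.toReal_ofReal (by positivity),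
      ← Real.rpow_mul (integral_nonneg fun x => by positivity), inv_mul_cancel₀ (by linarith),
      Real.rpow_one]
  have hfin := hbound hg₀mem.toLp
  rw [hℓ', Lp.norm_toLp, hg₀norm, ← ENNReal.toReal_rpow, ← hN] at hfin
  have h2 : ∫ x, h x * (hg₀mem.toLp : Lp ℂ p (volume : Measure V)) x = ∫ x, h x * g₀ x := by
    refine integral_congr_ae ?_
    filter_upwards [hg₀mem.coeFn_toLp] with x hx
    rw [hx]
  rw [h2, hint, Complex.norm_real, Real.norm_of_nonneg (by positivity)] at hfin
  have h3 : N ^ q.toReal = N * N ^ (q.toReal - 1) := by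
    rw [← Real.rpow_one_add' hN0 (by linarith)]
    congr 1
    ring
  rw [h3] at hfin
  exact le_of_mul_le_mul_right hfin (by positivity)

/-- A functional on Schwartz functions that is bounded in `L²` norm is integration against a
function in `L²`. -/
lemma exists_L2_representative (ℓ : 𝓢(V, ℂ) →ₗ[ℂ] ℂ) {C : ℝ} (hC : 0 ≤ C)
    (h : ∀ u, ‖ℓ u‖ ≤ C * (eLpNorm u 2 volume).toReal) :
    ∃ g : Lp ℂ 2 (volume : Measure V), ‖g‖ ≤ C ∧ ∀ u : 𝓢(V, ℂ), ℓ u = ∫ x, u x * g x := by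
  set e := (SchwartzMap.toLpCLM ℂ ℂ 2 (volume : Measure V)).toLinearMap with he
  have hdense : DenseRange e :=
    SchwartzMap.denseRange_toLpCLM (F := ℂ) (μ := (volume : Measure V)) ENNReal.ofNat_ne_top
  have hb : ∀ u, ‖ℓ u‖ ≤ C * ‖e u‖ := fun u => by
    refine (h u).trans_eq ?_
    congr 1
    exact (SchwartzMap.norm_toLp).symm
  set ℓ' := ℓ.extendOfNorm e
  have hℓ' : ‖ℓ'‖ ≤ C := LinearMap.opNorm_extendOfNorm_le hdense hC hb
  set g₀ : Lp ℂ 2 (volume : Measure V) := (InnerProductSpace.toDual ℂ _).symm ℓ' with hg₀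
  have hg₀n : ‖g₀‖ ≤ C := by rwa [hg₀, LinearIsometryEquiv.norm_map]
  have hmem : MemLp (fun x => starRingEnd ℂ (g₀ x)) 2 volume := (Lp.memLp g₀).star
  refine ⟨hmem.toLp, ?_, fun u => ?_⟩
  · rw [Lp.norm_toLp]
    rw [Lp.norm_def] at hg₀n
    convert hg₀n using 2
    exact eLpNorm_congr_norm_ae (Eventually.of_forall fun x => RCLike.norm_conj _)
  · have h1 : ℓ u = inner ℂ g₀ (e u) := by
      rw [hg₀, InnerProductSpace.toDual_symm_apply]
      exact (LinearMap.extendOfNorm_eq hdense ⟨C, hb⟩ u).symm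
    rw [h1, L2.inner_def]
    refine integral_congr_ae ?_
    filter_upwards [hmem.coeFn_toLp, u.coeFn_toLp 2 volume] with x hx hx'
    have hx'' : (e u : V → ℂ) x = u x := hx'
    rw [hx, hx'', RCLike.inner_apply]

/-- A multilinear operator on Schwartz functions with an `L^p × ⋯ × L^p → L^q` bound extends to a
bounded operator on `L^p × ⋯ × L^p`. -/
theorem exists_extension_of_schwartz_bound {m : ℕ} {p q : ℝ≥0∞} [Fact (1 ≤ p)] [Fact (1 ≤ q)]
    (hp : p ≠ ⊤) (B : MultilinearMap ℂ (fun _ : Fin m => 𝓢(V, ℂ)) (V → ℂ)) {C : ℝ}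
    (hmem : ∀ f, MemLp (B f) q volume)
    (hB : ∀ f, (eLpNorm (B f) q volume).toReal ≤ C * ∏ j, (eLpNorm (f j) p volume).toReal) :
    ∃ T : ContinuousMultilinearMap ℂ (fun _ : Fin m => Lp ℂ p (volume : Measure V))
        (Lp ℂ q (volume : Measure V)),
      ∀ f : Fin m → 𝓢(V, ℂ), T (fun j => (f j).toLp p) =ᵐ[volume] B f := by
  set e := (SchwartzMap.toLpCLM ℂ ℂ p (volume : Measure V)).toLinearMap with he
  have hinj : Function.Injective e := SchwartzMap.injective_toLp p (volume : Measure V)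
  have hdense : DenseRange e :=
    SchwartzMap.denseRange_toLpCLM (F := ℂ) (μ := (volume : Measure V)) hp
  set s := LinearEquiv.ofInjective e hinj with hs
  set B' : MultilinearMap ℂ (fun _ : Fin m => 𝓢(V, ℂ)) (Lp ℂ q (volume : Measure V)) :=
    { toFun := fun f => (hmem f).toLp
      map_update_add' := by
        intro _ f i x y
        rw [← MemLp.toLp_add]
        congr 1
        convert B.map_update_add f i x y
      map_update_smul' := by
        intro _ f i c x
        rw [← MemLp.toLp_const_smul]
        congr 1
        convert B.map_update_smul f i c x } with hB'
  set T₀ := (B'.compLinearMap fun _ => s.symm.toLinearMap).mkContinuous C (by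
    intro x
    have h1 : ∀ j, ‖x j‖ = (eLpNorm (s.symm (x j)) p volume).toReal := by
      intro j
      rw [← SchwartzMap.norm_toLp]
      change ‖((x j : Lp ℂ p (volume : Measure V)))‖ = ‖e (s.symm (x j))‖
      congr 1
      exact (congrArg Subtype.val (s.apply_symm_apply (x j))).symm
    simp_rw [h1]
    exact (Lp.norm_toLp _ (hmem fun j => s.symm (x j))).trans_le (hB _)) with hT₀
  have hdense' : DenseRange (LinearMap.range e).subtypeL := by
    have h1 : range (LinearMap.range e).subtypeL = range e := by
      ext x
      simp
    rw [DenseRange, h1]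
    exact hdense
  obtain ⟨T, hT⟩ := exists_multilinear_extension (e := (LinearMap.range e).subtypeL) hdense'
    (fun x => rfl) m (Lp ℂ q (volume : Measure V)) T₀
  refine ⟨T, fun f => ?_⟩
  have h1 := hT fun j => s (f j)
  have h2 : T₀ (fun j => s (f j)) = (hmem f).toLp := by
    change (hmem fun j => s.symm (s (f j))).toLp = _
    congr 1
    simp
  rw [h2] at h1
  have h3 : (fun j => (f j).toLp p volume) = fun j => (LinearMap.range e).subtypeL (s (f j)) := rfl
  rw [h3, h1]
  exact (hmem f).coeFn_toLp

end Duality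

/-! ### Changes of variables and product integrals -/

/-- A linear isomorphism changes integrals against Haar measures by a constant factor only. -/
lemma exists_lintegral_comp_eq {E F : Type*} [NormedAddCommGroup E] [NormedSpace ℝ E]
    [FiniteDimensional ℝ E] [MeasurableSpace E] [BorelSpace E] [NormedAddCommGroup F]
    [NormedSpace ℝ F] [FiniteDimensional ℝ F] [MeasurableSpace F] [BorelSpace F] (e : E ≃ₗ[ℝ] F)
    (μ : Measure E) [μ.IsAddHaarMeasure] (ν : Measure F) [ν.IsAddHaarMeasure] :
    ∃ c : ℝ≥0∞, c ≠ 0 ∧ c ≠ ⊤ ∧ ∀ f : F → ℝ≥0∞, ∫⁻ x, f (e x) ∂μ = c * ∫⁻ y, f y ∂ν := by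
  have : (μ.map e).IsAddHaarMeasure := e.toContinuousLinearEquiv.isAddHaarMeasure_map μ
  have h := Measure.isAddLeftInvariant_eq_smul (μ.map e) ν
  refine ⟨(μ.map e).addHaarScalarFactor ν, ?_, ENNReal.coe_ne_top, fun f => ?_⟩
  · exact ENNReal.coe_ne_zero.2 (Measure.addHaarScalarFactor_pos_of_isAddHaarMeasure _ _).ne'
  · have h1 : ∫⁻ y, f y ∂(μ.map e) = ∫⁻ x, f (e x) ∂μ :=
      (e.toContinuousLinearEquiv.toHomeomorph.measurableEmbedding).lintegral_map f
    rw [← h1]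
    conv_lhs => rw [h]
    rw [lintegral_smul_measure]
    simp [ENNReal.smul_def]

/-- Tonelli's theorem for a product of functions of separate variables. -/
lemma lintegral_fin_prod_eq_prod {E : Type*} [MeasurableSpace E] (μ : Measure E) [SigmaFinite μ]
    {n : ℕ} {f : Fin n → E → ℝ≥0∞} (hf : ∀ i, Measurable (f i)) :
    ∫⁻ x : Fin n → E, ∏ i, f i (x i) ∂(Measure.pi fun _ => μ) = ∏ i, ∫⁻ x, f i x ∂μ := by
  induction n with
  | zero => simp
  | succ n ih =>
    have hmp := (measurePreserving_piFinSuccAbove (fun _ : Fin (n + 1) => μ) 0).symm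
    rw [← hmp.lintegral_comp_emb (MeasurableEquiv.measurableEmbedding _)]
    simp_rw [MeasurableEquiv.piFinSuccAbove_symm_apply, Fin.insertNthEquiv,
      Fin.prod_univ_succ, Fin.insertNth_zero]
    simp only [Equiv.coe_fn_mk, Fin.cons_succ, Fin.cons_zero]
    change ∫⁻ a : E × (Fin n → E), f 0 a.1 * ∏ j, f j.succ (a.2 j) ∂_ = _
    rw [lintegral_prod_mul (f := f 0) (g := fun x : Fin n → E => ∏ i, f i.succ (x i))
      (hf 0).aemeasurable
      (Finset.measurable_prod _ fun i _ => (hf i.succ).comp (measurable_pi_apply i)).aemeasurable]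
    rw [ih fun i => hf i.succ]

lemma enorm_finsetProd {ι : Type*} (s : Finset ι) (f : ι → ℂ) : ‖∏ i ∈ s, f i‖ₑ = ∏ i ∈ s, ‖f i‖ₑ := by
  simp [enorm_eq_nnnorm, nnnorm_prod]

/-! ### The multilinear form associated with a measure -/

section Form

variable {m d : ℕ}

/-- The translations `(0, u¹, …, uᵐ)` applied to the `m + 1` arguments of the multilinear form. -/
def tupleShift (u : TupleSpace m d) (i : Fin (m + 1)) : EuclideanSpace ℝ (Fin d) :=
  Fin.cons (α := fun _ => EuclideanSpace ℝ (Fin d)) 0 (fun j => u j) i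

lemma continuous_tupleShift (i : Fin (m + 1)) :
    Continuous fun u : TupleSpace m d => tupleShift u i := by
  refine Fin.cases ?_ (fun j => ?_) i
  · exact continuous_const
  · change Continuous fun u : TupleSpace m d => u j
    fun_prop

/-- The integrand `f₀(x) f₁(x - u¹) ⋯ f_m(x - uᵐ) ψ(u)` of the multilinear form, as a function of
`(u, x)`. -/
def formIntegrand (ψ : TupleSpace m d → ℂ) (F : Fin (m + 1) → EuclideanSpace ℝ (Fin d) → ℂ)
    (y : TupleSpace m d × EuclideanSpace ℝ (Fin d)) : ℂ :=
  (∏ i, F i (y.2 - tupleShift y.1 i)) * ψ y.1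

lemma quasiMeasurePreserving_sub_tupleShift (σ : Measure (TupleSpace m d)) [SFinite σ]
    (i : Fin (m + 1)) :
    Measure.QuasiMeasurePreserving
      (fun y : TupleSpace m d × EuclideanSpace ℝ (Fin d) => y.2 - tupleShift y.1 i)
      (σ.prod volume) volume := by
  have h1 : MeasurePreserving
      (fun y : TupleSpace m d × EuclideanSpace ℝ (Fin d) => (y.1, y.2 - tupleShift y.1 i))
      (σ.prod volume) (σ.prod volume) := by
    refine (MeasurePreserving.id σ).skew_product
      (g := fun u x => x - tupleShift u i) ?_ ?_
    · exact (continuous_snd.sub ((continuous_tupleShift i).comp continuous_fst)).measurable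
    · exact ae_of_all _ fun u => (measurePreserving_sub_right volume _).map_eq
  exact Measure.quasiMeasurePreserving_snd.comp h1.quasiMeasurePreserving

lemma measurable_sub_tupleShift (i : Fin (m + 1)) : Measurable
    (fun y : TupleSpace m d × EuclideanSpace ℝ (Fin d) => y.2 - tupleShift y.1 i) :=
  (continuous_snd.sub ((continuous_tupleShift i).comp continuous_fst)).measurable

lemma formIntegrand_congr {σ : Measure (TupleSpace m d)} [SFinite σ] (ψ : TupleSpace m d → ℂ)
    {F G : Fin (m + 1) → EuclideanSpace ℝ (Fin d) → ℂ} (h : ∀ i, F i =ᵐ[volume] G i) :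
    formIntegrand ψ F =ᵐ[σ.prod volume] formIntegrand ψ G := by
  have h1 : ∀ i, ∀ᵐ y ∂σ.prod volume, F i (y.2 - tupleShift y.1 i) =
      G i (y.2 - tupleShift y.1 i) := fun i =>
    (quasiMeasurePreserving_sub_tupleShift σ i).ae (h i)
  filter_upwards [ae_all_iff.2 h1] with y hy
  simp only [formIntegrand, hy]

lemma aestronglyMeasurable_formIntegrand {σ : Measure (TupleSpace m d)} [SFinite σ]
    {ψ : TupleSpace m d → ℂ} (hψ : AEStronglyMeasurable ψ σ)
    {F : Fin (m + 1) → EuclideanSpace ℝ (Fin d) → ℂ}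
    (hF : ∀ i, AEStronglyMeasurable (F i) volume) :
    AEStronglyMeasurable (formIntegrand ψ F) (σ.prod volume) :=
  (Finset.aestronglyMeasurable_fun_prod _ fun i _ =>
    (hF i).comp_quasiMeasurePreserving (quasiMeasurePreserving_sub_tupleShift σ i)).mul
    hψ.comp_fst

/-- Hölder's inequality with `m + 1` functions in `L^{m+1}`. -/
lemma lintegral_formIntegrand_le {σ : Measure (TupleSpace m d)} [SFinite σ]
    {ψ : TupleSpace m d → ℂ} (hψ : AEStronglyMeasurable ψ σ)
    {F : Fin (m + 1) → EuclideanSpace ℝ (Fin d) → ℂ}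
    (hF : ∀ i, AEStronglyMeasurable (F i) volume) :
    ∫⁻ y, ‖formIntegrand ψ F y‖ₑ ∂σ.prod volume ≤
      (∫⁻ u, ‖ψ u‖ₑ ∂σ) * ∏ i, eLpNorm (F i) (m + 1) volume := by
  have hm0 : ((m : ℝ≥0∞) + 1) ≠ 0 := by simp
  have hmt : ((m : ℝ≥0∞) + 1) ≠ ⊤ := by simp
  have hmr : ((m : ℝ≥0∞) + 1).toReal = (m : ℝ) + 1 := by
    rw [ENNReal.toReal_add (by simp) (by simp)]; simp
  rw [lintegral_prod _ (aestronglyMeasurable_formIntegrand hψ hF).enorm]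
  have hinner : ∀ u : TupleSpace m d, ∫⁻ x, ‖formIntegrand ψ F (u, x)‖ₑ ≤
      ‖ψ u‖ₑ * ∏ i, eLpNorm (F i) (m + 1) volume := by
    intro u
    have h1 : ∀ x, ‖formIntegrand ψ F (u, x)‖ₑ = ‖ψ u‖ₑ *
        ∏ i, (‖F i (x - tupleShift u i)‖ₑ ^ ((m : ℝ) + 1)) ^ ((m : ℝ) + 1)⁻¹ := by
      intro x
      simp only [formIntegrand, enorm_mul]
      rw [mul_comm]
      congr 1
      have : ∀ i, (‖F i (x - tupleShift u i)‖ₑ ^ ((m : ℝ) + 1)) ^ ((m : ℝ) + 1)⁻¹ =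
          ‖F i (x - tupleShift u i)‖ₑ := fun i => by
        rw [← ENNReal.rpow_mul, mul_inv_cancel₀ (by positivity), ENNReal.rpow_one]
      simp_rw [this]
      exact enorm_finsetProd _ _
    simp_rw [h1]
    have hmeas : ∀ i, AEMeasurable (fun x => ‖F i (x - tupleShift u i)‖ₑ ^ ((m : ℝ) + 1))
        volume := fun i =>
      (((hF i).comp_quasiMeasurePreserving
        (measurePreserving_sub_right volume (tupleShift u i)).quasiMeasurePreserving).enorm).pow_const _
    rw [lintegral_const_mul'' _ (Finset.aemeasurable_fun_prod _ fun i _ => (hmeas i).pow_const _)]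
    gcongr
    refine (ENNReal.lintegral_prod_norm_pow_le _ (fun i _ => hmeas i) ?_ ?_).trans_eq ?_
    · simp only [Finset.sum_const, Finset.card_univ, Fintype.card_fin, nsmul_eq_mul]
      push_cast
      exact mul_inv_cancel₀ (by positivity)
    · intro i _; positivity
    · refine Finset.prod_congr rfl fun i _ => ?_
      rw [eLpNorm_eq_lintegral_rpow_enorm_toReal hm0 hmt, hmr, one_div]
      congr 1
      exact lintegral_sub_right_eq_self (fun x => ‖F i x‖ₑ ^ ((m : ℝ) + 1)) _
  calc _ ≤ ∫⁻ u, ‖ψ u‖ₑ * ∏ i, eLpNorm (F i) (m + 1) volume ∂σ := lintegral_mono hinner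
    _ = _ := lintegral_mul_const'' _ hψ.enorm

lemma integrable_formIntegrand {σ : Measure (TupleSpace m d)} [SFinite σ]
    {ψ : TupleSpace m d → ℂ} (hψ : Integrable ψ σ)
    {F : Fin (m + 1) → EuclideanSpace ℝ (Fin d) → ℂ}
    (hF : ∀ i, MemLp (F i) (m + 1) volume) :
    Integrable (formIntegrand ψ F) (σ.prod volume) :=
  ⟨aestronglyMeasurable_formIntegrand hψ.1 fun i => (hF i).1,
    (lintegral_formIntegrand_le hψ.1 fun i => (hF i).1).trans_lt
      (ENNReal.mul_lt_top hψ.2 (ENNReal.prod_lt_top fun i _ => (hF i).2))⟩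

instance fact_one_le_add_one (m : ℕ) : Fact ((1 : ℝ≥0∞) ≤ (m : ℝ≥0∞) + 1) := ⟨le_add_self⟩

lemma norm_integral_formIntegrand_le {σ : Measure (TupleSpace m d)} [SFinite σ]
    {ψ : TupleSpace m d → ℂ} (hψ : Integrable ψ σ)
    {F : Fin (m + 1) → EuclideanSpace ℝ (Fin d) → ℂ}
    (hF : ∀ i, MemLp (F i) (m + 1) volume) :
    ‖∫ y, formIntegrand ψ F y ∂σ.prod volume‖ ≤
      (∫ u, ‖ψ u‖ ∂σ) * ∏ i, (eLpNorm (F i) (m + 1) volume).toReal := by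
  have h1 := lintegral_formIntegrand_le hψ.1 fun i => (hF i).1
  have h2 : ((∫⁻ u, ‖ψ u‖ₑ ∂σ) * ∏ i, eLpNorm (F i) (m + 1) volume) ≠ ⊤ :=
    (ENNReal.mul_lt_top hψ.2 (ENNReal.prod_lt_top fun i _ => (hF i).2)).ne
  calc _ ≤ (∫⁻ y, ‖formIntegrand ψ F y‖ₑ ∂σ.prod volume).toReal :=
        norm_integral_le_lintegral_norm _ |>.trans_eq (by simp)
    _ ≤ ((∫⁻ u, ‖ψ u‖ₑ ∂σ) * ∏ i, eLpNorm (F i) (m + 1) volume).toReal :=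
        ENNReal.toReal_mono h2 h1
    _ = _ := by
        rw [ENNReal.toReal_mul, ENNReal.toReal_prod, integral_norm_eq_lintegral_enorm hψ.1]

/-- The `(m + 1)`-linear form `(f₀, …, f_m) ↦ ∫∫ f₀(x) f₁(x - u¹) ⋯ f_m(x - uᵐ) ψ(u) dσ(u) dx` on
`L^{m+1}`. -/
def multilinearForm (σ : Measure (TupleSpace m d)) [SFinite σ] {ψ : TupleSpace m d → ℂ}
    (hψ : Integrable ψ σ) : ContinuousMultilinearMap ℂ
      (fun _ : Fin (m + 1) => Lp ℂ (m + 1) (volume : Measure (EuclideanSpace ℝ (Fin d)))) ℂ :=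
  MultilinearMap.mkContinuous
    { toFun := fun F => ∫ y, formIntegrand ψ (fun i => F i) y ∂σ.prod volume
      map_update_add' := by
        intro _ F i f g
        rw [← integral_add (integrable_formIntegrand hψ fun j => Lp.memLp _)
          (integrable_formIntegrand hψ fun j => Lp.memLp _)]
        refine integral_congr_ae ?_
        filter_upwards [(quasiMeasurePreserving_sub_tupleShift σ i).ae (Lp.coeFn_add f g)]
          with y hy
        simp only [formIntegrand, ← add_mul]
        congr 1
        have key : ∀ h : Lp ℂ (m + 1) (volume : Measure (EuclideanSpace ℝ (Fin d))),
            (fun j => (Function.update F i h j : EuclideanSpace ℝ (Fin d) → ℂ)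
              (y.2 - tupleShift y.1 j)) =
            Function.update (fun j => (F j : EuclideanSpace ℝ (Fin d) → ℂ)
              (y.2 - tupleShift y.1 j)) i (h (y.2 - tupleShift y.1 i)) := by
          intro h
          funext j
          by_cases hj : j = i
          · subst hj; simp
          · simp [hj]
        have := (MultilinearMap.mkPiAlgebra ℂ (Fin (m + 1)) ℂ).map_update_add
          (fun j => (F j : EuclideanSpace ℝ (Fin d) → ℂ) (y.2 - tupleShift y.1 j)) i
          (f (y.2 - tupleShift y.1 i)) (g (y.2 - tupleShift y.1 i))
        simp only [MultilinearMap.mkPiAlgebra_apply] at this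
        rw [Pi.add_apply] at hy
        rw [← hy, ← key, ← key, ← key] at this
        convert this
      map_update_smul' := by
        intro _ F i c f
        rw [← integral_smul]
        refine integral_congr_ae ?_
        filter_upwards [(quasiMeasurePreserving_sub_tupleShift σ i).ae (Lp.coeFn_smul c f)]
          with y hy
        simp only [formIntegrand, ← smul_mul_assoc]
        congr 1
        have key : ∀ h : Lp ℂ (m + 1) (volume : Measure (EuclideanSpace ℝ (Fin d))),
            (fun j => (Function.update F i h j : EuclideanSpace ℝ (Fin d) → ℂ)
              (y.2 - tupleShift y.1 j)) =
            Function.update (fun j => (F j : EuclideanSpace ℝ (Fin d) → ℂ)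
              (y.2 - tupleShift y.1 j)) i (h (y.2 - tupleShift y.1 i)) := by
          intro h
          funext j
          by_cases hj : j = i
          · subst hj; simp
          · simp [hj]
        have := (MultilinearMap.mkPiAlgebra ℂ (Fin (m + 1)) ℂ).map_update_smul
          (fun j => (F j : EuclideanSpace ℝ (Fin d) → ℂ) (y.2 - tupleShift y.1 j)) i c
          (f (y.2 - tupleShift y.1 i))
        simp only [MultilinearMap.mkPiAlgebra_apply] at this
        rw [Pi.smul_apply] at hy
        rw [← hy, ← key, ← key] at this
        convert this }
    (∫ u, ‖ψ u‖ ∂σ)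
    (fun F => by
      simp_rw [Lp.norm_def]
      exact norm_integral_formIntegrand_le hψ fun i => Lp.memLp _)

lemma multilinearForm_apply (σ : Measure (TupleSpace m d)) [SFinite σ] {ψ : TupleSpace m d → ℂ}
    (hψ : Integrable ψ σ)
    (F : Fin (m + 1) → Lp ℂ (m + 1) (volume : Measure (EuclideanSpace ℝ (Fin d)))) :
    multilinearForm σ hψ F = ∫ y, formIntegrand ψ (fun i => F i) y ∂σ.prod volume := rfl

lemma formBound_multilinearForm (σ : Measure (TupleSpace m d)) [SFinite σ]
    {ψ : TupleSpace m d → ℂ} (hψ : Integrable ψ σ) :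
    FormBound (multilinearForm σ hψ) (m + 1) (∫ u, ‖ψ u‖ ∂σ) := fun F _ =>
  norm_integral_formIntegrand_le hψ fun i => Lp.memLp (F i)

/-- For an absolutely continuous measure with bounded density, the form is bounded in `L¹`. -/
lemma exists_formBound_one (m d : ℕ) : ∃ c : ℝ, 0 ≤ c ∧ ∀ (ψ : TupleSpace m d → ℂ)
    (hψ : Integrable ψ volume) (S : ℝ), (∀ u, ‖ψ u‖ ≤ S) →
    FormBound (multilinearForm volume hψ) 1 (c * S) := by
  obtain ⟨c, -, hct, hc⟩ := exists_lintegral_comp_eq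
    (WithLp.linearEquiv 2 ℝ (Fin m → EuclideanSpace ℝ (Fin d)))
    volume (volume : Measure (Fin m → EuclideanSpace ℝ (Fin d)))
  refine ⟨c.toReal, ENNReal.toReal_nonneg, fun ψ hψ S hS F hF => ?_⟩
  have hS0 : 0 ≤ S := (norm_nonneg _).trans (hS 0)
  have hFm : ∀ i, Measurable fun x => ‖F i x‖ₑ := fun i => (Lp.stronglyMeasurable (F i)).enorm
  have hprod : ∀ x : EuclideanSpace ℝ (Fin d), ∫⁻ u : TupleSpace m d, ∏ i, ‖F i (x - tupleShift u i)‖ₑ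
      = ‖F 0 x‖ₑ * (c * ∏ j : Fin m, ∫⁻ v, ‖F j.succ v‖ₑ) := by
    intro x
    simp_rw [Fin.prod_univ_succ]
    have h1 : ∀ u : TupleSpace m d, tupleShift u 0 = 0 := fun u => rfl
    have h2 : ∀ (u : TupleSpace m d) (j : Fin m), tupleShift u j.succ = u j := fun u j => rfl
    simp_rw [h1, h2, sub_zero]
    have hmeas : ∀ j : Fin m, Measurable fun v : EuclideanSpace ℝ (Fin d) => ‖F j.succ (x - v)‖ₑ :=
      fun j => (hFm j.succ).comp (measurable_const.sub measurable_id)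
    have hmeas' : Measurable fun u : TupleSpace m d =>
        ∏ j : Fin m, ‖F j.succ (x - u j)‖ₑ :=
      Finset.measurable_prod _ fun j _ => (hmeas j).comp
        (by fun_prop : Measurable fun u : TupleSpace m d => u j)
    rw [lintegral_const_mul _ hmeas']
    congr 1
    have h3 := hc fun u => ∏ j : Fin m, ‖F j.succ (x - u j)‖ₑ
    refine h3.trans ?_
    congr 1
    refine (lintegral_fin_prod_eq_prod volume hmeas).trans ?_
    refine Finset.prod_congr rfl fun j _ => ?_
    exact lintegral_sub_left_eq_self (fun v => ‖F j.succ v‖ₑ) x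
  have hle : ∫⁻ y, ‖formIntegrand ψ (fun i => F i) y‖ₑ
      ∂(volume : Measure (TupleSpace m d)).prod volume ≤
      ENNReal.ofReal S * (c * ∏ i, eLpNorm (F i) 1 volume) := by
    have hpm : Measurable fun y : TupleSpace m d × EuclideanSpace ℝ (Fin d) =>
        ∏ i, ‖F i (y.2 - tupleShift y.1 i)‖ₑ :=
      Finset.measurable_prod _ fun i _ => (hFm i).comp (measurable_sub_tupleShift i)
    calc _ ≤ ∫⁻ y : TupleSpace m d × EuclideanSpace ℝ (Fin d),
          ENNReal.ofReal S * ∏ i, ‖F i (y.2 - tupleShift y.1 i)‖ₑ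
          ∂(volume : Measure (TupleSpace m d)).prod volume := by
          refine lintegral_mono fun y => ?_
          simp only [formIntegrand, enorm_mul]
          rw [mul_comm, enorm_finsetProd]
          gcongr
          rw [← ofReal_norm]
          exact ENNReal.ofReal_le_ofReal (hS _)
      _ = ENNReal.ofReal S * ∫⁻ x : EuclideanSpace ℝ (Fin d), ∫⁻ u : TupleSpace m d,
            ∏ i, ‖F i (x - tupleShift u i)‖ₑ := by
          rw [lintegral_const_mul _ hpm, lintegral_prod_symm _ hpm.aemeasurable]
      _ = _ := by
          simp_rw [hprod]
          rw [lintegral_mul_const _ (hFm 0), Fin.prod_univ_succ]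
          simp_rw [eLpNorm_one_eq_lintegral_enorm]
          ring
  have hfin : ENNReal.ofReal S * (c * ∏ i, eLpNorm (F i) 1 volume) ≠ ⊤ :=
    ENNReal.mul_ne_top ENNReal.ofReal_ne_top
      (ENNReal.mul_ne_top hct (ENNReal.prod_lt_top fun i _ => (hF i).2).ne)
  rw [multilinearForm_apply]
  calc _ ≤ (∫⁻ y, ‖formIntegrand ψ (fun i => F i) y‖ₑ
          ∂(volume : Measure (TupleSpace m d)).prod volume).toReal :=
        norm_integral_le_lintegral_norm _ |>.trans_eq (by simp)
    _ ≤ _ := ENNReal.toReal_mono hfin hle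
    _ = _ := by
        rw [ENNReal.toReal_mul, ENNReal.toReal_mul, ENNReal.toReal_prod,
          ENNReal.toReal_ofReal hS0]
        ring

/-- On Schwartz functions the form is the pairing of the first function with the multilinear
average of the others. -/
lemma multilinearForm_toLp (σ : Measure (TupleSpace m d)) [SFinite σ] {ψ : TupleSpace m d → ℂ}
    (hψ : Integrable ψ σ) (f : Fin (m + 1) → 𝓢(EuclideanSpace ℝ (Fin d), ℂ)) :
    multilinearForm σ hψ (fun i => (f i).toLp (m + 1)) =
      ∫ x, f 0 x * multilinearAverage σ ψ (fun j => f j.succ) x := by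
  rw [multilinearForm_apply, integral_congr_ae
    (formIntegrand_congr ψ fun i => (f i).coeFn_toLp (m + 1) volume),
    integral_prod_symm _ (integrable_formIntegrand hψ fun i => (f i).memLp _ volume)]
  refine integral_congr_ae (ae_of_all _ fun x => ?_)
  simp only [formIntegrand, multilinearAverage, Fin.prod_univ_succ]
  rw [← integral_const_mul]
  refine integral_congr_ae (ae_of_all _ fun u => ?_)
  have h1 : tupleShift u 0 = 0 := rfl
  have h2 : ∀ j : Fin m, tupleShift u j.succ = u j := fun j => rfl
  simp only [h1, h2, sub_zero, mul_assoc]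

end Form

/-! ### The form on the Fourier side -/

section Fourier

variable {m d : ℕ}

lemma norm_exp_ofReal_mul_I' (t : ℝ) : ‖Complex.exp (-(t : ℂ) * Complex.I)‖ = 1 := by
  rw [← Complex.ofReal_neg, Complex.norm_exp_ofReal_mul_I]

/-- Fubini's theorem for an integrand that separates up to unimodular factors. -/
lemma integral_integral_mul_swap {α β γ : Type*} [MeasurableSpace α] [MeasurableSpace β]
    [MeasurableSpace γ] {σ : Measure α} {μ : Measure β} {ν : Measure γ} [SFinite σ] [SFinite μ]
    [SFinite ν] {ψ : α → ℂ} {g : β → ℂ} {G : γ → ℂ} (hψ : Integrable ψ σ) (hg : Integrable g μ)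
    (hG : Integrable G ν) {E₁ : α → γ → ℂ} {E₂ : β → γ → ℂ}
    (h₁ : Measurable (Function.uncurry E₁)) (h₂ : Measurable (Function.uncurry E₂))
    (hn₁ : ∀ u ζ, ‖E₁ u ζ‖ ≤ 1) (hn₂ : ∀ x ζ, ‖E₂ x ζ‖ ≤ 1) :
    ∫ y, ∫ ζ, E₁ y.1 ζ * ψ y.1 * (E₂ y.2 ζ * g y.2) * G ζ ∂ν ∂σ.prod μ =
      ∫ ζ, (∫ u, E₁ u ζ * ψ u ∂σ) * (∫ x, E₂ x ζ * g x ∂μ) * G ζ ∂ν := by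
  have hint : Integrable (Function.uncurry fun (y : α × β) ζ =>
      E₁ y.1 ζ * ψ y.1 * (E₂ y.2 ζ * g y.2) * G ζ) ((σ.prod μ).prod ν) := by
    have hbase : Integrable (fun z : (α × β) × γ => (ψ z.1.1 * g z.1.2) * G z.2)
        ((σ.prod μ).prod ν) := (hψ.mul_prod hg).mul_prod hG
    have hm : Measurable fun z : (α × β) × γ => E₁ z.1.1 z.2 * E₂ z.1.2 z.2 :=
      (h₁.comp ((measurable_fst.comp measurable_fst).prodMk measurable_snd)).mul
        (h₂.comp ((measurable_snd.comp measurable_fst).prodMk measurable_snd))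
    refine (hbase.bdd_mul (c := 1) hm.aestronglyMeasurable (ae_of_all _ fun z => ?_)).congr
      (ae_of_all _ fun z => ?_)
    · rw [norm_mul]
      exact mul_le_one₀ (hn₁ _ _) (norm_nonneg _) (hn₂ _ _)
    · simp only [Function.uncurry]
      ring
  rw [integral_integral_swap hint]
  refine integral_congr_ae (ae_of_all _ fun ζ => ?_)
  simp only
  rw [integral_mul_const, integral_prod_mul (fun u => E₁ u ζ * ψ u) (fun x => E₂ x ζ * g x)]

/-- The multilinear form in terms of Fourier transforms: the frequencies `ζ₁, …, ζ_m` of the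
functions add up to the frequency that is seen by the first argument. -/
lemma integral_formIntegrand_eq (σ : Measure (TupleSpace m d)) [SFinite σ]
    {ψ : TupleSpace m d → ℂ} (hψ : Integrable ψ σ)
    (f : Fin (m + 1) → 𝓢(EuclideanSpace ℝ (Fin d), ℂ)) :
    ∫ y, formIntegrand ψ (fun i => f i) y ∂σ.prod volume =
      ∫ ζ : Fin m → EuclideanSpace ℝ (Fin d),
        fourierMeasure σ ψ (WithLp.toLp 2 ζ) * (𝓕⁻ (f 0)) (∑ j, ζ j) *
          ∏ j : Fin m, (𝓕 (f j.succ)) (ζ j) := by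
  set P : (TupleSpace m d × EuclideanSpace ℝ (Fin d)) → (Fin m → EuclideanSpace ℝ (Fin d)) → ℂ :=
    fun y ζ => (Complex.exp (-(2 * Real.pi * inner ℝ y.1 (WithLp.toLp 2 ζ) : ℝ) * Complex.I)
      * ψ y.1) * (Complex.exp ((2 * Real.pi * inner ℝ y.2 (∑ j, ζ j) : ℝ) * Complex.I) * f 0 y.2)
      * ∏ j : Fin m, (𝓕 (f j.succ)) (ζ j) with hP
  have hpoint : ∀ y, formIntegrand ψ (fun i => f i) y = ∫ ζ, P y ζ := by
    intro y
    have h1 : ∀ j : Fin m, f j.succ (y.2 - y.1 j) = ∫ ξ : EuclideanSpace ℝ (Fin d),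
        Complex.exp ((2 * Real.pi * inner ℝ ξ (y.2 - y.1 j) : ℝ) * Complex.I) *
          (𝓕 (f j.succ)) ξ := by
      intro j
      have h2 : 𝓕⁻ (𝓕 (f j.succ)) = f j.succ := FourierTransform.fourierInv_fourier_eq _
      conv_lhs => rw [← h2, SchwartzMap.fourierInv_coe, Real.fourierInv_eq']
      rfl
    have h0 : formIntegrand ψ (fun i => f i) y =
        f 0 y.2 * (∏ j : Fin m, f j.succ (y.2 - y.1 j)) * ψ y.1 := by
      have h1 : tupleShift y.1 0 = 0 := rfl
      have h2 : ∀ j : Fin m, tupleShift y.1 j.succ = y.1 j := fun j => rfl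
      simp only [formIntegrand, Fin.prod_univ_succ, h1, h2, sub_zero]
    rw [h0]
    simp_rw [h1]
    rw [← integral_fintype_prod_volume_eq_prod, ← integral_const_mul, ← integral_mul_const]
    refine integral_congr_ae (ae_of_all _ fun ζ => ?_)
    simp only [hP, Finset.prod_mul_distrib, ← Complex.exp_sum]
    have h3 : ∑ j : Fin m, ((2 * Real.pi * inner ℝ (ζ j) (y.2 - y.1 j) : ℝ) : ℂ) * Complex.I =
        -(2 * Real.pi * inner ℝ y.1 (WithLp.toLp 2 ζ) : ℝ) * Complex.I +
          (2 * Real.pi * inner ℝ y.2 (∑ j, ζ j) : ℝ) * Complex.I := by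
      rw [← Finset.sum_mul, ← add_mul, PiLp.inner_apply, inner_sum]
      congr 1
      have h4 : ∀ j, inner ℝ (ζ j) (y.2 - y.1 j) = inner ℝ y.2 (ζ j) - inner ℝ (y.1 j) (ζ j) :=
        fun j => by rw [inner_sub_right, real_inner_comm, real_inner_comm (y.1 j)]
      simp_rw [h4]
      push_cast
      rw [Finset.mul_sum, Finset.mul_sum, ← Finset.sum_neg_distrib, ← Finset.sum_add_distrib]
      refine Finset.sum_congr rfl fun j _ => ?_
      ring
    rw [h3, Complex.exp_add]
    ring
  simp_rw [hpoint]
  refine (integral_integral_mul_swap hψ (f 0).integrable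
    (Integrable.fintype_prod fun j => (𝓕 (f j.succ)).integrable)
    (E₁ := fun u ζ => Complex.exp
      (-(2 * Real.pi * inner ℝ u (WithLp.toLp 2 ζ) : ℝ) * Complex.I))
    (E₂ := fun x ζ => Complex.exp ((2 * Real.pi * inner ℝ x (∑ j, ζ j) : ℝ) * Complex.I))
    ?_ ?_ (fun u ζ => (norm_exp_ofReal_mul_I' _).le)
    (fun x ζ => (Complex.norm_exp_ofReal_mul_I _).le)).trans ?_
  · refine Continuous.measurable ?_
    unfold Function.uncurry
    fun_prop
  · refine Continuous.measurable ?_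
    unfold Function.uncurry
    fun_prop
  refine integral_congr_ae (ae_of_all _ fun ζ => ?_)
  simp only
  congr 2
  rw [SchwartzMap.fourierInv_coe, Real.fourierInv_eq']
  rfl

/-! ### Integration over slices orthogonal to the diagonal -/

instance isAddHaarMeasure_subspaceVolume {E : Type*} [NormedAddCommGroup E]
    [InnerProductSpace ℝ E] [MeasurableSpace E] [BorelSpace E] [FiniteDimensional ℝ E]
    (H : Submodule ℝ E) : (subspaceVolume H).IsAddHaarMeasure := by
  unfold subspaceVolume
  infer_instance

lemma sum_eq_zero_of_mem_diagonal_orthogonal {η : TupleSpace m d}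
    (hη : η ∈ (diagonalSubspace m d)ᗮ) : ∑ i, η i = 0 := by
  rw [Submodule.mem_orthogonal] at hη
  have h1 := hη (WithLp.toLp 2 fun _ => ∑ i, η i) (fun i j => rfl)
  rw [PiLp.inner_apply, ← inner_sum] at h1
  exact inner_self_eq_zero.1 h1

/-- The diagonal is parametrised by the sum of the components. -/
def diagonalSum (hm : m ≠ 0) : diagonalSubspace m d ≃ₗ[ℝ] EuclideanSpace ℝ (Fin d) :=
  LinearEquiv.ofBijective
    { toFun := fun ξ : diagonalSubspace m d => ∑ i, (ξ : TupleSpace m d) i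
      map_add' := fun ξ ξ' => by simp [Finset.sum_add_distrib]
      map_smul' := fun c ξ => by simp [Finset.smul_sum] }
    (by
      have hm' : (m : ℝ) ≠ 0 := by exact_mod_cast hm
      constructor
      · rw [← LinearMap.ker_eq_bot, LinearMap.ker_eq_bot']
        intro ξ hξ
        have hξ' : ∑ i, (ξ : TupleSpace m d) i = 0 := hξ
        refine Subtype.ext (PiLp.ext fun j => ?_)
        have h1 : ∀ i, (ξ : TupleSpace m d) i = (ξ : TupleSpace m d) j := fun i => ξ.2 i j
        simp_rw [h1] at hξ'
        rw [Finset.sum_const, Finset.card_univ, Fintype.card_fin, ← Nat.cast_smul_eq_nsmul ℝ,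
          smul_eq_zero] at hξ'
        exact hξ'.resolve_left hm'
      · intro v
        refine ⟨⟨WithLp.toLp 2 fun _ => (m : ℝ)⁻¹ • v, fun i j => rfl⟩, ?_⟩
        change ∑ _i : Fin m, (m : ℝ)⁻¹ • v = v
        rw [Finset.sum_const, Finset.card_univ, Fintype.card_fin, ← Nat.cast_smul_eq_nsmul ℝ,
          smul_inv_smul₀ hm'])

/-- Integration over a Euclidean space in terms of a subspace and its orthogonal complement. -/
lemma exists_lintegral_orthogonal_eq {E : Type*} [NormedAddCommGroup E] [InnerProductSpace ℝ E]
    [FiniteDimensional ℝ E] [MeasurableSpace E] [BorelSpace E] (H : Submodule ℝ E) :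
    ∃ c : ℝ≥0∞, c ≠ 0 ∧ c ≠ ⊤ ∧ ∀ f : E → ℝ≥0∞,
      ∫⁻ z : H × Hᗮ, f ((z.1 : E) + (z.2 : E)) ∂(subspaceVolume H).prod (subspaceVolume Hᗮ) =
        c * ∫⁻ x, f x :=
  exists_lintegral_comp_eq (Submodule.prodEquivOfIsCompl H Hᗮ (Submodule.isCompl_orthogonal H))
    ((subspaceVolume H).prod (subspaceVolume Hᗮ)) (volume : Measure E)

/-- Cauchy–Schwarz on the slices orthogonal to the diagonal. If `K j` has `L²` norm at most
`a j (s)` on almost every slice, `s` being the sum of the components, then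
`∑ j, K j` acts on tensor products as if it were bounded in `L²` along slices by `∑ j, a j`. -/
lemma exists_slice_bound (hm : m ≠ 0) : ∃ C : ℝ≥0∞, C ≠ ⊤ ∧ ∀ {ι : Type} [Countable ι]
    (K : ι → TupleSpace m d → ℝ≥0∞) (a : ι → EuclideanSpace ℝ (Fin d) → ℝ≥0∞)
    (k : Fin m → EuclideanSpace ℝ (Fin d) → ℝ≥0∞) (h : EuclideanSpace ℝ (Fin d) → ℝ≥0∞),
    (∀ j, Measurable (K j)) → (∀ j, Measurable (a j)) → (∀ i, Measurable (k i)) → Measurable h →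
    (∀ j, ∀ᵐ ξ : diagonalSubspace m d ∂subspaceVolume (diagonalSubspace m d),
      (∫⁻ η : (diagonalSubspace m d)ᗮ, K j ((ξ : TupleSpace m d) + (η : TupleSpace m d)) ^ (2 : ℝ)
        ∂subspaceVolume (diagonalSubspace m d)ᗮ) ^ (1 / 2 : ℝ) ≤
          a j (∑ i, (ξ : TupleSpace m d) i)) →
    ∫⁻ ζ : Fin m → EuclideanSpace ℝ (Fin d),
        (∑' j, K j (WithLp.toLp 2 ζ)) * h (∑ i, ζ i) * ∏ i, k i (ζ i) ≤
      C * (∫⁻ s, ((∑' j, a j s) * h s) ^ (2 : ℝ)) ^ (1 / 2 : ℝ) *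
        ∏ i, (∫⁻ v, k i v ^ (2 : ℝ)) ^ (1 / 2 : ℝ) := by
  set H := diagonalSubspace m d with hH
  obtain ⟨c₀, hc₀0, hc₀t, hc₀⟩ := exists_lintegral_orthogonal_eq H
  obtain ⟨c₀', hc₀'0, hc₀'t, hc₀'⟩ := exists_lintegral_comp_eq
    (WithLp.linearEquiv 2 ℝ (Fin m → EuclideanSpace ℝ (Fin d)))
    (volume : Measure (TupleSpace m d)) (volume : Measure (Fin m → EuclideanSpace ℝ (Fin d)))
  obtain ⟨c₁, hc₁0, hc₁t, hc₁⟩ : ∃ c : ℝ≥0∞, c ≠ 0 ∧ c ≠ ⊤ ∧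
      ∀ f : (Fin m → EuclideanSpace ℝ (Fin d)) → ℝ≥0∞,
      ∫⁻ z : H × Hᗮ, f ((z.1 : TupleSpace m d) + (z.2 : TupleSpace m d)).ofLp
        ∂(subspaceVolume H).prod (subspaceVolume Hᗮ) = c * ∫⁻ ζ, f ζ := by
    refine ⟨c₀ * c₀', mul_ne_zero hc₀0 hc₀'0, ENNReal.mul_ne_top hc₀t hc₀'t, fun f => ?_⟩
    rw [mul_assoc]
    exact (hc₀ fun u => f u.ofLp).trans (congrArg _ (hc₀' f))
  obtain ⟨c₂, hc₂0, hc₂t, hc₂⟩ := exists_lintegral_comp_eq (diagonalSum (d := d) hm)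
    (subspaceVolume H) (volume : Measure (EuclideanSpace ℝ (Fin d)))
  have h2 : (2 : ℝ).HolderConjugate 2 := Real.HolderConjugate.two_two
  refine ⟨c₁⁻¹ * (c₂ ^ (1 / 2 : ℝ) * c₁ ^ (1 / 2 : ℝ)), ?_, ?_⟩
  · exact ENNReal.mul_ne_top (ENNReal.inv_ne_top.2 hc₁0) (ENNReal.mul_ne_top
      (ENNReal.rpow_ne_top_of_nonneg (by norm_num) hc₂t)
      (ENNReal.rpow_ne_top_of_nonneg (by norm_num) hc₁t))
  intro ι _ K a k h hK ha hk hh hslice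
  set A : EuclideanSpace ℝ (Fin d) → ℝ≥0∞ := fun s => ∑' j, a j s with hA
  have hAm : Measurable A := Measurable.tsum ha
  -- the tensor product on `H × Hᗮ`
  set T : H × Hᗮ → ℝ≥0∞ :=
    fun z => ∏ i, k i (((z.1 : TupleSpace m d) + (z.2 : TupleSpace m d)) i) with hT
  have haddm : Measurable fun z : H × Hᗮ => (z.1 : TupleSpace m d) + (z.2 : TupleSpace m d) :=
    (measurable_subtype_coe.comp measurable_fst).add (measurable_subtype_coe.comp measurable_snd)
  have hcoord : ∀ i : Fin m, Measurable fun u : TupleSpace m d => u i := fun i => by fun_prop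
  have hTm : Measurable T := Finset.measurable_prod _ fun i _ => (hk i).comp
    ((hcoord i).comp haddm)
  set Φ : H → ℝ≥0∞ := fun ξ =>
    (∫⁻ η, T (ξ, η) ^ (2 : ℝ) ∂subspaceVolume Hᗮ) ^ (1 / 2 : ℝ) with hΦ
  have hΦm : Measurable Φ := ((hTm.pow_const _).lintegral_prod_right').pow_const _
  have hsumm : Measurable fun ξ : H => ∑ i, (ξ : TupleSpace m d) i :=
    Finset.measurable_sum _ fun i _ => (hcoord i).comp measurable_subtype_coe
  have hsum : ∀ z : H × Hᗮ, ∑ i, ((z.1 : TupleSpace m d) + (z.2 : TupleSpace m d)) i =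
      ∑ i, (z.1 : TupleSpace m d) i := by
    intro z
    simp only [PiLp.add_apply, Finset.sum_add_distrib]
    rw [sum_eq_zero_of_mem_diagonal_orthogonal z.2.2, add_zero]
  -- Cauchy–Schwarz on a single slice
  have hCS : ∀ᵐ ξ : H ∂subspaceVolume H, ∫⁻ η : Hᗮ,
      (∑' j, K j ((ξ : TupleSpace m d) + (η : TupleSpace m d))) *
        h (∑ i, (ξ : TupleSpace m d) i) * T (ξ, η) ∂subspaceVolume Hᗮ ≤
      (A (∑ i, (ξ : TupleSpace m d) i) * h (∑ i, (ξ : TupleSpace m d) i)) * Φ ξ := by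
    filter_upwards [ae_all_iff.2 hslice] with ξ hξ
    have hKm : ∀ j, Measurable fun η : Hᗮ => K j ((ξ : TupleSpace m d) + (η : TupleSpace m d)) :=
      fun j => (hK j).comp (haddm.comp measurable_prodMk_left)
    have hTm' : Measurable fun η : Hᗮ => T (ξ, η) := hTm.comp measurable_prodMk_left
    have h3 : ∀ η : Hᗮ, (∑' j, K j ((ξ : TupleSpace m d) + (η : TupleSpace m d))) *
        h (∑ i, (ξ : TupleSpace m d) i) * T (ξ, η) = h (∑ i, (ξ : TupleSpace m d) i) *
        ∑' j, K j ((ξ : TupleSpace m d) + (η : TupleSpace m d)) * T (ξ, η) := by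
      intro η
      rw [ENNReal.tsum_mul_right]; ring
    simp_rw [h3]
    have hprodm : ∀ j, Measurable fun η : Hᗮ =>
        K j ((ξ : TupleSpace m d) + (η : TupleSpace m d)) * T (ξ, η) := fun j => (hKm j).mul hTm'
    rw [lintegral_const_mul _ (Measurable.tsum hprodm),
      lintegral_tsum fun j => (hprodm j).aemeasurable]
    calc _ ≤ h (∑ i, (ξ : TupleSpace m d) i) *
          ∑' j, a j (∑ i, (ξ : TupleSpace m d) i) * Φ ξ := by
          gcongr with j
          refine (ENNReal.lintegral_mul_le_Lp_mul_Lq _ h2 (hKm j).aemeasurable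
            hTm'.aemeasurable).trans ?_
          exact mul_le_mul_left (hξ j) _
      _ = _ := by rw [ENNReal.tsum_mul_right]; ring
  -- norms of the two factors over the diagonal
  have hΦ2 : ∫⁻ ξ, Φ ξ ^ (2 : ℝ) ∂subspaceVolume H = c₁ * ∏ i, ∫⁻ v, k i v ^ (2 : ℝ) := by
    have h4 : ∀ ξ, Φ ξ ^ (2 : ℝ) = ∫⁻ η, T (ξ, η) ^ (2 : ℝ) ∂subspaceVolume Hᗮ := by
      intro ξ
      rw [hΦ, ← ENNReal.rpow_mul]
      norm_num
    simp_rw [h4]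
    rw [← lintegral_prod (fun z => T z ^ (2 : ℝ)) (hTm.pow_const _).aemeasurable]
    have h5 := hc₁ fun ζ => (∏ i, k i (ζ i)) ^ (2 : ℝ)
    refine h5.trans ?_
    congr 1
    rw [← lintegral_fin_prod_eq_prod volume fun i => (hk i).pow_const _]
    refine lintegral_congr fun ζ => ?_
    exact (ENNReal.prod_rpow_of_nonneg (by norm_num)).symm
  have hA2 : ∫⁻ ξ : H, (A (∑ i, (ξ : TupleSpace m d) i) * h (∑ i, (ξ : TupleSpace m d) i)) ^ (2 : ℝ)
      ∂subspaceVolume H = c₂ * ∫⁻ s, (A s * h s) ^ (2 : ℝ) :=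
    hc₂ fun s => (A s * h s) ^ (2 : ℝ)
  have hG := hc₁ fun ζ => (∑' j, K j (WithLp.toLp 2 ζ)) * h (∑ i, ζ i) * ∏ i, k i (ζ i)
  have hmain : ∫⁻ z : H × Hᗮ, (∑' j, K j ((z.1 : TupleSpace m d) + (z.2 : TupleSpace m d))) *
      h (∑ i, ((z.1 : TupleSpace m d) + (z.2 : TupleSpace m d)) i) *
        ∏ i, k i (((z.1 : TupleSpace m d) + (z.2 : TupleSpace m d)) i)
      ∂(subspaceVolume H).prod (subspaceVolume Hᗮ) ≤
      (c₂ * ∫⁻ s, (A s * h s) ^ (2 : ℝ)) ^ (1 / 2 : ℝ) *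
        (c₁ * ∏ i, ∫⁻ v, k i v ^ (2 : ℝ)) ^ (1 / 2 : ℝ) := by
    simp_rw [hsum]
    have hm1 : Measurable fun z : H × Hᗮ =>
        (∑' j, K j ((z.1 : TupleSpace m d) + (z.2 : TupleSpace m d))) *
        h (∑ i, (z.1 : TupleSpace m d) i) *
          ∏ i, k i (((z.1 : TupleSpace m d) + (z.2 : TupleSpace m d)) i) :=
      ((Measurable.tsum fun j => (hK j).comp haddm).mul
        (hh.comp (hsumm.comp measurable_fst))).mul hTm
    rw [lintegral_prod _ hm1.aemeasurable]
    refine (lintegral_mono_ae hCS).trans ?_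
    refine (ENNReal.lintegral_mul_le_Lp_mul_Lq _ h2
      ((hAm.comp hsumm).mul (hh.comp hsumm)).aemeasurable hΦm.aemeasurable).trans ?_
    rw [hΦ2]
    gcongr
    exact hA2.le
  replace hmain := hG.symm.trans_le hmain
  have h6 : ∀ x : ℝ≥0∞, c₁⁻¹ * (c₁ * x) = x := fun x => by
    rw [← mul_assoc, ENNReal.inv_mul_cancel hc₁0 hc₁t, one_mul]
  calc _ = c₁⁻¹ * (c₁ * ∫⁻ ζ : Fin m → EuclideanSpace ℝ (Fin d),
        (∑' j, K j (WithLp.toLp 2 ζ)) * h (∑ i, ζ i) * ∏ i, k i (ζ i)) := (h6 _).symm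
    _ ≤ c₁⁻¹ * ((c₂ * ∫⁻ s, (A s * h s) ^ (2 : ℝ)) ^ (1 / 2 : ℝ) *
        (c₁ * ∏ i, ∫⁻ v, k i v ^ (2 : ℝ)) ^ (1 / 2 : ℝ)) := by gcongr
    _ = _ := by
        rw [ENNReal.mul_rpow_of_nonneg _ _ (by norm_num),
          ENNReal.mul_rpow_of_nonneg _ _ (by norm_num), ENNReal.prod_rpow_of_nonneg (by norm_num)]
        ring

end Fourier

/-! ### Regularity of the surface measure -/

section Geometry

lemma euclideanHausdorffMeasure_image_le {E : Type*} [MetricSpace E] [MeasurableSpace E]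
    [BorelSpace E] {k : ℕ} {K : ℝ≥0} {f : E → E} {s : Set E}
    (h : LipschitzOnWith K f s) :
    (Measure.euclideanHausdorffMeasure k : Measure E) (f '' s) ≤
      (K : ℝ≥0∞) ^ k * (Measure.euclideanHausdorffMeasure k : Measure E) s := by
  rw [Measure.euclideanHausdorffMeasure_def, Measure.smul_apply, Measure.smul_apply,
    ENNReal.smul_def, ENNReal.smul_def, smul_eq_mul, smul_eq_mul, mul_left_comm]
  gcongr
  simpa using h.hausdorffMeasure_image_le (d := k) (Nat.cast_nonneg k)

variable {E : Type*} [NormedAddCommGroup E] [InnerProductSpace ℝ E] [MeasurableSpace E]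
  [BorelSpace E]

lemma euclideanHausdorffMeasure_subspace_closedBall_le {k : ℕ} [FiniteDimensional ℝ E]
    {V : Submodule ℝ E} (hV : Module.finrank ℝ V = k) (v : V) {r : ℝ} (hr : 0 ≤ r) :
    (Measure.euclideanHausdorffMeasure k : Measure E) (V.subtype '' Metric.closedBall v r) ≤
      ENNReal.ofReal (r ^ k) * volume (Metric.closedBall (0 : V) 1) := by
  have h1 : Isometry (V.subtype : V → E) := V.subtypeₗᵢ.isometry
  rw [h1.euclideanHausdorffMeasure_image, ← hV, InnerProductSpace.euclideanHausdorffMeasure_eq_volume,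
    Measure.addHaar_closedBall' _ _ hr]

/-- Near each of its points, a submanifold is bi-Lipschitz to a piece of a linear subspace, hence
has at most the volume of a `k`-dimensional ball of radius comparable to `r` in each ball of
radius `r`. -/
lemma IsSmoothSubmanifold.exists_nhds_measure_le [FiniteDimensional ℝ E] {k : ℕ} {M : Set E}
    (hM : IsSmoothSubmanifold k M) {x : E} (hx : x ∈ M) :
    ∃ U ∈ 𝓝 x, ∃ C : ℝ, ∀ y r, 0 < r →
      (Measure.euclideanHausdorffMeasure k : Measure E) (Metric.closedBall y r ∩ (U ∩ M)) ≤
        ENNReal.ofReal (C * r ^ k) := by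
  obtain ⟨e, V, hxe, he, hes, hV, hVM⟩ := hM x hx
  obtain ⟨K₁, t₁, ht₁, hK₁⟩ := ((he.contDiffAt (e.open_source.mem_nhds hxe)).of_le
    (m := 1) (by exact_mod_cast le_top)).exists_lipschitzOnWith
  obtain ⟨K₂, t₂, ht₂, hK₂⟩ := ((hes.contDiffAt (e.open_target.mem_nhds (e.map_source hxe))).of_le
    (m := 1) (by exact_mod_cast le_top)).exists_lipschitzOnWith
  refine ⟨t₁ ∩ (e.source ∩ e ⁻¹' t₂), inter_mem ht₁ (inter_mem (e.open_source.mem_nhds hxe)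
    ((e.continuousAt hxe).preimage_mem_nhds ht₂)),
    K₂ ^ k * (2 * K₁) ^ k * (volume (Metric.closedBall (0 : V) 1)).toReal, fun y r hr => ?_⟩
  set A := Metric.closedBall y r ∩ (t₁ ∩ (e.source ∩ e ⁻¹' t₂) ∩ M) with hA
  rcases A.eq_empty_or_nonempty with hAe | ⟨a, ha⟩
  · rw [hAe, measure_empty]; exact zero_le
  have hAV : ∀ b ∈ A, e b ∈ (V : Set E) := fun b hb =>
    (hVM.subset ⟨b, ⟨hb.2.1.2.1, hb.2.2⟩, rfl⟩).2
  have hsub : A ⊆ e.symm '' (e '' A) := fun b hb =>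
    ⟨e b, ⟨b, hb, rfl⟩, e.left_inv hb.2.1.2.1⟩
  have hsub2 : e '' A ⊆ V.subtype '' Metric.closedBall ⟨e a, hAV a ha⟩ (2 * K₁ * r) := by
    rintro _ ⟨b, hb, rfl⟩
    refine ⟨⟨e b, hAV b hb⟩, ?_, rfl⟩
    rw [Metric.mem_closedBall, Subtype.dist_eq]
    refine (hK₁.dist_le_mul b hb.2.1.1 a ha.2.1.1).trans ?_
    have h1 : dist b a ≤ 2 * r := by
      have := dist_triangle_right b a y
      have h2 := Metric.mem_closedBall.1 hb.1
      have h3 := Metric.mem_closedBall.1 ha.1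
      linarith
    nlinarith [K₁.2, h1]
  have hLip : LipschitzOnWith K₂ e.symm (e '' A) := hK₂.mono (by
    rintro _ ⟨b, hb, rfl⟩
    exact hb.2.1.2.2)
  have hfin : volume (Metric.closedBall (0 : V) 1) ≠ ⊤ :=
    (isCompact_closedBall (0 : V) 1).measure_ne_top
  calc _ ≤ (Measure.euclideanHausdorffMeasure k : Measure E) (e.symm '' (e '' A)) :=
        measure_mono hsub
    _ ≤ (K₂ : ℝ≥0∞) ^ k * (Measure.euclideanHausdorffMeasure k : Measure E) (e '' A) :=
        euclideanHausdorffMeasure_image_le hLip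
    _ ≤ (K₂ : ℝ≥0∞) ^ k * (ENNReal.ofReal ((2 * K₁ * r) ^ k) *
          volume (Metric.closedBall (0 : V) 1)) := by
        gcongr
        exact (measure_mono hsub2).trans
          (euclideanHausdorffMeasure_subspace_closedBall_le hV _ (by positivity))
    _ = _ := by
        conv_lhs => rw [← ENNReal.ofReal_toReal hfin, ← ENNReal.ofReal_coe_nnreal,
          ← ENNReal.ofReal_pow (by positivity), ← ENNReal.ofReal_mul (by positivity),
          ← ENNReal.ofReal_mul (by positivity)]
        congr 1
        rw [mul_pow (2 * (K₁ : ℝ)) r]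
        ring

/-- The surface measure of a compact `k`-dimensional submanifold satisfies the Frostman condition
of exponent `k`. -/
lemma IsSmoothSubmanifold.exists_surfaceMeasure_closedBall_le [FiniteDimensional ℝ E] {k : ℕ}
    {M : Set E} (hM : IsSmoothSubmanifold k M) (hMc : IsCompact M) :
    ∃ C : ℝ, 0 ≤ C ∧ ∀ y r, 0 < r →
      surfaceMeasure k M (Metric.closedBall y r) ≤ ENNReal.ofReal (C * r ^ k) := by
  have key : ∃ C : ℝ, ∀ y r, 0 < r →
      (Measure.euclideanHausdorffMeasure k : Measure E) (Metric.closedBall y r ∩ (M ∩ M)) ≤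
        ENNReal.ofReal (C * r ^ k) := by
    refine hMc.induction_on (p := fun U => ∃ C : ℝ, ∀ y r, 0 < r →
      (Measure.euclideanHausdorffMeasure k : Measure E) (Metric.closedBall y r ∩ (U ∩ M)) ≤
        ENNReal.ofReal (C * r ^ k)) ⟨0, by simp⟩ ?_ ?_ ?_
    · rintro s t hst ⟨C, hC⟩
      exact ⟨C, fun y r hr => (measure_mono (by gcongr)).trans (hC y r hr)⟩
    · rintro s t ⟨C, hC⟩ ⟨C', hC'⟩
      refine ⟨max C 0 + max C' 0, fun y r hr => ?_⟩
      rw [union_inter_distrib_right, inter_union_distrib_left]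
      refine (measure_union_le _ _).trans ?_
      rw [add_mul, ENNReal.ofReal_add (by positivity) (by positivity)]
      refine add_le_add ((hC y r hr).trans ?_) ((hC' y r hr).trans ?_) <;>
      · gcongr
        exact le_max_left _ _
    · intro x hx
      obtain ⟨U, hU, hC⟩ := hM.exists_nhds_measure_le hx
      exact ⟨U, mem_nhdsWithin_of_mem_nhds hU, hC⟩
  obtain ⟨C, hC⟩ := key
  refine ⟨max C 0, le_max_right _ _, fun y r hr => ?_⟩
  rw [surfaceMeasure, Measure.restrict_apply Metric.isClosed_closedBall.measurableSet]
  rw [inter_self] at hC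
  refine (hC y r hr).trans ?_
  gcongr
  exact le_max_left _ _

lemma IsSmoothSubmanifold.isFiniteMeasure_surfaceMeasure [FiniteDimensional ℝ E] {k : ℕ}
    {M : Set E} (hM : IsSmoothSubmanifold k M) (hMc : IsCompact M) :
    IsFiniteMeasure (surfaceMeasure k M) := by
  obtain ⟨C, -, hC⟩ := hM.exists_surfaceMeasure_closedBall_le hMc
  obtain ⟨R, hR⟩ := hMc.isBounded.subset_closedBall (0 : E)
  have hsub : M ⊆ Metric.closedBall (0 : E) (max R 1) :=
    hR.trans (Metric.closedBall_subset_closedBall (le_max_left _ _))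
  constructor
  have h1 := hC 0 (max R 1) (by positivity)
  rw [surfaceMeasure, Measure.restrict_apply Metric.isClosed_closedBall.measurableSet,
    inter_eq_right.2 hsub] at h1
  rw [surfaceMeasure, Measure.restrict_apply_univ]
  exact h1.trans_lt ENNReal.ofReal_lt_top

lemma integrable_surfaceMeasure_of_continuous [FiniteDimensional ℝ E] {k : ℕ}
    {M : Set E} (hM : IsSmoothSubmanifold k M) (hMc : IsCompact M) {ψ : E → ℂ}
    (hψ : Continuous ψ) : Integrable ψ (surfaceMeasure k M) := by
  have := hM.isFiniteMeasure_surfaceMeasure hMc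
  have h1 : IntegrableOn ψ M (surfaceMeasure k M) := hψ.continuousOn.integrableOn_compact hMc
  rwa [IntegrableOn, surfaceMeasure, Measure.restrict_restrict hMc.measurableSet, inter_self] at h1

lemma exists_ae_norm_le_surfaceMeasure {k : ℕ} {M : Set E} (hMc : IsCompact M) {ψ : E → ℂ}
    (hψ : Continuous ψ) : ∃ S : ℝ, 0 ≤ S ∧ ∀ᵐ u ∂surfaceMeasure k M, ‖ψ u‖ ≤ S := by
  obtain ⟨S, hS⟩ := hMc.exists_bound_of_continuousOn hψ.continuousOn
  refine ⟨max S 0, le_max_right _ _, ?_⟩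
  filter_upwards [ae_restrict_mem hMc.measurableSet] with u hu
  exact (hS u hu).trans (le_max_left _ _)

end Geometry

/-! ### Fourier transforms of measures and their frequency pieces -/

section Measures

variable {E : Type*} [NormedAddCommGroup E] [InnerProductSpace ℝ E] [MeasurableSpace E]
  [BorelSpace E] {σ : Measure E} {ψ : E → ℂ}

omit [BorelSpace E] in
lemma norm_fourierMeasure_le (ζ : E) : ‖fourierMeasure σ ψ ζ‖ ≤ ∫ u, ‖ψ u‖ ∂σ := by
  refine (norm_integral_le_integral_norm _).trans_eq (integral_congr_ae (ae_of_all _ fun u => ?_))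
  simp only [norm_mul, norm_exp_ofReal_mul_I', one_mul]

lemma continuous_fourierMeasure [FiniteDimensional ℝ E] (hψ : Integrable ψ σ) :
    Continuous (fourierMeasure σ ψ) := by
  refine continuous_of_dominated (bound := fun u => ‖ψ u‖) (fun ζ => ?_) (fun ζ => ?_) hψ.norm ?_
  · exact (Continuous.aestronglyMeasurable (by fun_prop)).mul hψ.aestronglyMeasurable
  · exact ae_of_all _ fun u => by rw [norm_mul, norm_exp_ofReal_mul_I', one_mul]
  · exact ae_of_all _ fun u => by fun_prop

variable [FiniteDimensional ℝ E]

lemma fourierMeasure_volume (f : E → ℂ) : fourierMeasure volume f = 𝓕 f := by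
  ext ζ
  rw [Real.fourier_eq']
  refine integral_congr_ae (ae_of_all _ fun u => ?_)
  simp only [smul_eq_mul]
  push_cast
  ring_nf

/-- Multiplying the Fourier transform of a measure by `χ` convolves the measure with the inverse
Fourier transform of `χ`. -/
lemma fourierInv_mul_fourierMeasure [SFinite σ] {χ : E → ℂ} (hχ : Integrable χ)
    (hψ : Integrable ψ σ) (x : E) :
    𝓕⁻ (fun ζ => χ ζ * fourierMeasure σ ψ ζ) x = ∫ u, 𝓕⁻ χ (x - u) * ψ u ∂σ := by
  have hint : Integrable (Function.uncurry fun ζ u =>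
      Complex.exp ((2 * Real.pi * inner ℝ ζ (x - u) : ℝ) * Complex.I) * (χ ζ * ψ u))
      ((volume : Measure E).prod σ) := by
    refine (hχ.mul_prod hψ).bdd_mul (c := 1) (Continuous.aestronglyMeasurable (by fun_prop)) ?_
    exact ae_of_all _ fun z => (Complex.norm_exp_ofReal_mul_I _).le
  rw [Real.fourierInv_eq']
  have h1 : ∀ ζ, Complex.exp ((2 * Real.pi * inner ℝ ζ x : ℝ) * Complex.I) •
      (χ ζ * fourierMeasure σ ψ ζ) = ∫ u,
        Complex.exp ((2 * Real.pi * inner ℝ ζ (x - u) : ℝ) * Complex.I) * (χ ζ * ψ u) ∂σ := by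
    intro ζ
    rw [fourierMeasure, smul_eq_mul, ← mul_assoc, ← integral_const_mul]
    refine integral_congr_ae (ae_of_all _ fun u => ?_)
    have h2 : ((2 * Real.pi * inner ℝ ζ (x - u) : ℝ) : ℂ) * Complex.I =
        (2 * Real.pi * inner ℝ ζ x : ℝ) * Complex.I +
          -(2 * Real.pi * inner ℝ u ζ : ℝ) * Complex.I := by
      rw [inner_sub_right, real_inner_comm ζ u]
      push_cast
      ring
    simp only
    rw [h2, Complex.exp_add]
    ring
  simp_rw [h1]
  rw [integral_integral_swap hint]
  refine integral_congr_ae (ae_of_all _ fun u => ?_)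
  simp only
  rw [Real.fourierInv_eq', ← integral_mul_const]
  refine integral_congr_ae (ae_of_all _ fun ζ => ?_)
  simp only [smul_eq_mul]
  ring

/-- A convolution of an integrable function with a complex measure is integrable. -/
lemma integrable_integral_sub_mul [SFinite σ] {G : E → ℂ} (hG : Integrable G)
    (hψ : Integrable ψ σ) : Integrable fun x => ∫ u, G (x - u) * ψ u ∂σ := by
  have hmp : MeasurePreserving (fun z : E × E => (z.1 - z.2, z.2)) ((volume : Measure E).prod σ)
      ((volume : Measure E).prod σ) := by
    have h := MeasurePreserving.skew_product (μa := σ) (μb := σ) (μc := (volume : Measure E))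
      (μd := (volume : Measure E)) (f := id) (MeasurePreserving.id σ)
      (g := fun u x => x - u) (by fun_prop)
      (ae_of_all _ fun u => (measurePreserving_sub_right volume u).map_eq)
    exact (Measure.measurePreserving_swap.comp (h.comp Measure.measurePreserving_swap))
  have h2 : Integrable (fun z : E × E => G (z.1 - z.2) * ψ z.2) ((volume : Measure E).prod σ) :=
    hmp.integrable_comp_of_integrable (hG.mul_prod hψ)
  exact h2.integral_prod_left

lemma fourierInv_comp_inv_smul (χ : E → ℂ) {R : ℝ} (hR : 0 < R) (y : E) :
    𝓕⁻ (fun ζ => χ (R⁻¹ • ζ)) y = (R : ℂ) ^ Module.finrank ℝ E * 𝓕⁻ χ (R • y) := by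
  rw [Real.fourierInv_eq', Real.fourierInv_eq']
  have h1 := Measure.integral_comp_inv_smul (volume : Measure E)
    (fun ζ => Complex.exp ((2 * Real.pi * inner ℝ ζ (R • y) : ℝ) * Complex.I) • χ ζ) R
  rw [abs_of_pos (pow_pos hR _)] at h1
  have h2 : ∀ ζ : E, inner ℝ (R⁻¹ • ζ) (R • y) = inner ℝ ζ y := by
    intro ζ
    rw [real_inner_smul_left, real_inner_smul_right, inv_mul_cancel_left₀ hR.ne']
  simp_rw [h2] at h1
  rw [h1, Complex.real_smul]
  push_cast
  rfl

omit [FiniteDimensional ℝ E] in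
/-- A rapidly decreasing kernel at scale `R⁻¹` integrates to `O(R⁻ᵏ)` against a measure that
satisfies the Frostman condition of exponent `k`. -/
lemma exists_lintegral_schwartz_scaled_le {k : ℕ} {C : ℝ} (hC0 : 0 ≤ C)
    (hC : ∀ y r, 0 < r → σ (Metric.closedBall y r) ≤ ENNReal.ofReal (C * r ^ k)) (χ : 𝓢(E, ℂ)) :
    ∃ C' : ℝ, 0 ≤ C' ∧ ∀ R x, 0 < R →
      ∫⁻ u, ‖χ (R • (x - u))‖ₑ ∂σ ≤ ENNReal.ofReal (C' * (R ^ k)⁻¹) := by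
  obtain ⟨A, hA0, hA⟩ : ∃ A : ℝ, 0 ≤ A ∧ ∀ y, ‖χ y‖ ≤ A * ((1 + ‖y‖) ^ (k + 1))⁻¹ := by
    refine ⟨2 ^ (k + 1) * ((Finset.Iic (k + 1, 0)).sup
      (fun m => SchwartzMap.seminorm ℝ m.1 m.2)) χ, by positivity, fun y => ?_⟩
    have h1 := SchwartzMap.one_add_le_sup_seminorm_apply (𝕜 := ℝ) (m := (k + 1, 0)) (k := k + 1)
      (n := 0) le_rfl le_rfl χ y
    rw [norm_iteratedFDeriv_zero] at h1
    rw [← div_eq_mul_inv, le_div_iff₀ (by positivity)]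
    linarith
  -- each shell `2^{i-1} < R|x - u| ≤ 2^i` is covered by the `i`-th term of a sum over balls
  have hpt : ∀ R x u, 0 < R → ‖χ (R • (x - u))‖ₑ ≤
      ∑' i : ℕ, ENNReal.ofReal (A * 2 ^ (k + 1) * ((2 : ℝ) ^ i)⁻¹ ^ (k + 1)) *
        (Metric.closedBall x (2 ^ i / R)).indicator 1 u := by
    intro R x u hR
    set t := ‖R • (x - u)‖ with ht
    have hex : ∃ i : ℕ, t ≤ 2 ^ i := (pow_unbounded_of_one_lt t one_lt_two).imp fun i hi => hi.le
    set i := Nat.find hex with hi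
    have hti : t ≤ 2 ^ i := Nat.find_spec hex
    have hmem : u ∈ Metric.closedBall x (2 ^ i / R) := by
      rw [Metric.mem_closedBall', dist_eq_norm, le_div_iff₀ hR]
      rw [ht, norm_smul, Real.norm_of_nonneg hR.le] at hti
      linarith
    refine le_trans ?_ (ENNReal.le_tsum i)
    rw [indicator_of_mem hmem, Pi.one_apply, mul_one, ← ofReal_norm]
    refine ENNReal.ofReal_le_ofReal ((hA _).trans ?_)
    rw [← ht, mul_assoc, ← mul_pow, ← inv_pow]
    gcongr
    rcases Nat.eq_zero_or_pos i with h0 | h0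
    · rw [h0, pow_zero, inv_one, mul_one]
      have h3 : (1 + t)⁻¹ ≤ 1 := inv_le_one_of_one_le₀ (by linarith [norm_nonneg (R • (x - u))])
      linarith
    · have h4 : 2 ^ (i - 1) < t := not_le.1 (Nat.find_min hex (Nat.sub_lt h0 one_pos))
      have h5 : (2 : ℝ) ^ i = 2 * 2 ^ (i - 1) := by
        rw [← pow_succ', Nat.sub_add_cancel h0]
      rw [h5, mul_inv, ← mul_assoc, mul_inv_cancel₀ two_ne_zero, one_mul]
      gcongr
      linarith
  refine ⟨A * 2 ^ (k + 1) * C * 2, by positivity, fun R x hR => ?_⟩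
  calc _ ≤ ∫⁻ u, ∑' i : ℕ, ENNReal.ofReal (A * 2 ^ (k + 1) * ((2 : ℝ) ^ i)⁻¹ ^ (k + 1)) *
        (Metric.closedBall x (2 ^ i / R)).indicator 1 u ∂σ := lintegral_mono fun u => hpt R x u hR
    _ = ∑' i : ℕ, ENNReal.ofReal (A * 2 ^ (k + 1) * ((2 : ℝ) ^ i)⁻¹ ^ (k + 1)) *
        σ (Metric.closedBall x (2 ^ i / R)) := by
        rw [lintegral_tsum fun i => ((measurable_one.indicator
          Metric.isClosed_closedBall.measurableSet).const_mul _).aemeasurable]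
        congr 1 with i
        rw [lintegral_const_mul _ (measurable_one.indicator
          Metric.isClosed_closedBall.measurableSet),
          lintegral_indicator_one Metric.isClosed_closedBall.measurableSet]
    _ ≤ ∑' i : ℕ, ENNReal.ofReal (A * 2 ^ (k + 1) * C * (R ^ k)⁻¹ * (2⁻¹ : ℝ) ^ i) := by
        gcongr with i
        refine (mul_le_mul_right (hC x _ (by positivity)) _).trans_eq ?_
        rw [← ENNReal.ofReal_mul (by positivity)]
        congr 1
        rw [div_pow, pow_succ ((2 : ℝ) ^ i)⁻¹ k, inv_pow ((2 : ℝ) ^ i) k, inv_pow (2 : ℝ) i]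
        have : ((2 : ℝ) ^ i)^ k ≠ 0 := by positivity
        field_simp
    _ = _ := by
        rw [← ENNReal.ofReal_tsum_of_nonneg (fun i => by positivity)
          (Summable.mul_left _ (summable_geometric_of_lt_one (by norm_num) (by norm_num)))]
        rw [tsum_mul_left, tsum_geometric_of_lt_one (by norm_num) (by norm_num)]
        congr 1
        norm_num
        ring

end Measures

/-! ### Littlewood–Paley pieces of a measure -/

namespace LittlewoodPaley

variable {E : Type*} [NormedAddCommGroup E] [InnerProductSpace ℝ E] (φ : LittlewoodPaley E)

/-- The unscaled frequency cut-off from which the cut-off at scale `2^j` is obtained by dilation. -/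
def profile : ℕ → E → ℝ
  | 0 => φ.low
  | _ + 1 => φ.high

lemma cutoff_eq_profile (j : ℕ) (ζ : E) : φ.cutoff j ζ = φ.profile j (((2 : ℝ) ^ j)⁻¹ • ζ) := by
  cases j with
  | zero => simp [cutoff, profile]
  | succ j => simp [cutoff, profile]

lemma contDiff_profile (j : ℕ) : ContDiff ℝ ∞ (φ.profile j) := by
  cases j with
  | zero => exact φ.low_smooth
  | succ j => exact φ.high_smooth

lemma hasCompactSupport_profile (j : ℕ) : HasCompactSupport (φ.profile j) := by
  cases j with
  | zero => exact φ.low_compact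
  | succ j => exact φ.high_compact

lemma continuous_cutoff (j : ℕ) : Continuous (φ.cutoff j) := by
  have h : φ.cutoff j = fun ζ => φ.profile j (((2 : ℝ) ^ j)⁻¹ • ζ) :=
    funext (φ.cutoff_eq_profile j)
  rw [h]
  exact (φ.contDiff_profile j).continuous.comp (by fun_prop)

lemma hasCompactSupport_cutoff (j : ℕ) : HasCompactSupport (φ.cutoff j) := by
  have h : φ.cutoff j = fun ζ => φ.profile j (((2 : ℝ) ^ j)⁻¹ • ζ) :=
    funext (φ.cutoff_eq_profile j)
  rw [h]
  exact (φ.hasCompactSupport_profile j).comp_smul (by positivity)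

lemma exists_norm_le_of_cutoff_ne_zero : ∃ b : ℝ, 1 ≤ b ∧ ∀ j ζ, φ.cutoff j ζ ≠ 0 →
    ‖ζ‖ ≤ b * 2 ^ j := by
  have h1 : ∀ f : E → ℝ, HasCompactSupport f → ∃ b : ℝ, ∀ ζ, f ζ ≠ 0 → ‖ζ‖ ≤ b := by
    intro f hf
    obtain ⟨b, hb⟩ := hf.isCompact.isBounded.exists_norm_le
    exact ⟨b, fun ζ hζ => hb ζ (subset_tsupport _ hζ)⟩
  obtain ⟨b₀, hb₀⟩ := h1 _ φ.low_compact
  obtain ⟨b₁, hb₁⟩ := h1 _ φ.high_compact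
  refine ⟨max 1 (max b₀ b₁), le_max_left _ _, fun j ζ hζ => ?_⟩
  rw [cutoff_eq_profile] at hζ
  have h2 : ‖((2 : ℝ) ^ j)⁻¹ • ζ‖ ≤ max 1 (max b₀ b₁) := by
    cases j with
    | zero => exact (hb₀ _ hζ).trans ((le_max_left _ _).trans (le_max_right _ _))
    | succ j => exact (hb₁ _ hζ).trans ((le_max_right _ _).trans (le_max_right _ _))
  rw [norm_smul, norm_inv, Real.norm_of_nonneg (by positivity), inv_mul_le_iff₀ (by positivity)] at h2
  linarith

lemma hasSum_cutoff (ζ : E) : HasSum (fun j => φ.cutoff j ζ) 1 := by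
  rw [← hasSum_nat_add_iff' 1]
  simpa [cutoff] using φ.hasSum ζ

/-- The cut-offs decay geometrically at a fixed frequency, because the profile of the
high-frequency ones is Lipschitz and vanishes at the origin. -/
lemma exists_abs_cutoff_le : ∃ C : ℝ, 0 ≤ C ∧ ∀ j ζ,
    |φ.cutoff j ζ| ≤ C * (2⁻¹ : ℝ) ^ j * (1 + ‖ζ‖) := by
  obtain ⟨C₀, hC₀⟩ := φ.low_compact.exists_bound_of_continuous φ.low_smooth.continuous
  obtain ⟨C₁, hC₁⟩ := ContDiff.lipschitzWith_of_hasCompactSupport φ.high_compact φ.high_smooth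
    (by simp)
  have h0 : φ.high 0 = 0 := image_eq_zero_of_notMem_tsupport φ.high_zero
  refine ⟨max C₀ 0 + C₁, by positivity, fun j ζ => ?_⟩
  cases j with
  | zero =>
    have h1 : |φ.low ζ| ≤ max C₀ 0 := (hC₀ ζ).trans (le_max_left _ _)
    have h2 : 0 ≤ max C₀ 0 := le_max_right _ _
    have h3 := norm_nonneg ζ
    have h4 := C₁.2
    simp only [cutoff, pow_zero, mul_one]
    nlinarith [mul_nonneg h2 h3, mul_nonneg h4 h3]
  | succ j =>
    have h1 := hC₁.dist_le_mul ((2 : ℝ)⁻¹ ^ (j + 1) • ζ) 0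
    rw [h0, dist_zero_right, dist_zero_right, norm_smul,
      Real.norm_of_nonneg (show (0 : ℝ) ≤ 2⁻¹ ^ (j + 1) by positivity), Real.norm_eq_abs] at h1
    simp only [cutoff]
    refine h1.trans ?_
    have h2 : 0 ≤ max C₀ 0 := le_max_right _ _
    have h3 := norm_nonneg ζ
    calc (C₁ : ℝ) * ((2 : ℝ)⁻¹ ^ (j + 1) * ‖ζ‖) = C₁ * (2 : ℝ)⁻¹ ^ (j + 1) * ‖ζ‖ := by ring
      _ ≤ (max C₀ 0 + C₁) * (2 : ℝ)⁻¹ ^ (j + 1) * (1 + ‖ζ‖) := by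
        gcongr <;> linarith

variable [MeasurableSpace E] [BorelSpace E] [FiniteDimensional ℝ E]

lemma integrable_cutoff (j : ℕ) : Integrable fun ζ => (φ.cutoff j ζ : ℂ) :=
  ((φ.continuous_cutoff j).integrable_of_hasCompactSupport (φ.hasCompactSupport_cutoff j)).ofReal

/-- The inverse Fourier transform of the `j`-th cut-off is the dilation of a Schwartz function. -/
lemma exists_schwartz_fourierInv_cutoff (j : ℕ) : ∃ χ : 𝓢(E, ℂ),
    (χ : E → ℂ) = 𝓕⁻ (fun ζ => (φ.profile j ζ : ℂ)) ∧ ∀ y, 𝓕⁻ (fun ζ => (φ.cutoff j ζ : ℂ)) y =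
      (((2 : ℝ) ^ j : ℝ) : ℂ) ^ Module.finrank ℝ E * χ ((2 : ℝ) ^ j • y) := by
  have h1 : HasCompactSupport fun ζ => (φ.profile j ζ : ℂ) :=
    (φ.hasCompactSupport_profile j).comp_left (g := fun t : ℝ => (t : ℂ)) rfl
  have h2 : ContDiff ℝ ∞ fun ζ => (φ.profile j ζ : ℂ) :=
    Complex.ofRealCLM.contDiff.comp (φ.contDiff_profile j)
  have h3 : ((𝓕⁻ (h1.toSchwartzMap h2) : 𝓢(E, ℂ)) : E → ℂ) =
      𝓕⁻ (fun ζ => (φ.profile j ζ : ℂ)) := by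
    rw [SchwartzMap.fourierInv_coe]
    rfl
  refine ⟨𝓕⁻ (h1.toSchwartzMap h2), h3, fun y => ?_⟩
  rw [h3, ← fourierInv_comp_inv_smul _ (by positivity)]
  simp_rw [cutoff_eq_profile]

variable {σ : Measure E} {ψ : E → ℂ} [SFinite σ]

lemma littlewoodPaleyPiece_eq_integral (hψ : Integrable ψ σ) (j : ℕ) :
    littlewoodPaleyPiece φ σ ψ j =
      fun x => ∫ u, 𝓕⁻ (fun ζ => (φ.cutoff j ζ : ℂ)) (x - u) * ψ u ∂σ :=
  funext fun x => fourierInv_mul_fourierMeasure (φ.integrable_cutoff j) hψ x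

lemma integrable_littlewoodPaleyPiece (hψ : Integrable ψ σ) (j : ℕ) :
    Integrable (littlewoodPaleyPiece φ σ ψ j) := by
  rw [φ.littlewoodPaleyPiece_eq_integral hψ]
  refine integrable_integral_sub_mul ?_ hψ
  obtain ⟨χ, -, hχ⟩ := φ.exists_schwartz_fourierInv_cutoff j
  have h : 𝓕⁻ (fun ζ => (φ.cutoff j ζ : ℂ)) = fun y =>
      (((2 : ℝ) ^ j : ℝ) : ℂ) ^ Module.finrank ℝ E * χ ((2 : ℝ) ^ j • y) := funext hχ
  rw [h]
  exact (χ.integrable.comp_smul (by positivity)).const_mul _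

lemma fourier_littlewoodPaleyPiece (hψ : Integrable ψ σ) (j : ℕ) :
    𝓕 (littlewoodPaleyPiece φ σ ψ j) = fun ζ => (φ.cutoff j ζ : ℂ) * fourierMeasure σ ψ ζ := by
  have hc : Continuous fun ζ => (φ.cutoff j ζ : ℂ) * fourierMeasure σ ψ ζ :=
    (Complex.continuous_ofReal.comp (φ.continuous_cutoff j)).mul (continuous_fourierMeasure hψ)
  refine hc.fourier_fourierInv_eq ?_ ?_
  swap
  · refine ((φ.integrable_littlewoodPaleyPiece hψ j).comp_neg).congr (ae_of_all _ fun ζ => ?_)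
    simp only
    rw [littlewoodPaleyPiece, Real.fourierInv_eq_fourier_neg, neg_neg]
  exact hc.integrable_of_hasCompactSupport
    (((φ.hasCompactSupport_cutoff j).comp_left (g := fun t : ℝ => (t : ℂ)) rfl).mul_right)

/-- The pieces of a bounded density on a set of dimension `k` grow at most like `2^{jl}`, with `l`
the codimension. -/
lemma exists_norm_littlewoodPaleyPiece_le (hψ : Integrable ψ σ) {S : ℝ} (hS0 : 0 ≤ S)
    (hS : ∀ᵐ u ∂σ, ‖ψ u‖ ≤ S) {k l : ℕ} (hkl : k + l = Module.finrank ℝ E) {C : ℝ} (hC0 : 0 ≤ C)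
    (hC : ∀ y r, 0 < r → σ (Metric.closedBall y r) ≤ ENNReal.ofReal (C * r ^ k)) :
    ∃ C' : ℝ, 0 ≤ C' ∧ ∀ j x, ‖littlewoodPaleyPiece φ σ ψ j x‖ ≤ C' * ((2 : ℝ) ^ j) ^ l := by
  have key : ∀ j₀, ∃ C' : ℝ, 0 ≤ C' ∧ ∀ j, φ.profile j = φ.profile j₀ → ∀ x,
      ‖littlewoodPaleyPiece φ σ ψ j x‖ ≤ C' * ((2 : ℝ) ^ j) ^ l := by
    intro j₀
    obtain ⟨χ, hχ0, -⟩ := φ.exists_schwartz_fourierInv_cutoff j₀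
    obtain ⟨C', hC'0, hC'⟩ := exists_lintegral_schwartz_scaled_le hC0 hC χ
    refine ⟨C' * S, by positivity, fun j hj x => ?_⟩
    obtain ⟨χ', hχ'0, hχ'⟩ := φ.exists_schwartz_fourierInv_cutoff j
    obtain rfl : χ' = χ := DFunLike.coe_injective (by rw [hχ0, hχ'0, hj])
    set R : ℝ := 2 ^ j with hR
    have hR0 : 0 < R := by positivity
    rw [φ.littlewoodPaleyPiece_eq_integral hψ]
    simp_rw [hχ']
    have h1 : ‖∫ u, ((R : ℝ) : ℂ) ^ Module.finrank ℝ E * χ' (R • (x - u)) * ψ u ∂σ‖ₑ ≤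
        ENNReal.ofReal (C' * S * R ^ l) := by
      calc _ ≤ ∫⁻ u, ‖((R : ℝ) : ℂ) ^ Module.finrank ℝ E * χ' (R • (x - u)) * ψ u‖ₑ ∂σ :=
            enorm_integral_le_lintegral_enorm _
        _ ≤ ∫⁻ u, ENNReal.ofReal (R ^ Module.finrank ℝ E * S) * ‖χ' (R • (x - u))‖ₑ ∂σ := by
            refine lintegral_mono_ae ?_
            filter_upwards [hS] with u hu
            rw [← ofReal_norm, ← ofReal_norm, ← ENNReal.ofReal_mul (by positivity)]
            refine ENNReal.ofReal_le_ofReal ?_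
            rw [norm_mul, norm_mul, norm_pow, Complex.norm_real, Real.norm_of_nonneg hR0.le,
              mul_right_comm]
            gcongr
        _ ≤ ENNReal.ofReal (R ^ Module.finrank ℝ E * S) * ENNReal.ofReal (C' * (R ^ k)⁻¹) := by
            rw [lintegral_const_mul' _ _ ENNReal.ofReal_ne_top]
            gcongr
            exact hC' R x hR0
        _ = _ := by
            rw [← ENNReal.ofReal_mul (by positivity), ← hkl, pow_add]
            congr 1
            field_simp
    rw [← ofReal_norm] at h1
    exact (ENNReal.ofReal_le_ofReal_iff (by positivity)).1 h1
  obtain ⟨C₀, hC₀0, hC₀⟩ := key 0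
  obtain ⟨C₁, hC₁0, hC₁⟩ := key 1
  refine ⟨C₀ + C₁, by positivity, fun j x => ?_⟩
  cases j with
  | zero =>
    refine (hC₀ 0 rfl x).trans ?_
    gcongr
    linarith
  | succ j =>
    refine (hC₁ (j + 1) rfl x).trans ?_
    gcongr
    linarith

end LittlewoodPaley

/-! ### `L²` bounds for the form -/

section SliceDecay

lemma lintegral_rpow_two_eq_eLpNorm {X : Type*} [MeasurableSpace X] {μ : Measure X} (f : X → ℂ) :
    (∫⁻ x, ‖f x‖ₑ ^ (2 : ℝ) ∂μ) ^ (1 / 2 : ℝ) = eLpNorm f 2 μ := by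
  rw [eLpNorm_eq_lintegral_rpow_enorm_toReal two_ne_zero ENNReal.ofNat_ne_top]
  simp

lemma eLpNorm_fourier_schwartz {V : Type*} [NormedAddCommGroup V] [InnerProductSpace ℝ V]
    [FiniteDimensional ℝ V] [MeasurableSpace V] [BorelSpace V] (f : 𝓢(V, ℂ)) :
    eLpNorm ⇑(𝓕 f : 𝓢(V, ℂ)) 2 volume = eLpNorm f 2 volume := by
  have h := SchwartzMap.norm_fourier_toL2_eq f
  rw [SchwartzMap.norm_toLp, SchwartzMap.norm_toLp] at h
  exact (ENNReal.toReal_eq_toReal_iff' ((𝓕 f : 𝓢(V, ℂ)).memLp 2 volume).eLpNorm_ne_top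
    (f.memLp 2 volume).eLpNorm_ne_top).1 h

lemma eLpNorm_fourierInv_schwartz {V : Type*} [NormedAddCommGroup V] [InnerProductSpace ℝ V]
    [FiniteDimensional ℝ V] [MeasurableSpace V] [BorelSpace V] (f : 𝓢(V, ℂ)) :
    eLpNorm ⇑(𝓕⁻ f : 𝓢(V, ℂ)) 2 volume = eLpNorm f 2 volume := by
  rw [← eLpNorm_fourier_schwartz, FourierTransform.fourier_fourierInv_eq]

variable {m d : ℕ}

/-- On almost every slice orthogonal to the diagonal, the part of the Fourier transform of `ψ dσ`
at frequency scale `2^j` has `L²` norm at most `C 2^{-jγ}`. -/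
def SliceDecay (φ : LittlewoodPaley (TupleSpace m d)) (σ : Measure (TupleSpace m d))
    (ψ : TupleSpace m d → ℂ) (C γ : ℝ) : Prop :=
  ∀ j : ℕ, ∀ᵐ ξ : diagonalSubspace m d ∂subspaceVolume (diagonalSubspace m d),
    (∫⁻ η : (diagonalSubspace m d)ᗮ,
      ‖(φ.cutoff j ((ξ : TupleSpace m d) + (η : TupleSpace m d)) : ℂ) *
        fourierMeasure σ ψ ((ξ : TupleSpace m d) + (η : TupleSpace m d))‖ₑ ^ (2 : ℝ)
        ∂subspaceVolume (diagonalSubspace m d)ᗮ) ^ (1 / 2 : ℝ) ≤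
      ENNReal.ofReal (C * (2 : ℝ) ^ (-(j : ℝ) * γ))

lemma sliceDecay_of_lambdaNorm_le {φ : LittlewoodPaley (TupleSpace m d)}
    {σ : Measure (TupleSpace m d)} [SFinite σ] {ψ : TupleSpace m d → ℂ} (hψ : Integrable ψ σ)
    {C γ : ℝ} (h : ∀ j : ℕ, lambdaNorm (diagonalSubspace m d) 2 ⊤ (littlewoodPaleyPiece φ σ ψ j) ≤
      ENNReal.ofReal (C * (2 : ℝ) ^ (-(j : ℝ) * γ))) : SliceDecay φ σ ψ C γ := by
  intro j
  have h1 := h j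
  rw [lambdaNorm, eLpNorm_exponent_top, φ.fourier_littlewoodPaleyPiece hψ] at h1
  filter_upwards [ae_le_eLpNormEssSup (μ := subspaceVolume (diagonalSubspace m d))
    (f := fun ξ : diagonalSubspace m d => eLpNorm (fun η : (diagonalSubspace m d)ᗮ =>
      (φ.cutoff j ((ξ : TupleSpace m d) + (η : TupleSpace m d)) : ℂ) *
        fourierMeasure σ ψ ((ξ : TupleSpace m d) + (η : TupleSpace m d))) 2
      (subspaceVolume (diagonalSubspace m d)ᗮ))] with ξ hξ
  rw [lintegral_rpow_two_eq_eLpNorm (μ := subspaceVolume (diagonalSubspace m d)ᗮ)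
    (fun η : (diagonalSubspace m d)ᗮ =>
      (φ.cutoff j ((ξ : TupleSpace m d) + (η : TupleSpace m d)) : ℂ) *
        fourierMeasure σ ψ ((ξ : TupleSpace m d) + (η : TupleSpace m d)))]
  exact hξ.trans h1

lemma norm_sum_coord_le (u : TupleSpace m d) : ‖∑ i, u i‖ ≤ m * ‖u‖ := by
  refine (norm_sum_le _ _).trans ?_
  refine (Finset.sum_le_sum fun i _ => PiLp.norm_apply_le u i).trans_eq ?_
  simp

/-- The Sobolev weight of order `γ` is absorbed by the decay `2^{-jγ}` over the scales `2^j` that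
are not small compared with the frequency. -/
lemma exists_tsum_indicator_le {V : Type*} [NormedAddCommGroup V] {B C γ : ℝ} (hB : 1 ≤ B)
    (hC : 0 ≤ C) (hγ : 0 < γ) :
    ∃ C' : ℝ≥0∞, C' ≠ ⊤ ∧ ∀ s : V,
      (∑' j : ℕ, (Metric.closedBall (0 : V) (B * 2 ^ j)).indicator
        (fun _ => ENNReal.ofReal (C * (2 : ℝ) ^ (-(j : ℝ) * γ))) s) *
          ENNReal.ofReal ((1 + ‖s‖ ^ 2) ^ (γ / 2)) ≤ C' := by
  set q : ℝ := (2 : ℝ) ^ (-γ) with hq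
  have hq0 : 0 < q := by positivity
  have hq1 : q < 1 := Real.rpow_lt_one_of_one_lt_of_neg one_lt_two (by linarith)
  have hpow : ∀ j : ℕ, (2 : ℝ) ^ (-(j : ℝ) * γ) = q ^ j := fun j => by
    rw [hq, ← Real.rpow_natCast, ← Real.rpow_mul (by norm_num)]; ring_nf
  refine ⟨ENNReal.ofReal ((2 * B) ^ γ * C * (1 - q)⁻¹), ENNReal.ofReal_ne_top, fun s => ?_⟩
  -- the first scale that sees `s`
  have hex : ∃ i : ℕ, ‖s‖ ≤ B * 2 ^ i := by
    obtain ⟨i, hi⟩ := pow_unbounded_of_one_lt ‖s‖ one_lt_two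
    exact ⟨i, hi.le.trans (le_mul_of_one_le_left (by positivity) hB)⟩
  set i := Nat.find hex with hi
  have hsi : ‖s‖ ≤ B * 2 ^ i := Nat.find_spec hex
  have hw : (1 + ‖s‖ ^ 2) ^ (γ / 2) ≤ (2 * B) ^ γ * (q ^ i)⁻¹ := by
    have hi1 : (1 : ℝ) ≤ 2 ^ i := one_le_pow₀ one_le_two
    have h1 : 1 + ‖s‖ ^ 2 ≤ (2 * B * 2 ^ i) ^ 2 := by
      have h2 : 1 ≤ B * 2 ^ i := one_le_mul_of_one_le_of_one_le hB hi1
      nlinarith [norm_nonneg s]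
    calc _ ≤ ((2 * B * 2 ^ i) ^ 2) ^ (γ / 2) := by gcongr
      _ = (2 * B) ^ γ * (q ^ i)⁻¹ := by
        rw [← Real.rpow_natCast (2 * B * 2 ^ i) 2, ← Real.rpow_mul (by positivity),
          Real.mul_rpow (by positivity) (by positivity), ← hpow, ← Real.rpow_neg (by norm_num),
          ← Real.rpow_natCast 2 i, ← Real.rpow_mul (by norm_num)]
        congr 2 <;> · push_cast; ring
  rw [← Summable.sum_add_tsum_nat_add' (k := i) ENNReal.summable, Finset.sum_eq_zero, zero_add]
  swap
  · intro j hj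
    refine indicator_of_notMem (fun hmem => ?_) _
    exact Nat.find_min hex (Finset.mem_range.1 hj) (mem_closedBall_zero_iff.1 hmem)
  calc _ ≤ (∑' j : ℕ, ENNReal.ofReal (C * q ^ i * q ^ j)) *
        ENNReal.ofReal ((2 * B) ^ γ * (q ^ i)⁻¹) := by
        gcongr with j
        refine (indicator_le_self' (fun _ _ => zero_le) _).trans (ENNReal.ofReal_le_ofReal ?_)
        rw [hpow, pow_add]
        exact le_of_eq (by ring)
    _ = _ := by
        rw [← ENNReal.ofReal_tsum_of_nonneg (fun j => by positivity)
          (Summable.mul_left _ (summable_geometric_of_lt_one hq0.le hq1)), tsum_mul_left,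
          tsum_geometric_of_lt_one hq0.le hq1, ← ENNReal.ofReal_mul
            (mul_nonneg (by positivity) (inv_nonneg.2 (by linarith)))]
        congr 1
        have : q ^ i ≠ 0 := by positivity
        field_simp

variable {φ : LittlewoodPaley (TupleSpace m d)} {σ : Measure (TupleSpace m d)} [SFinite σ]
  {ψ : TupleSpace m d → ℂ} {C γ : ℝ}

omit [SFinite σ] in
/-- The decay on slices, refined by the localisation of the pieces: a piece at scale `2^j` does not
see the slices at distance more than a multiple of `2^j` from the origin. -/
lemma SliceDecay.indicator (h : SliceDecay φ σ ψ C γ) :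
    ∃ B : ℝ, 1 ≤ B ∧ ∀ j : ℕ,
      ∀ᵐ ξ : diagonalSubspace m d ∂subspaceVolume (diagonalSubspace m d),
      (∫⁻ η : (diagonalSubspace m d)ᗮ,
        ‖(φ.cutoff j ((ξ : TupleSpace m d) + (η : TupleSpace m d)) : ℂ) *
          fourierMeasure σ ψ ((ξ : TupleSpace m d) + (η : TupleSpace m d))‖ₑ ^ (2 : ℝ)
          ∂subspaceVolume (diagonalSubspace m d)ᗮ) ^ (1 / 2 : ℝ) ≤
        (Metric.closedBall (0 : EuclideanSpace ℝ (Fin d)) (B * 2 ^ j)).indicator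
          (fun _ => ENNReal.ofReal (C * (2 : ℝ) ^ (-(j : ℝ) * γ)))
          (∑ i, (ξ : TupleSpace m d) i) := by
  obtain ⟨b, hb1, hb⟩ := φ.exists_norm_le_of_cutoff_ne_zero
  refine ⟨max 1 (m * b), le_max_left _ _, fun j => ?_⟩
  filter_upwards [h j] with ξ hξ
  by_cases hs : ∑ i, (ξ : TupleSpace m d) i ∈
      Metric.closedBall (0 : EuclideanSpace ℝ (Fin d)) (max 1 (m * b) * 2 ^ j)
  · rwa [indicator_of_mem hs]
  · rw [indicator_of_notMem hs]
    have h0 : ∀ η : (diagonalSubspace m d)ᗮ,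
        φ.cutoff j ((ξ : TupleSpace m d) + (η : TupleSpace m d)) = 0 := by
      intro η
      by_contra hne
      refine hs (mem_closedBall_zero_iff.2 ?_)
      have h1 := norm_sum_coord_le ((ξ : TupleSpace m d) + (η : TupleSpace m d))
      simp only [PiLp.add_apply, Finset.sum_add_distrib] at h1
      rw [sum_eq_zero_of_mem_diagonal_orthogonal η.2, add_zero] at h1
      refine h1.trans ((mul_le_mul_of_nonneg_left (hb j _ hne) (Nat.cast_nonneg m)).trans ?_)
      rw [← mul_assoc]
      gcongr
      exact le_max_right _ _
    simp [h0]

omit [SFinite σ] in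
/-- The weighted `L²` bound on the Fourier side: the Sobolev weight of order `γ` in the output
frequency `∑ i, ζ i` is paid for by the decay of the pieces on slices. -/
lemma SliceDecay.exists_lintegral_weighted_le (hm : m ≠ 0) (h : SliceDecay φ σ ψ C γ)
    (hC : 0 ≤ C) (hγ : 0 < γ) (hψ : Integrable ψ σ) :
    ∃ C' : ℝ, 0 ≤ C' ∧ ∀ (f : Fin m → 𝓢(EuclideanSpace ℝ (Fin d), ℂ))
      (g : 𝓢(EuclideanSpace ℝ (Fin d), ℂ)),
      ∫⁻ ζ : Fin m → EuclideanSpace ℝ (Fin d), ‖fourierMeasure σ ψ (WithLp.toLp 2 ζ)‖ₑ *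
          (ENNReal.ofReal ((1 + ‖∑ i, ζ i‖ ^ 2) ^ (γ / 2)) * ‖g (∑ i, ζ i)‖ₑ) *
            ∏ i, ‖𝓕 (f i) (ζ i)‖ₑ ≤
        ENNReal.ofReal C' * eLpNorm g 2 volume * ∏ i, eLpNorm (f i) 2 volume := by
  obtain ⟨B, hB1, hB⟩ := h.indicator
  obtain ⟨C₁, hC₁, hslice⟩ := exists_slice_bound (d := d) hm
  obtain ⟨C₂, hC₂, hsum⟩ := exists_tsum_indicator_le (V := EuclideanSpace ℝ (Fin d)) hB1 hC hγ
  refine ⟨(C₁ * C₂).toReal, ENNReal.toReal_nonneg, fun f g => ?_⟩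
  rw [ENNReal.ofReal_toReal (ENNReal.mul_ne_top hC₁ hC₂)]
  have hcont : Continuous (fourierMeasure σ ψ) := continuous_fourierMeasure hψ
  have hw : Measurable fun s : EuclideanSpace ℝ (Fin d) =>
      ENNReal.ofReal ((1 + ‖s‖ ^ 2) ^ (γ / 2)) := by fun_prop
  have hmain := hslice
    (fun j u => ‖(φ.cutoff j u : ℂ) * fourierMeasure σ ψ u‖ₑ)
    (fun j => (Metric.closedBall (0 : EuclideanSpace ℝ (Fin d)) (B * 2 ^ j)).indicator
          (fun _ => ENNReal.ofReal (C * (2 : ℝ) ^ (-(j : ℝ) * γ))))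
    (fun i v => ‖𝓕 (f i) v‖ₑ)
    (fun s => ENNReal.ofReal ((1 + ‖s‖ ^ 2) ^ (γ / 2)) * ‖g s‖ₑ)
    (fun j => ((Complex.continuous_ofReal.comp (φ.continuous_cutoff j)).mul hcont).enorm.measurable)
    (fun j => measurable_const.indicator Metric.isClosed_closedBall.measurableSet)
    (fun i => (𝓕 (f i)).continuous.enorm.measurable)
    (hw.mul g.continuous.enorm.measurable) hB
  calc _ ≤ _ := lintegral_mono fun ζ => ?_
    _ ≤ _ := hmain
    _ ≤ _ := ?_
  · simp only
    gcongr
    have h1 := Complex.ofRealCLM.hasSum (φ.hasSum_cutoff (WithLp.toLp 2 ζ))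
    have h2 := (h1.mul_right (fourierMeasure σ ψ (WithLp.toLp 2 ζ))).tsum_eq
    simp only [Complex.ofRealCLM_apply, Complex.ofReal_one, one_mul] at h2
    refine (congrArg _ h2).symm.trans_le ?_
    exact enorm_tsum_le_tsum_enorm (ε := ℂ)
  · simp_rw [lintegral_rpow_two_eq_eLpNorm, eLpNorm_fourier_schwartz]
    rw [mul_assoc C₁ C₂]
    gcongr
    calc _ ≤ (∫⁻ s, (C₂ * ‖g s‖ₑ) ^ (2 : ℝ)) ^ (1 / 2 : ℝ) := by
          refine ENNReal.rpow_le_rpow (lintegral_mono fun s => ?_) (by norm_num)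
          refine ENNReal.rpow_le_rpow ?_ zero_le_two
          rw [← mul_assoc]
          exact mul_le_mul_left (hsum s) _
      _ = _ := by
          simp_rw [ENNReal.mul_rpow_of_nonneg _ _ (zero_le_two : (0 : ℝ) ≤ 2)]
          rw [lintegral_const_mul' _ _ (ENNReal.rpow_ne_top_of_nonneg zero_le_two hC₂),
            ENNReal.mul_rpow_of_nonneg _ _ (by norm_num), ← ENNReal.rpow_mul,
            lintegral_rpow_two_eq_eLpNorm]
          norm_num

/-- The form at Schwartz functions, on the Fourier side. -/
lemma multilinearForm_toLp_eq_integral_fourier (hψ : Integrable ψ σ)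
    (f : Fin (m + 1) → 𝓢(EuclideanSpace ℝ (Fin d), ℂ)) :
    multilinearForm σ hψ (fun i => (f i).toLp (m + 1)) =
      ∫ ζ : Fin m → EuclideanSpace ℝ (Fin d),
        fourierMeasure σ ψ (WithLp.toLp 2 ζ) * (𝓕⁻ (f 0)) (∑ j, ζ j) *
          ∏ j : Fin m, (𝓕 (f j.succ)) (ζ j) := by
  rw [multilinearForm_apply, ← integral_formIntegrand_eq σ hψ f]
  exact integral_congr_ae (formIntegrand_congr ψ fun i => (f i).coeFn_toLp (m + 1) volume)

/-- The `L²` bound for the whole form, from the weighted one since the weight is at least `1`. -/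
lemma SliceDecay.exists_formBound_two (hm : m ≠ 0) (h : SliceDecay φ σ ψ C γ)
    (hC : 0 ≤ C) (hγ : 0 < γ) (hψ : Integrable ψ σ) :
    ∃ C' : ℝ, 0 ≤ C' ∧ FormBound (multilinearForm σ hψ) 2 C' := by
  obtain ⟨C', hC', hw⟩ := h.exists_lintegral_weighted_le hm hC hγ hψ
  refine ⟨C', hC', FormBound.of_schwartz (by simp) one_le_two
    ENNReal.ofNat_ne_top fun f => ?_⟩
  rw [multilinearForm_toLp_eq_integral_fourier]
  have h1 := hw (fun j => f j.succ) (𝓕⁻ (f 0))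
  rw [eLpNorm_fourierInv_schwartz] at h1
  have h2 : ‖∫ ζ : Fin m → EuclideanSpace ℝ (Fin d),
        fourierMeasure σ ψ (WithLp.toLp 2 ζ) * (𝓕⁻ (f 0)) (∑ j, ζ j) *
          ∏ j : Fin m, (𝓕 (f j.succ)) (ζ j)‖ₑ ≤
      ENNReal.ofReal C' * ∏ i, eLpNorm (f i) 2 volume := by
    refine (enorm_integral_le_lintegral_enorm _).trans (le_trans (lintegral_mono fun ζ => ?_)
      (h1.trans_eq (by rw [Fin.prod_univ_succ, mul_assoc])))
    simp only
    rw [enorm_mul, enorm_mul, enorm_finsetProd]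
    gcongr
    refine le_mul_of_one_le_left zero_le ?_
    rw [← ENNReal.ofReal_one]
    refine ENNReal.ofReal_le_ofReal (Real.one_le_rpow (by nlinarith [sq_nonneg ‖∑ i, ζ i‖])
      (by positivity))
  have h3 := ENNReal.toReal_mono (ENNReal.mul_ne_top ENNReal.ofReal_ne_top
    (ENNReal.prod_ne_top fun i _ => ((f i).memLp 2 volume).eLpNorm_ne_top)) h2
  rwa [toReal_enorm, ENNReal.toReal_mul, ENNReal.toReal_ofReal hC', ENNReal.toReal_prod] at h3

/-- The `L²` bound for the form of a single piece. -/
lemma SliceDecay.exists_formBound_two_piece (hm : m ≠ 0) (h : SliceDecay φ σ ψ C γ)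
    (hC : 0 ≤ C) (hψ : Integrable ψ σ) :
    ∃ C' : ℝ, 0 ≤ C' ∧ ∀ j, FormBound (multilinearForm volume
      (φ.integrable_littlewoodPaleyPiece hψ j)) 2 (C' * (2 : ℝ) ^ (-(j : ℝ) * γ)) := by
  obtain ⟨C₁, hC₁, hslice⟩ := exists_slice_bound (d := d) hm
  refine ⟨C₁.toReal * C, by positivity, fun j => FormBound.of_schwartz (by simp) one_le_two
    ENNReal.ofNat_ne_top fun f => ?_⟩
  rw [multilinearForm_toLp_eq_integral_fourier, fourierMeasure_volume,
    φ.fourier_littlewoodPaleyPiece hψ]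
  set c : ℝ := C * (2 : ℝ) ^ (-(j : ℝ) * γ) with hc
  have hc0 : 0 ≤ c := by positivity
  have hcont : Continuous (fourierMeasure σ ψ) := continuous_fourierMeasure hψ
  have hmain := hslice (ι := Unit)
    (fun _ u => ‖(φ.cutoff j u : ℂ) * fourierMeasure σ ψ u‖ₑ)
    (fun _ _ => ENNReal.ofReal c)
    (fun i v => ‖𝓕 (f i.succ) v‖ₑ)
    (fun s => ‖𝓕⁻ (f 0) s‖ₑ)
    (fun _ => ((Complex.continuous_ofReal.comp (φ.continuous_cutoff j)).mul hcont).enorm.measurable)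
    (fun _ => measurable_const)
    (fun i => (𝓕 (f i.succ)).continuous.enorm.measurable)
    (𝓕⁻ (f 0)).continuous.enorm.measurable (fun _ => h j)
  simp only [tsum_fintype, Finset.univ_unique, Finset.sum_singleton] at hmain
  simp_rw [lintegral_rpow_two_eq_eLpNorm, eLpNorm_fourier_schwartz,
    ENNReal.mul_rpow_of_nonneg _ _ (zero_le_two : (0 : ℝ) ≤ 2)] at hmain
  rw [lintegral_const_mul' _ _ (ENNReal.rpow_ne_top_of_nonneg zero_le_two ENNReal.ofReal_ne_top),
    ENNReal.mul_rpow_of_nonneg _ _ (by norm_num), ← ENNReal.rpow_mul,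
    lintegral_rpow_two_eq_eLpNorm, eLpNorm_fourierInv_schwartz] at hmain
  have h2 : ‖∫ ζ : Fin m → EuclideanSpace ℝ (Fin d),
        (φ.cutoff j (WithLp.toLp 2 ζ) : ℂ) * fourierMeasure σ ψ (WithLp.toLp 2 ζ) *
          (𝓕⁻ (f 0)) (∑ j, ζ j) * ∏ j : Fin m, (𝓕 (f j.succ)) (ζ j)‖ₑ ≤
      C₁ * ENNReal.ofReal c * ∏ i, eLpNorm (f i) 2 volume := by
    refine (enorm_integral_le_lintegral_enorm _).trans (le_trans (le_of_eq ?_)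
      (hmain.trans_eq ?_))
    · refine lintegral_congr fun ζ => ?_
      rw [enorm_mul, enorm_mul, enorm_finsetProd]
    · rw [Fin.prod_univ_succ]
      norm_num
      ring
  have h3 := ENNReal.toReal_mono (ENNReal.mul_ne_top (ENNReal.mul_ne_top hC₁ ENNReal.ofReal_ne_top)
    (ENNReal.prod_ne_top fun i _ => ((f i).memLp 2 volume).eLpNorm_ne_top)) h2
  rw [toReal_enorm, ENNReal.toReal_mul, ENNReal.toReal_mul, ENNReal.toReal_ofReal hc0,
    ENNReal.toReal_prod] at h3
  rwa [mul_assoc C₁.toReal, ← hc]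

end SliceDecay

/-! ### Summation over the frequency scales -/

section Summation

variable {m d : ℕ} {φ : LittlewoodPaley (TupleSpace m d)} {σ : Measure (TupleSpace m d)}
  {ψ : TupleSpace m d → ℂ} {C γ : ℝ}

lemma one_add_norm_toLp_le (ζ : Fin m → EuclideanSpace ℝ (Fin d)) :
    1 + ‖(WithLp.toLp 2 ζ : TupleSpace m d)‖ ≤ 2 * ∏ i, (1 + ‖ζ i‖ ^ 2) := by
  have h1 : ‖(WithLp.toLp 2 ζ : TupleSpace m d)‖ ^ 2 = ∑ i, ‖ζ i‖ ^ 2 :=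
    PiLp.norm_sq_eq_of_L2 _ _
  have h2 : 1 + ∑ i, ‖ζ i‖ ^ 2 ≤ ∏ i, (1 + ‖ζ i‖ ^ 2) := by
    induction (Finset.univ : Finset (Fin m)) using Finset.induction_on with
    | empty => simp
    | insert i s hi ih =>
      rw [Finset.sum_insert hi, Finset.prod_insert hi]
      have h3 : 1 ≤ ∏ i ∈ s, (1 + ‖ζ i‖ ^ 2) :=
        le_trans (by simpa using Finset.sum_nonneg fun i _ => sq_nonneg ‖ζ i‖) ih
      nlinarith [sq_nonneg ‖ζ i‖]
  rw [← h1] at h2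
  nlinarith [sq_nonneg (‖(WithLp.toLp 2 ζ : TupleSpace m d)‖ - 1)]

lemma integrable_prod_weight_mul_schwartz (g : Fin m → 𝓢(EuclideanSpace ℝ (Fin d), ℂ)) :
    Integrable fun ζ : Fin m → EuclideanSpace ℝ (Fin d) =>
      ∏ i, ((1 + ‖ζ i‖ ^ 2) * ‖g i (ζ i)‖) := by
  refine Integrable.fintype_prod (f := fun i v => (1 + ‖v‖ ^ 2) * ‖g i v‖) fun i => ?_
  have h := (g i).integrable.norm.add ((g i).integrable_pow_mul volume 2)
  refine h.congr (ae_of_all _ fun v => ?_)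
  simp only [Pi.add_apply]
  ring

variable [SFinite σ]

/-- At Schwartz functions, the form is the sum of the forms of the Littlewood–Paley pieces. -/
lemma hasSum_multilinearForm_littlewoodPaleyPiece (φ : LittlewoodPaley (TupleSpace m d))
    (hψ : Integrable ψ σ) (f : Fin (m + 1) → 𝓢(EuclideanSpace ℝ (Fin d), ℂ)) :
    HasSum (fun j => multilinearForm volume (φ.integrable_littlewoodPaleyPiece hψ j)
      (fun i => (f i).toLp (m + 1))) (multilinearForm σ hψ (fun i => (f i).toLp (m + 1))) := by
  simp_rw [multilinearForm_toLp_eq_integral_fourier, fourierMeasure_volume,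
    φ.fourier_littlewoodPaleyPiece hψ]
  have hcont : Continuous (fourierMeasure σ ψ) := continuous_fourierMeasure hψ
  obtain ⟨C, hC0, hC⟩ := φ.exists_abs_cutoff_le
  obtain ⟨S, hS⟩ := SchwartzMap.decay (𝓕⁻ (f 0)) 0 0
  have hS1 : ∀ v, ‖(𝓕⁻ (f 0)) v‖ ≤ S := fun v => by simpa using hS.2 v
  set N := ∫ u, ‖ψ u‖ ∂σ with hN
  have hN0 : 0 ≤ N := integral_nonneg fun u => norm_nonneg _
  set G : (Fin m → EuclideanSpace ℝ (Fin d)) → ℝ := fun ζ =>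
    ∏ i, ((1 + ‖ζ i‖ ^ 2) * ‖(𝓕 (f i.succ)) (ζ i)‖) with hG
  have hGi : Integrable G := integrable_prod_weight_mul_schwartz fun i => 𝓕 (f i.succ)
  have hG0 : 0 ≤ ∫ ζ, G ζ := integral_nonneg fun ζ => Finset.prod_nonneg fun i _ => by positivity
  set F : ℕ → (Fin m → EuclideanSpace ℝ (Fin d)) → ℂ := fun j ζ =>
    (φ.cutoff j (WithLp.toLp 2 ζ) : ℂ) * fourierMeasure σ ψ (WithLp.toLp 2 ζ) *
      (𝓕⁻ (f 0)) (∑ i, ζ i) * ∏ i : Fin m, (𝓕 (f i.succ)) (ζ i) with hF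
  have hFb : ∀ j ζ, ‖F j ζ‖ ≤ (2 * C * N * S) * (2⁻¹ : ℝ) ^ j * G ζ := by
    intro j ζ
    rw [hF, hG]
    simp only [norm_mul, norm_prod, Complex.norm_real, Real.norm_eq_abs, Finset.prod_mul_distrib]
    have h1 := (hC j (WithLp.toLp 2 ζ)).trans
      (mul_le_mul_of_nonneg_left (one_add_norm_toLp_le ζ) (by positivity))
    calc _ ≤ (C * (2⁻¹ : ℝ) ^ j * (2 * ∏ i, (1 + ‖ζ i‖ ^ 2))) * N * S *
          ∏ i : Fin m, ‖(𝓕 (f i.succ)) (ζ i)‖ := by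
          gcongr
          · exact norm_fourierMeasure_le _
          · exact hS1 _
      _ = _ := by ring
  have htoLp : Continuous fun ζ : Fin m → EuclideanSpace ℝ (Fin d) =>
      (WithLp.toLp 2 ζ : TupleSpace m d) := PiLp.continuous_toLp 2 _
  have hFc : ∀ j, Continuous (F j) := by
    intro j
    refine Continuous.mul (Continuous.mul (Continuous.mul ?_ ?_) ?_) ?_
    · exact Complex.continuous_ofReal.comp ((φ.continuous_cutoff j).comp htoLp)
    · exact hcont.comp htoLp
    · exact (𝓕⁻ (f 0)).continuous.comp (by fun_prop)
    · exact continuous_finsetProd _ fun i _ => (𝓕 (f i.succ)).continuous.comp (by fun_prop)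
  have hFi : ∀ j, Integrable (F j) := fun j =>
    (hGi.const_mul _).mono' (hFc j).aestronglyMeasurable (ae_of_all _ (hFb j))
  have hsumm : Summable fun j => ∫ ζ, ‖F j ζ‖ := by
    refine Summable.of_nonneg_of_le (fun j => integral_nonneg fun ζ => norm_nonneg _)
      (fun j => (integral_mono (hFi j).norm (hGi.const_mul _) (hFb j)).trans_eq
        (integral_const_mul _ _)) ?_
    exact ((summable_geometric_of_lt_one (by norm_num) (by norm_num)).mul_left _).mul_right _
  have hmain := hasSum_integral_of_summable_integral_norm hFi hsumm
  have hsumeq : ∀ ζ, ∑' j, F j ζ = fourierMeasure σ ψ (WithLp.toLp 2 ζ) *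
      (𝓕⁻ (f 0)) (∑ i, ζ i) * ∏ i : Fin m, (𝓕 (f i.succ)) (ζ i) := by
    intro ζ
    have h1 := Complex.ofRealCLM.hasSum (φ.hasSum_cutoff (WithLp.toLp 2 ζ))
    have h2 := (((h1.mul_right (fourierMeasure σ ψ (WithLp.toLp 2 ζ))).mul_right
      ((𝓕⁻ (f 0)) (∑ i, ζ i))).mul_right (∏ i : Fin m, (𝓕 (f i.succ)) (ζ i))).tsum_eq
    simpa using h2
  simp_rw [hsumeq] at hmain
  exact hmain

/-- The `L^p` bounds below `p = 2`: the pieces grow like `2^{jl}` on `L¹` and decay like `2^{-jγ}`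
on `L²`, and the interpolated bounds are summable in the stated range. -/
lemma SliceDecay.exists_formBound_of_lt_two (hm : m ≠ 0) (h : SliceDecay φ σ ψ C γ)
    (hC : 0 ≤ C) (hγ : 0 < γ) (hψ : Integrable ψ σ) {l : ℕ} {S : ℝ} (hS0 : 0 ≤ S)
    (hS : ∀ j u, ‖littlewoodPaleyPiece φ σ ψ j u‖ ≤ S * ((2 : ℝ) ^ j) ^ l) {p : ℝ≥0∞}
    (hp1 : 1 ≤ p) (hp2 : p ≤ 2) (hp : 2 * (l + γ) / (l + 2 * γ) < p.toReal) :
    ∃ A : ℝ, 0 ≤ A ∧ FormBound (multilinearForm σ hψ) p A := by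
  have hpt : p ≠ ⊤ := (hp2.trans_lt ENNReal.ofNat_lt_top).ne
  obtain ⟨c₀, hc₀, hone⟩ := exists_formBound_one m d
  obtain ⟨c₁, hc₁, htwo⟩ := h.exists_formBound_two_piece hm hC hψ
  set P := p.toReal with hP
  have hP1 : 1 ≤ P := by simpa using ENNReal.toReal_mono hpt hp1
  have hP2 : P ≤ 2 := by simpa using ENNReal.toReal_mono ENNReal.ofNat_ne_top hp2
  -- the solution of `1 / p = (1 - θ) + θ / 2`
  set θ : ℝ := 2 - 2 / P with hθ
  have hdiv1 : 2 / P ≤ 2 := div_le_self (by norm_num) hP1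
  have hdiv2 : 1 ≤ 2 / P := (one_le_div (by linarith)).2 hP2
  have hθ01 : θ ∈ Icc (0 : ℝ) 1 := ⟨by linarith, by linarith⟩
  set e : ℝ := l * (1 - θ) - γ * θ with he
  have he0 : e < 0 := by
    have h1 : 0 < (l : ℝ) + 2 * γ := by positivity
    rw [div_lt_iff₀ h1] at hp
    have h2 : e * P = 2 * (l + γ) - P * (l + 2 * γ) := by
      rw [he, hθ]
      field_simp
      ring
    nlinarith
  have hq1 : (2 : ℝ) ^ e < 1 := Real.rpow_lt_one_of_one_lt_of_neg one_lt_two he0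
  have hq0 : (0 : ℝ) < 2 ^ e := by positivity
  set K : ℝ := (c₀ * S) ^ (1 - θ) * c₁ ^ θ with hK
  have hK0 : 0 ≤ K := by positivity
  have hpiece : ∀ j, FormBound (multilinearForm volume (φ.integrable_littlewoodPaleyPiece hψ j)) p
      (K * ((2 : ℝ) ^ e) ^ j) := by
    intro j
    have h1 := FormBound.interpolate (by simp) le_rfl ENNReal.one_ne_top one_le_two
      ENNReal.ofNat_ne_top hp1 hpt hθ01 ?_ (by positivity) (by positivity)
      (hone _ (φ.integrable_littlewoodPaleyPiece hψ j) _ (hS j)) (htwo j)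
    · convert h1 using 1
      rw [← mul_assoc c₀, Real.mul_rpow (mul_nonneg hc₀ hS0) (by positivity),
        Real.mul_rpow hc₁ (by positivity), hK, he]
      have h2 : (((2 : ℝ) ^ j) ^ l) ^ (1 - θ) = 2 ^ (j * (l * (1 - θ))) := by
        rw [← Real.rpow_natCast, ← Real.rpow_natCast, ← Real.rpow_mul (by norm_num),
          ← Real.rpow_mul (by norm_num)]
      have h3 : ((2 : ℝ) ^ (-(j : ℝ) * γ)) ^ θ = 2 ^ (-(j : ℝ) * (γ * θ)) := by
        rw [← Real.rpow_mul (by norm_num)]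
        ring_nf
      have h4 : ((2 : ℝ) ^ (l * (1 - θ) - γ * θ)) ^ j =
          2 ^ (j * (l * (1 - θ))) * 2 ^ (-(j : ℝ) * (γ * θ)) := by
        rw [← Real.rpow_natCast, ← Real.rpow_mul (by norm_num), ← Real.rpow_add (by norm_num)]
        ring_nf
      rw [h2, h3, h4]
      ring
    · rw [ENNReal.toReal_one, ENNReal.toReal_ofNat, ← hP, hθ]
      field_simp
      ring
  refine ⟨K * (1 - 2 ^ e)⁻¹, mul_nonneg hK0 (inv_nonneg.2 (by linarith)),
    FormBound.of_schwartz (by simp) hp1 hpt fun f => ?_⟩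
  have hgeo : HasSum (fun j : ℕ => K * ((2 : ℝ) ^ e) ^ j *
      ∏ i, (eLpNorm (f i) p volume).toReal)
      (K * (1 - 2 ^ e)⁻¹ * ∏ i, (eLpNorm (f i) p volume).toReal) :=
    ((hasSum_geometric_of_lt_one hq0.le hq1).mul_left _).mul_right _
  rw [← (hasSum_multilinearForm_littlewoodPaleyPiece φ hψ f).tsum_eq]
  refine tsum_of_norm_bounded hgeo fun j => ?_
  have h1 := hpiece j (fun i => (f i).toLp (m + 1)) fun i =>
    ((f i).memLp p volume).ae_eq ((f i).coeFn_toLp (m + 1) volume).symm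
  refine h1.trans_eq ?_
  congr 1
  exact Finset.prod_congr rfl fun i _ => by
    rw [eLpNorm_congr_ae ((f i).coeFn_toLp (m + 1) volume)]

/-- The `L^p` bounds for the form in the whole range; above `p = 2` by interpolation with the
Hölder bound at `p = m + 1`. -/
lemma SliceDecay.exists_formBound (hm : 2 ≤ m) (h : SliceDecay φ σ ψ C γ)
    (hC : 0 ≤ C) (hγ : 0 < γ) (hψ : Integrable ψ σ) {l : ℕ} {S : ℝ} (hS0 : 0 ≤ S)
    (hS : ∀ j u, ‖littlewoodPaleyPiece φ σ ψ j u‖ ≤ S * ((2 : ℝ) ^ j) ^ l) {p : ℝ≥0∞}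
    (hp1 : 1 ≤ p) (hpm : p ≤ m + 1) (hp : 2 * (l + γ) / (l + 2 * γ) < p.toReal) :
    ∃ A : ℝ, 0 ≤ A ∧ FormBound (multilinearForm σ hψ) p A := by
  have hm0 : m ≠ 0 := by omega
  rcases le_total p 2 with hp2 | hp2
  · exact h.exists_formBound_of_lt_two hm0 hC hγ hψ hS0 hS hp1 hp2 hp
  obtain ⟨A₀, hA₀, htwo⟩ := h.exists_formBound_two hm0 hC hγ hψ
  have hmt : ((m : ℝ≥0∞) + 1) ≠ ⊤ := by simp
  have hpt : p ≠ ⊤ := (hpm.trans_lt hmt.lt_top).ne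
  set P := p.toReal with hP
  have hP2 : 2 ≤ P := by simpa using ENNReal.toReal_mono hpt hp2
  have hPm : P ≤ m + 1 := by
    have := ENNReal.toReal_mono hmt hpm
    rwa [ENNReal.toReal_add (by simp) (by simp), ENNReal.toReal_natCast,
      ENNReal.toReal_one] at this
  have hm3 : (3 : ℝ) ≤ m + 1 := by
    have : (2 : ℝ) ≤ m := by exact_mod_cast hm
    linarith
  have hden : 0 < (2 : ℝ)⁻¹ - ((m : ℝ) + 1)⁻¹ := by
    rw [sub_pos]
    gcongr
    linarith
  have hle1 : P⁻¹ ≤ 2⁻¹ := by gcongr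
  have hle2 : ((m : ℝ) + 1)⁻¹ ≤ P⁻¹ := by gcongr
  refine ⟨_, ?_, FormBound.interpolate hmt one_le_two ENNReal.ofNat_ne_top
    (le_trans hp1 hpm) hmt hp1 hpt (θ := (2⁻¹ - P⁻¹) / (2⁻¹ - ((m : ℝ) + 1)⁻¹))
    ⟨div_nonneg (by linarith) hden.le, (div_le_one hden).2 (by linarith)⟩ ?_ hA₀
    (integral_nonneg fun u => norm_nonneg (ψ u)) htwo (formBound_multilinearForm σ hψ)⟩
  · have : 0 ≤ ∫ u, ‖ψ u‖ ∂σ := integral_nonneg fun u => norm_nonneg (ψ u)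
    positivity
  · rw [ENNReal.toReal_add (by simp) (by simp), ENNReal.toReal_natCast, ENNReal.toReal_one,
      ENNReal.toReal_ofNat, ← hP]
    have h1 := div_mul_cancel₀ (2⁻¹ - P⁻¹) hden.ne'
    linear_combination h1

end Summation

/-! ### The multilinear average on Schwartz functions -/

section Average

variable {m d : ℕ} {σ : Measure (TupleSpace m d)} {ψ : TupleSpace m d → ℂ}

lemma memLp_of_integrable_of_norm_le {X : Type*} [MeasurableSpace X] {μ : Measure X} {h : X → ℂ}
    (hh : Integrable h μ) {S : ℝ} (hS : ∀ x, ‖h x‖ ≤ S) {q : ℝ≥0∞} (hq1 : 1 ≤ q) (hq : q ≠ ⊤) :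
    MemLp h q μ := by
  refine ⟨hh.aestronglyMeasurable, ?_⟩
  have hq0 : q ≠ 0 := (zero_lt_one.trans_le hq1).ne'
  have hQ : 1 ≤ q.toReal := by simpa using ENNReal.toReal_mono hq hq1
  rw [eLpNorm_lt_top_iff_lintegral_rpow_enorm_lt_top hq0 hq]
  have hpt : ∀ x, ‖h x‖ₑ ^ q.toReal ≤ ENNReal.ofReal S ^ (q.toReal - 1) * ‖h x‖ₑ := by
    intro x
    conv_lhs => rw [← sub_add_cancel q.toReal 1,
      ENNReal.rpow_add_of_nonneg _ _ (by linarith) zero_le_one, ENNReal.rpow_one]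
    gcongr
    rw [← ofReal_norm]
    exact ENNReal.ofReal_le_ofReal (hS x)
  refine (lintegral_mono hpt).trans_lt ?_
  have hc : ENNReal.ofReal S ^ (q.toReal - 1) ≠ ⊤ :=
    ENNReal.rpow_ne_top_of_nonneg (by linarith) ENNReal.ofReal_ne_top
  rw [lintegral_const_mul' _ _ hc]
  exact ENNReal.mul_lt_top hc.lt_top hh.hasFiniteIntegral

lemma exists_norm_le_schwartz {V : Type*} [NormedAddCommGroup V] [NormedSpace ℝ V] (f : 𝓢(V, ℂ)) :
    ∃ S : ℝ, ∀ v, ‖f v‖ ≤ S := by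
  obtain ⟨S, hS⟩ := SchwartzMap.decay f 0 0
  exact ⟨S, fun v => by simpa using hS.2 v⟩

lemma exists_norm_prod_schwartz_le (s : Finset (Fin m))
    (f : Fin m → 𝓢(EuclideanSpace ℝ (Fin d), ℂ)) :
    ∃ S : ℝ, 0 ≤ S ∧ ∀ v : Fin m → EuclideanSpace ℝ (Fin d), ‖∏ j ∈ s, f j (v j)‖ ≤ S := by
  choose S hS using fun j => exists_norm_le_schwartz (f j)
  refine ⟨∏ j ∈ s, S j, Finset.prod_nonneg fun j _ => (norm_nonneg _).trans (hS j 0), fun v => ?_⟩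
  rw [norm_prod]
  exact Finset.prod_le_prod (fun j _ => norm_nonneg _) fun j _ => hS j _

lemma integrable_prod_schwartz_mul (hψ : Integrable ψ σ)
    (f : Fin m → 𝓢(EuclideanSpace ℝ (Fin d), ℂ)) (x : EuclideanSpace ℝ (Fin d)) :
    Integrable (fun u => (∏ j, f j (x - u j)) * ψ u) σ := by
  obtain ⟨S, -, hS⟩ := exists_norm_prod_schwartz_le Finset.univ f
  refine hψ.bdd_mul (c := S) (Continuous.aestronglyMeasurable ?_) (ae_of_all _ fun u => hS _)
  exact continuous_finsetProd _ fun j _ => (f j).continuous.comp (by fun_prop)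

/-- The product `f₁(x - u¹) ⋯ f_m(x - uᵐ)` as a multilinear function of Schwartz functions. -/
def schwartzProduct (m d : ℕ) (x : EuclideanSpace ℝ (Fin d)) (u : TupleSpace m d) :
    MultilinearMap ℂ (fun _ : Fin m => 𝓢(EuclideanSpace ℝ (Fin d), ℂ)) ℂ :=
  (MultilinearMap.mkPiAlgebra ℂ (Fin m) ℂ).compLinearMap fun j =>
    { toFun := fun f => f (x - u j)
      map_add' := fun _ _ => rfl
      map_smul' := fun _ _ => rfl }

lemma schwartzProduct_apply (x : EuclideanSpace ℝ (Fin d)) (u : TupleSpace m d)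
    (f : Fin m → 𝓢(EuclideanSpace ℝ (Fin d), ℂ)) :
    schwartzProduct m d x u f = ∏ j, f j (x - u j) := by
  simp [schwartzProduct]

/-- The multilinear average, as a multilinear map on Schwartz functions. -/
def schwartzAverage (hψ : Integrable ψ σ) :
    MultilinearMap ℂ (fun _ : Fin m => 𝓢(EuclideanSpace ℝ (Fin d), ℂ))
      (EuclideanSpace ℝ (Fin d) → ℂ) where
  toFun f x := ∫ u, schwartzProduct m d x u f * ψ u ∂σ
  map_update_add' := by
    intro _ f i a b
    ext x
    have h : ∀ f, Integrable (fun u => schwartzProduct m d x u f * ψ u) σ := fun f => by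
      simpa only [schwartzProduct_apply] using integrable_prod_schwartz_mul hψ f x
    rw [Pi.add_apply, ← integral_add (h _) (h _)]
    simp only [MultilinearMap.map_update_add, add_mul]
  map_update_smul' := by
    intro _ f i c a
    ext x
    rw [Pi.smul_apply, smul_eq_mul, ← integral_const_mul]
    simp only [MultilinearMap.map_update_smul, smul_eq_mul, mul_assoc]

lemma schwartzAverage_apply (hψ : Integrable ψ σ) (f : Fin m → 𝓢(EuclideanSpace ℝ (Fin d), ℂ)) :
    schwartzAverage hψ f = multilinearAverage σ ψ (fun j => ⇑(f j)) := by
  ext x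
  simp only [schwartzAverage, MultilinearMap.coe_mk, schwartzProduct_apply, multilinearAverage]

variable [SFinite σ]

lemma integrable_multilinearAverage (hm : m ≠ 0) (hψ : Integrable ψ σ)
    (f : Fin m → 𝓢(EuclideanSpace ℝ (Fin d), ℂ)) :
    Integrable (multilinearAverage σ ψ (fun j => ⇑(f j))) := by
  let i : Fin m := ⟨0, Nat.pos_of_ne_zero hm⟩
  have hmp : MeasurePreserving (fun z : TupleSpace m d × EuclideanSpace ℝ (Fin d) =>
      (z.1, z.2 - z.1 i)) (σ.prod volume) (σ.prod volume) :=
    MeasurePreserving.skew_product (f := id) (MeasurePreserving.id σ)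
      (g := fun (u : TupleSpace m d) (x : EuclideanSpace ℝ (Fin d)) => x - u i) (by fun_prop)
      (ae_of_all _ fun u => (measurePreserving_sub_right volume (u i)).map_eq)
  have h1 : Integrable (fun z : TupleSpace m d × EuclideanSpace ℝ (Fin d) =>
      ψ z.1 * f i (z.2 - z.1 i)) (σ.prod volume) :=
    hmp.integrable_comp_of_integrable (hψ.mul_prod (f i).integrable)
  obtain ⟨S, -, hS⟩ := exists_norm_prod_schwartz_le (Finset.univ.erase i) f
  have h2 : Integrable (fun z : TupleSpace m d × EuclideanSpace ℝ (Fin d) =>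
      (∏ j ∈ Finset.univ.erase i, f j (z.2 - z.1 j)) * (ψ z.1 * f i (z.2 - z.1 i)))
      (σ.prod volume) := by
    refine h1.bdd_mul (c := S) (Continuous.aestronglyMeasurable ?_) (ae_of_all _ fun z => hS _)
    exact continuous_finsetProd _ fun j _ => (f j).continuous.comp (by fun_prop)
  refine h2.integral_prod_right.congr (ae_of_all _ fun x => ?_)
  refine integral_congr_ae (ae_of_all _ fun u => ?_)
  simp only
  rw [← Finset.mul_prod_erase Finset.univ (fun j => f j (x - u j)) (Finset.mem_univ i)]
  ring

lemma memLp_multilinearAverage (hm : m ≠ 0) (hψ : Integrable ψ σ)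
    (f : Fin m → 𝓢(EuclideanSpace ℝ (Fin d), ℂ)) {q : ℝ≥0∞} (hq1 : 1 ≤ q) (hq : q ≠ ⊤) :
    MemLp (multilinearAverage σ ψ (fun j => ⇑(f j))) q volume := by
  obtain ⟨S, hS0, hS⟩ := exists_norm_prod_schwartz_le Finset.univ f
  refine memLp_of_integrable_of_norm_le (integrable_multilinearAverage hm hψ f)
    (S := S * ∫ u, ‖ψ u‖ ∂σ) (fun x => ?_) hq1 hq
  refine (norm_integral_le_integral_norm _).trans ?_
  rw [← integral_const_mul]
  refine integral_mono (integrable_prod_schwartz_mul hψ f x).norm (hψ.norm.const_mul _)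
    fun u => ?_
  simp only [norm_mul]
  gcongr
  exact hS _

/-- A bound for the form gives by duality a bounded extension of the multilinear average. -/
lemma FormBound.exists_isBoundedExtension (hm : m ≠ 0) (hψ : Integrable ψ σ) {p q : ℝ≥0∞}
    [Fact (1 ≤ p)] [Fact (1 ≤ q)] (hpq : p.HolderConjugate q) (hp1 : 1 < p) (hp : p ≠ ⊤)
    {A : ℝ} (hA : 0 ≤ A) (h : FormBound (multilinearForm σ hψ) p A) :
    ∃ T : ContinuousMultilinearMap ℂ
        (fun _ : Fin m => Lp ℂ p (volume : Measure (EuclideanSpace ℝ (Fin d))))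
        (Lp ℂ q (volume : Measure (EuclideanSpace ℝ (Fin d)))),
      IsBoundedExtension p q (multilinearAverage σ ψ) T := by
  have hq : q ≠ ⊤ := by
    rintro rfl
    have h1 := ENNReal.HolderConjugate.inv_add_inv_eq_one p ⊤
    rw [ENNReal.inv_top, add_zero, ENNReal.inv_eq_one] at h1
    exact hp1.ne' h1
  have hmem : ∀ f : Fin m → 𝓢(EuclideanSpace ℝ (Fin d), ℂ), MemLp (schwartzAverage hψ f) q volume :=
    fun f => by
      rw [schwartzAverage_apply]
      exact memLp_multilinearAverage hm hψ f Fact.out hq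
  have hbound : ∀ f : Fin m → 𝓢(EuclideanSpace ℝ (Fin d), ℂ),
      (eLpNorm (schwartzAverage hψ f) q volume).toReal ≤
        A * ∏ j, (eLpNorm (f j) p volume).toReal := by
    intro f
    refine eLpNorm_le_of_schwartz_pairing hpq hp1 hp (hmem f)
      (mul_nonneg hA (Finset.prod_nonneg fun j _ => ENNReal.toReal_nonneg)) fun g => ?_
    have h1 := h (fun i => (Fin.cons g f : Fin (m + 1) → 𝓢(EuclideanSpace ℝ (Fin d), ℂ)) i |>.toLp
      (m + 1)) fun i => ((Fin.cons g f : Fin (m + 1) → 𝓢(EuclideanSpace ℝ (Fin d), ℂ)) i |>.memLp p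
        volume).ae_eq (SchwartzMap.coeFn_toLp _ (m + 1) volume).symm
    rw [multilinearForm_toLp, Fin.prod_univ_succ] at h1
    simp only [Fin.cons_zero, Fin.cons_succ] at h1
    simp_rw [eLpNorm_congr_ae (SchwartzMap.coeFn_toLp _ ((m : ℝ≥0∞) + 1) volume)] at h1
    rw [schwartzAverage_apply]
    simp_rw [mul_comm (multilinearAverage σ ψ (fun j => ⇑(f j)) _)]
    refine h1.trans_eq ?_
    ring
  obtain ⟨T, hT⟩ := exists_extension_of_schwartz_bound (p := p) (q := q) hp (schwartzAverage hψ)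
    hmem hbound
  exact ⟨T, fun f => (hT f).trans (by rw [schwartzAverage_apply])⟩

end Average

/-! ### Sobolev regularity -/

section Sobolev

variable {m d : ℕ} {φ : LittlewoodPaley (TupleSpace m d)} {σ : Measure (TupleSpace m d)}
  {ψ : TupleSpace m d → ℂ} {C γ : ℝ} [SFinite σ]

/-- The bounded extension to `L²` gains `γ` derivatives. -/
lemma SliceDecay.exists_besselPotential (hm : m ≠ 0) (h : SliceDecay φ σ ψ C γ)
    (hC : 0 ≤ C) (hγ : 0 < γ) (hψ : Integrable ψ σ)
    (T : ContinuousMultilinearMap ℂ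
        (fun _ : Fin m => Lp ℂ 2 (volume : Measure (EuclideanSpace ℝ (Fin d))))
        (Lp ℂ 2 (volume : Measure (EuclideanSpace ℝ (Fin d)))))
    (hT : IsBoundedExtension 2 2 (multilinearAverage σ ψ) T) :
    ∃ C : ℝ, ∀ f : Fin m → Lp ℂ 2 (volume : Measure (EuclideanSpace ℝ (Fin d))),
      ∃ g : Lp ℂ 2 (volume : Measure (EuclideanSpace ℝ (Fin d))),
        TemperedDistribution.besselPotential (EuclideanSpace ℝ (Fin d)) ℂ γ (T f) = g ∧
        ‖g‖ ≤ C * ∏ j, ‖f j‖ := by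
  obtain ⟨C', hC', hw⟩ := h.exists_lintegral_weighted_le hm hC hγ hψ
  refine ⟨C', fun f => ?_⟩
  set w : EuclideanSpace ℝ (Fin d) → ℂ := fun x => (((1 + ‖x‖ ^ 2) ^ (γ / 2) : ℝ) : ℂ) with hwdef
  have hwt : w.HasTemperateGrowth := by
    rw [hwdef]
    fun_prop
  have hschwartz : ∀ (u : 𝓢(EuclideanSpace ℝ (Fin d), ℂ))
      (f : Fin m → 𝓢(EuclideanSpace ℝ (Fin d), ℂ)),
      ‖MeasureTheory.Lp.toTemperedDistribution (T fun j => (f j).toLp 2)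
        (𝓕 (SchwartzMap.smulLeftCLM ℂ w (𝓕⁻ u)))‖ ≤
      C' * (∏ j, ‖(f j).toLp 2 volume‖) * (eLpNorm u 2 volume).toReal := by
    intro u f
    set v : 𝓢(EuclideanSpace ℝ (Fin d), ℂ) := 𝓕 (SchwartzMap.smulLeftCLM ℂ w (𝓕⁻ u)) with hv
    have h1 : MeasureTheory.Lp.toTemperedDistribution (T fun j => (f j).toLp 2) v =
        multilinearForm σ hψ (fun i =>
          (Fin.cons v f : Fin (m + 1) → 𝓢(EuclideanSpace ℝ (Fin d), ℂ)) i |>.toLp (m + 1)) := by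
      rw [MeasureTheory.Lp.toTemperedDistribution_apply, multilinearForm_toLp]
      simp only [Fin.cons_zero, Fin.cons_succ, smul_eq_mul]
      refine integral_congr_ae ?_
      filter_upwards [hT f] with x hx
      rw [hx]
    rw [h1, multilinearForm_toLp_eq_integral_fourier]
    simp only [Fin.cons_zero, Fin.cons_succ]
    have h2 := hw f (𝓕⁻ u)
    rw [eLpNorm_fourierInv_schwartz] at h2
    have h3 : ‖∫ ζ : Fin m → EuclideanSpace ℝ (Fin d),
        fourierMeasure σ ψ (WithLp.toLp 2 ζ) * (𝓕⁻ v) (∑ j, ζ j) *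
          ∏ j : Fin m, (𝓕 (f j)) (ζ j)‖ₑ ≤
        ENNReal.ofReal C' * eLpNorm u 2 volume * ∏ i, eLpNorm (f i) 2 volume := by
      refine (enorm_integral_le_lintegral_enorm _).trans (le_trans (le_of_eq ?_) h2)
      refine lintegral_congr fun ζ => ?_
      rw [enorm_mul, enorm_mul, enorm_finsetProd, hv, FourierTransform.fourierInv_fourier_eq,
        SchwartzMap.smulLeftCLM_apply_apply hwt, smul_eq_mul, enorm_mul]
      congr 3
      rw [hwdef, ← ofReal_norm, Complex.norm_real, Real.norm_of_nonneg (by positivity)]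
    have h4 := ENNReal.toReal_mono (ENNReal.mul_ne_top (ENNReal.mul_ne_top ENNReal.ofReal_ne_top
      (u.memLp 2 volume).eLpNorm_ne_top)
      (ENNReal.prod_ne_top fun i _ => ((f i).memLp 2 volume).eLpNorm_ne_top)) h3
    rw [toReal_enorm, ENNReal.toReal_mul, ENNReal.toReal_mul, ENNReal.toReal_ofReal hC',
      ENNReal.toReal_prod] at h4
    refine h4.trans_eq ?_
    simp_rw [SchwartzMap.norm_toLp]
    ring
  have hdense : DenseRange fun (f : Fin m → 𝓢(EuclideanSpace ℝ (Fin d), ℂ)) j =>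
      SchwartzMap.toLpCLM ℝ ℂ 2 (volume : Measure (EuclideanSpace ℝ (Fin d))) (f j) :=
    DenseRange.piMap fun _ => SchwartzMap.denseRange_toLpCLM ENNReal.ofNat_ne_top
  have hall : ∀ (u : 𝓢(EuclideanSpace ℝ (Fin d), ℂ)),
      ‖MeasureTheory.Lp.toTemperedDistribution (T f)
        (𝓕 (SchwartzMap.smulLeftCLM ℂ w (𝓕⁻ u)))‖ ≤
      C' * (∏ j, ‖f j‖) * (eLpNorm u 2 volume).toReal := by
    intro u
    refine hdense.induction_on (p := fun f => ‖MeasureTheory.Lp.toTemperedDistribution (T f)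
        (𝓕 (SchwartzMap.smulLeftCLM ℂ w (𝓕⁻ u)))‖ ≤
      C' * (∏ j, ‖f j‖) * (eLpNorm u 2 volume).toReal) f ?_ (hschwartz u)
    refine isClosed_le (Continuous.norm ?_) (by fun_prop)
    exact (PointwiseConvergenceCLM.evalCLM (RingHom.id ℂ) ℂ
      (𝓕 (SchwartzMap.smulLeftCLM ℂ w (𝓕⁻ u)))).continuous.comp
      ((MeasureTheory.Lp.toTemperedDistributionCLM ℂ
        (volume : Measure (EuclideanSpace ℝ (Fin d))) 2).continuous.comp T.cont)
  obtain ⟨g, hg, hgu⟩ := exists_L2_representative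
    ((TemperedDistribution.besselPotential (EuclideanSpace ℝ (Fin d)) ℂ γ (T f)).toLinearMap)
    (C := C' * ∏ j, ‖f j‖) (by positivity) hall
  refine ⟨g, ?_, hg⟩
  ext u
  rw [MeasureTheory.Lp.toTemperedDistribution_apply]
  exact hgu u

end Sobolev

/-! ### Conclusion -/

lemma finrank_tupleSpace (m d : ℕ) : Module.finrank ℝ (TupleSpace m d) = m * d := by
  rw [(WithLp.linearEquiv 2 ℝ (Fin m → EuclideanSpace ℝ (Fin d))).finrank_eq,
    Module.finrank_pi_fintype]
  simp

end

theorem theorem2p3 (m d k l : ℕ) (hm : 2 ≤ m) (hd : 1 ≤ d) (hkl : k + l = m * d)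
    (M : Set (TupleSpace m d)) (hMc : IsCompact M) (hM : IsSmoothSubmanifold k M)
    (ψ : TupleSpace m d → ℂ) (hψ : ContDiff ℝ ∞ ψ)
    (φ : LittlewoodPaley (TupleSpace m d)) (γ : ℝ) (hγ : 0 < γ)
    (hdecay : ∃ C : ℝ, ∀ j : ℕ,
      lambdaNorm (diagonalSubspace m d) 2 ∞
          (littlewoodPaleyPiece φ (surfaceMeasure k M) ψ j) ≤
        ENNReal.ofReal (C * (2 : ℝ) ^ (-(j : ℝ) * γ))) :
    (∃ T : ContinuousMultilinearMap ℂ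
        (fun _ : Fin m => Lp ℂ 2 (volume : Measure (EuclideanSpace ℝ (Fin d))))
        (Lp ℂ 2 (volume : Measure (EuclideanSpace ℝ (Fin d)))),
      IsBoundedExtension 2 2 (multilinearAverage (surfaceMeasure k M) ψ) T ∧
      ∃ C : ℝ, ∀ f : Fin m → Lp ℂ 2 (volume : Measure (EuclideanSpace ℝ (Fin d))),
        ∃ g : Lp ℂ 2 (volume : Measure (EuclideanSpace ℝ (Fin d))),
          TemperedDistribution.besselPotential (EuclideanSpace ℝ (Fin d)) ℂ γ (T f) = g ∧
          ‖g‖ ≤ C * ∏ j, ‖f j‖) ∧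
    (∀ (p q : ℝ≥0∞) [Fact (1 ≤ p)] [Fact (1 ≤ q)], p.HolderConjugate q →
      ENNReal.ofReal (2 * (l + γ) / (l + 2 * γ)) < p → p ≤ m + 1 →
      ∃ T : ContinuousMultilinearMap ℂ
          (fun _ : Fin m => Lp ℂ p (volume : Measure (EuclideanSpace ℝ (Fin d))))
          (Lp ℂ q (volume : Measure (EuclideanSpace ℝ (Fin d)))),
        IsBoundedExtension p q (multilinearAverage (surfaceMeasure k M) ψ) T) := by
  have hm0 : m ≠ 0 := by omega
  have hfin := hM.isFiniteMeasure_surfaceMeasure hMc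
  have hψi : Integrable ψ (surfaceMeasure k M) :=
    integrable_surfaceMeasure_of_continuous hM hMc hψ.continuous
  obtain ⟨C₀, hC₀⟩ := hdecay
  obtain ⟨C, hC, hdec⟩ : ∃ C : ℝ, 0 ≤ C ∧ SliceDecay φ (surfaceMeasure k M) ψ C γ := by
    refine ⟨max C₀ 0, le_max_right _ _, sliceDecay_of_lambdaNorm_le hψi fun j => (hC₀ j).trans ?_⟩
    gcongr
    exact le_max_left _ _
  obtain ⟨Cσ, hCσ, hball⟩ := hM.exists_surfaceMeasure_closedBall_le hMc
  obtain ⟨S, hS, hψS⟩ := exists_ae_norm_le_surfaceMeasure (k := k) hMc hψ.continuous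
  obtain ⟨S', hS', hpiece⟩ := φ.exists_norm_littlewoodPaleyPiece_le hψi hS hψS
    (hkl.trans (finrank_tupleSpace m d).symm) hCσ hball
  refine ⟨?_, ?_⟩
  · obtain ⟨A, hA, hform⟩ := hdec.exists_formBound_two hm0 hC hγ hψi
    obtain ⟨T, hT⟩ := hform.exists_isBoundedExtension (q := 2) hm0 hψi inferInstance
      ENNReal.one_lt_two ENNReal.ofNat_ne_top hA
    exact ⟨T, hT, hdec.exists_besselPotential hm0 hC hγ hψi T hT⟩
  · intro p q _ _ hpq hcrit hpm
    have hpt : p ≠ ⊤ := (hpm.trans_lt (by simp [lt_top_iff_ne_top])).ne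
    have hl : (0 : ℝ) < l + 2 * γ := by positivity
    -- the critical exponent is at least `1`
    have hp1 : 1 < p := by
      refine lt_of_le_of_lt ?_ hcrit
      rw [← ENNReal.ofReal_one]
      refine ENNReal.ofReal_le_ofReal ((one_le_div hl).2 ?_)
      have : (0 : ℝ) ≤ l := Nat.cast_nonneg l
      linarith
    have hcrit' : 2 * (l + γ) / (l + 2 * γ) < p.toReal :=
      (ENNReal.ofReal_lt_iff_lt_toReal (by positivity) hpt).1 hcrit
    obtain ⟨A, hA, hform⟩ := hdec.exists_formBound hm hC hγ hψi hS' hpiece hp1.le hpm hcrit'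
    exact hform.exists_isBoundedExtension hm0 hψi hpq hp1 hpt hA
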